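/- Let $d\ge 1$, let $\Omega\subseteq\mathbb R^d$ be a non-empty open set, and let $V=V_1+iV_2\in\mathcal C^1(\overline\Omega;\mathbb C)$ ($V_1,V_2$ real) and $\mathbf A\in\mathcal C^2(\overline\Omega;\mathbb R^d)$, i.e. the derivatives up to order $1$, respectively $2$, exist and are continuous in $\Omega$ and extend continuously to $\overline\Omega$. Put $$B_{jk}=\partial_jA_k-\partial_kA_j,\quad |\mathbf B|^2=\sum_{j,k}B_{jk}^2,\quad m=\sqrt{1+|\mathbf B|^2+|V|^2},\quad \Phi=\frac{V_2}{m},\quad \Psi=\frac{\mathbf B}{m},\quad |\nabla\Psi|^2=\sum_{j,k}|\nabla\Psi_{jk}|^2 .$$ Assume that $\gamma_1>0$ and $\gamma_2\in\mathbb R$ are such that, everywhere in $\Omega$, $$\frac{V_2^2+\frac1{12d}|\mathbf B|^2}{m}+V_1-9\left(|\nabla\Phi|^2+|\nabla\Psi|^2\right)\ \ge\ \gamma_1|V|-\gamma_2 .$$ Let $H^1_{\mathbf A}(\Omega)=\{u\in L^2(\Omega):(-i\nabla+\mathbf A)u\in L^2(\Omega)\}$ (in the sense of distributions), with norm $\left(\|u\|^2+\|(-i\nabla+\mathbf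 A)u\|^2\right)^{1/2}$, let $H^1_{\mathbf A,0}(\Omega)$ be the closure of $\mathcal C_0^\infty(\Omega)$ in it, and let $\mathscr V=\{u\in H^1_{\mathbf A,0}(\Omega):|V|^{1/2}u\in L^2(\Omega)\}$. For $u,v\in\mathscr V$ let $$Q(u,v)=\langle(-i\nabla+\mathbf A)u,(-i\nabla+\mathbf A)v\rangle+\int_\Omega Vu\bar v\,\mathrm dx .$$ Let $\mathscr L$ be the operator in $L^2(\Omega)$ whose domain consists of all $u\in\mathscr V$ for which $v\mapsto Q(u,v)$ is continuous on $\mathscr V$ for the norm of $L^2(\Omega)$, and which is determined by $Q(u,v)=\langle\mathscr Lu,v\rangle$ for all $v\in\mathscr V$. Its spectrum $\mathsf{sp}(\mathscr L)$ is the set of all $\mu\in\mathbb C$ such that $\mathscr L-\mu:\mathsf{Dom}(\mathscr L)\to L^2(\Omega)$ is not bijective. Let $V_\infty=\liminf_{x\in\Omega,\,|x|\to\infty}|V(x)|\in[0,\infty]$ (equal to $+\infty$ if $\Omega$ is bounded), let $\check V_\infty\in(0,V_\infty)$ be a real number, and for $c\in\mathbb R$ let $\rho_c=\{\mu\in\mathbb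 C:-c-\operatorname{Re}\mu-|\operatorname{Im}\mu|>0\}$. Let $$\lambda\in\mathsf{sp}(\mathscr L)\cap\rho_{\gamma_2-\gamma_1\check V_\infty}.$$ Fix a point in every connected component of $\Omega$ (a single point of $\Omega$ if $\Omega$ is connected), and for $x\in\Omega$ let $\mathrm d_{\mathsf{Ag}}(x)$ be the Agmon distance of $x$ to the fixed point of its component, i.e. the infimum, over all $\mathcal C^1$ curves $c:[0,1]\to\Omega$ joining these two points, of the length of $c$ for the (degenerate) metric $(\gamma_1|V|-\operatorname{Re}\lambda-|\operatorname{Im}\lambda|-\gamma_2)_+\,\mathrm dx^2$: $$\int_0^1\sqrt{\left(\gamma_1|V(c(t))|-\operatorname{Re}\lambda-|\operatorname{Im}\lambda|-\gamma_2\right)_+}\;|c'(t)|\,\mathrm dt .$$ Then, for every $\varepsilon\in(0,1)$, every eigenfunction $\psi$ of $\mathscr L$ associated with $\lambda$ satisfies $$e^{\frac{1-\varepsilon}{3}\mathrm d_{\mathsf{Ag}}}\,\psi\in L^2(\Omega),$$ and the same holds for every $\psi$ in the algebraic eigenspace $\bigcup_{k\ge1}\operatorname{Ker}\left((\mathscr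 L-\lambda)^k\right)$. -/

import Mathlib

open MeasureTheory Filter Topology Set
open scoped ENNReal ContDiff ComplexConjugate

noncomputable section

/-- Euclidean space `ℝ^d`. -/
abbrev Eucl (d : ℕ) : Type := EuclideanSpace ℝ (Fin d)

/-- `L²(Ω)` with complex values, with respect to Lebesgue measure. -/
abbrev LTwo {d : ℕ} (Ω : Set (Eucl d)) : Type := Lp ℂ 2 (volume.restrict Ω)

/-- The `j`-th standard basis vector. -/
abbrev basisVec {d : ℕ} (j : Fin d) : Eucl d := EuclideanSpace.single j 1

/-- `f ∈ 𝒞ᵏ(Ω̄)`: `f` is `𝒞ᵏ` in the open set `Ω` and all its derivatives up to order `k`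
extend continuously to the closure of `Ω`. -/
def ContDiffUpToClosure {d : ℕ} {F : Type*} [NormedAddCommGroup F] [NormedSpace ℝ F]
    (k : ℕ) (f : Eucl d → F) (Ω : Set (Eucl d)) : Prop :=
  ContDiffOn ℝ k f Ω ∧
    ∀ j : ℕ, j ≤ k → ∃ g : Eucl d → (Eucl d) [×j]→L[ℝ] F,
      ContinuousOn g (closure Ω) ∧ EqOn g (iteratedFDeriv ℝ j f) Ω

/-- A non-empty open set `Ω ⊆ ℝ^d` with an electric potential `V ∈ 𝒞¹(Ω̄; ℂ)` and a magnetic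
vector potential `A ∈ 𝒞²(Ω̄; ℝ^d)`. (The values outside `Ω` play no role.) -/
structure EMSystem (d : ℕ) where
  Ω : Set (Eucl d)
  V : Eucl d → ℂ
  A : Eucl d → Eucl d
  isOpen_Ω : IsOpen Ω
  nonempty_Ω : Ω.Nonempty
  smooth_V : ContDiffUpToClosure 1 V Ω
  smooth_A : ContDiffUpToClosure 2 A Ω

/-- Test functions: `φ ∈ 𝒞_0^∞(Ω)`. -/
def IsTestFunction {d : ℕ} (Ω : Set (Eucl d)) (φ : Eucl d → ℂ) : Prop :=
  ContDiff ℝ ∞ φ ∧ HasCompactSupport φ ∧ tsupport φ ⊆ Ω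

namespace EMSystem

variable {d : ℕ} (S : EMSystem d)

/-! ### The magnetic field and the pointwise hypothesis on the potentials -/

/-- The magnetic matrix `B_{jk} = ∂_j A_k - ∂_k A_j`. -/
def B (j k : Fin d) (x : Eucl d) : ℝ :=
  fderiv ℝ S.A x (basisVec j) k - fderiv ℝ S.A x (basisVec k) j

/-- `|B(x)|²`. -/
def normSqB (x : Eucl d) : ℝ := ∑ j, ∑ k, S.B j k x ^ 2

/-- `m_{B,V} = √(1 + |B|² + |V|²)`. -/
def mBV (x : Eucl d) : ℝ := √(1 + S.normSqB x + ‖S.V x‖ ^ 2)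

/-- `Φ = V₂ / m_{B,V}`, where `V₂ = Im V`. -/
def Φ (x : Eucl d) : ℝ := (S.V x).im / S.mBV x

/-- `Ψ_{jk} = B_{jk} / m_{B,V}`. -/
def Ψ (j k : Fin d) (x : Eucl d) : ℝ := S.B j k x / S.mBV x

/-- The main hypothesis: the weighted-coercivity inequality with constants `γ₁`, `γ₂`. -/
def PotentialBound (γ₁ γ₂ : ℝ) : Prop :=
  ∀ x ∈ S.Ω,
    γ₁ * ‖S.V x‖ - γ₂ ≤
      ((S.V x).im ^ 2 + 1 / (12 * (d : ℝ)) * S.normSqB x) / S.mBV x + (S.V x).re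
        - 9 * (‖gradient S.Φ x‖ ^ 2 + ∑ j, ∑ k, ‖gradient (S.Ψ j k) x‖ ^ 2)

/-! ### Magnetic derivatives and the form domain -/

/-- `P_j φ = (-i ∂_j + A_j) φ` for a differentiable function `φ`. -/
def magTest (j : Fin d) (φ : Eucl d → ℂ) (x : Eucl d) : ℂ :=
  -Complex.I * fderiv ℝ φ x (basisVec j) + (S.A x j : ℂ) * φ x

/-- `w = (-i ∂_j + A_j) u` in the sense of distributions on `Ω`. -/
def HasMagDeriv (j : Fin d) (u w : LTwo S.Ω) : Prop :=
  ∀ φ : Eucl d → ℂ, IsTestFunction S.Ω φ →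
    ∫ x in S.Ω, u x * conj (S.magTest j φ x) = ∫ x in S.Ω, w x * conj (φ x)

open Classical in
/-- The distributional `(-i ∂_j + A_j) u` if it belongs to `L²(Ω)` (and `0` otherwise). -/
def magDeriv (j : Fin d) (u : LTwo S.Ω) : LTwo S.Ω :=
  if h : ∃ w, S.HasMagDeriv j u w then h.choose else 0

theorem continuousOn_V : ContinuousOn S.V S.Ω := S.smooth_V.1.continuousOn

theorem continuousOn_A : ContinuousOn S.A S.Ω := S.smooth_A.1.continuousOn

theorem continuous_mul_test {f g : Eucl d → ℂ} (hf : ContinuousOn f S.Ω) (hg : Continuous g)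
    (hs : tsupport g ⊆ S.Ω) : Continuous (fun x => f x * g x) := by
  refine continuous_of_tsupport fun x hx => ?_
  have hx' : x ∈ S.Ω := hs (tsupport_mul_subset_right hx)
  exact (hf.continuousAt (S.isOpen_Ω.mem_nhds hx')).mul hg.continuousAt

theorem continuous_magTest (j : Fin d) {φ : Eucl d → ℂ} (hφ : IsTestFunction S.Ω φ) :
    Continuous (S.magTest j φ) := by
  have h1 : Continuous (fun x => fderiv ℝ φ x (basisVec j)) :=
    (hφ.1.continuous_fderiv (by simp)).clm_apply continuous_const
  have hA : ContinuousOn (fun x => ((S.A x j : ℝ) : ℂ)) S.Ω :=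
    Complex.continuous_ofReal.comp_continuousOn
      ((EuclideanSpace.proj j : Eucl d →L[ℝ] ℝ).continuous.comp_continuousOn S.continuousOn_A)
  exact (continuous_const.mul h1).add (S.continuous_mul_test hA hφ.1.continuous hφ.2.2)

theorem hasCompactSupport_magTest (j : Fin d) {φ : Eucl d → ℂ} (hφ : IsTestFunction S.Ω φ) :
    HasCompactSupport (S.magTest j φ) := by
  have h1 : HasCompactSupport (fun x => fderiv ℝ φ x (basisVec j)) :=
    hφ.2.1.fderiv_apply (𝕜 := ℝ) (basisVec j)
  exact (h1.mul_left (f := fun _ => -Complex.I)).add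
    (hφ.2.1.mul_left (f := fun x => ((S.A x j : ℝ) : ℂ)))

theorem memLp_magTest (j : Fin d) {φ : Eucl d → ℂ} (hφ : IsTestFunction S.Ω φ) :
    MemLp (S.magTest j φ) 2 (volume.restrict S.Ω) :=
  ((S.continuous_magTest j hφ).memLp_of_hasCompactSupport
    (S.hasCompactSupport_magTest j hφ)).restrict _

theorem _root_.IsTestFunction.memLp {Ω : Set (Eucl d)} {φ : Eucl d → ℂ}
    (hφ : IsTestFunction Ω φ) : MemLp φ 2 (volume.restrict Ω) :=
  (hφ.1.continuous.memLp_of_hasCompactSupport hφ.2.1).restrict _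

theorem integrable_mul_conj {Ω : Set (Eucl d)} {f g : Eucl d → ℂ}
    (hf : MemLp f 2 (volume.restrict Ω)) (hg : MemLp g 2 (volume.restrict Ω)) :
    Integrable (fun x => f x * conj (g x)) (volume.restrict Ω) :=
  hf.integrable_mul hg.star

/-- An element of `L²(Ω)` orthogonal to all test functions vanishes. -/
theorem eq_zero_of_test (w : LTwo S.Ω)
    (h : ∀ φ : Eucl d → ℂ, IsTestFunction S.Ω φ → ∫ x in S.Ω, w x * conj (φ x) = 0) :
    w = 0 := by
  have hloc : LocallyIntegrableOn (fun x => w x) S.Ω (volume.restrict S.Ω) :=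
    ((Lp.memLp w).locallyIntegrable (by norm_num)).locallyIntegrableOn _
  have := S.isOpen_Ω.ae_eq_zero_of_integral_contDiff_smul_eq_zero hloc (by
    intro g hg hgs hgt
    have ht : IsTestFunction S.Ω (fun x => (g x : ℂ)) := by
      have hsub : tsupport (fun x => (g x : ℂ)) ⊆ tsupport g :=
        closure_mono (fun x hx hx' => hx (by simp [hx']))
      exact ⟨Complex.ofRealCLM.contDiff.comp hg, hgs.comp_left (g := fun t : ℝ => (t : ℂ)) (by simp),
        hsub.trans hgt⟩
    have := h _ ht
    simp only [Complex.conj_ofReal] at this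
    rw [← this]
    refine integral_congr_ae (Eventually.of_forall fun x => ?_)
    simp [mul_comm])
  rw [Lp.eq_zero_iff_ae_eq_zero]
  filter_upwards [this, ae_restrict_mem S.isOpen_Ω.measurableSet] with x hx hxΩ
  exact hx hxΩ

variable {S}

theorem HasMagDeriv.unique {j : Fin d} {u w w' : LTwo S.Ω} (h : S.HasMagDeriv j u w)
    (h' : S.HasMagDeriv j u w') : w = w' := by
  rw [← sub_eq_zero]
  refine S.eq_zero_of_test _ fun φ hφ => ?_
  have e : ∫ x in S.Ω, (w - w' : LTwo S.Ω) x * conj (φ x)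
      = ∫ x in S.Ω, (w x * conj (φ x) - w' x * conj (φ x)) := by
    refine integral_congr_ae ?_
    filter_upwards [Lp.coeFn_sub w w'] with x hx
    rw [hx, Pi.sub_apply, sub_mul]
  rw [e, integral_sub (integrable_mul_conj (Lp.memLp w) hφ.memLp)
    (integrable_mul_conj (Lp.memLp w') hφ.memLp), ← h φ hφ, ← h' φ hφ, sub_self]

theorem HasMagDeriv.magDeriv_eq {j : Fin d} {u w : LTwo S.Ω} (h : S.HasMagDeriv j u w) :
    S.magDeriv j u = w := by
  have hex : ∃ w, S.HasMagDeriv j u w := ⟨w, h⟩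
  rw [magDeriv, dif_pos hex]
  exact hex.choose_spec.unique h

theorem hasMagDeriv_zero (j : Fin d) : S.HasMagDeriv j 0 0 := by
  intro φ hφ
  have hz : ∀ g : Eucl d → ℂ, ∫ x in S.Ω, (0 : LTwo S.Ω) x * g x = 0 := by
    intro g
    rw [integral_eq_zero_of_ae]
    filter_upwards [Lp.coeFn_zero ℂ 2 (volume.restrict S.Ω)] with x hx
    rw [hx, Pi.zero_apply, zero_mul]
  rw [hz, hz]

theorem HasMagDeriv.add {j : Fin d} {u w u' w' : LTwo S.Ω} (h : S.HasMagDeriv j u w)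
    (h' : S.HasMagDeriv j u' w') : S.HasMagDeriv j (u + u') (w + w') := by
  intro φ hφ
  have key : ∀ (a b : LTwo S.Ω) (g : Eucl d → ℂ), MemLp g 2 (volume.restrict S.Ω) →
      ∫ x in S.Ω, (a + b : LTwo S.Ω) x * conj (g x)
        = (∫ x in S.Ω, a x * conj (g x)) + ∫ x in S.Ω, b x * conj (g x) := by
    intro a b g hg
    rw [← integral_add (integrable_mul_conj (Lp.memLp a) hg)
      (integrable_mul_conj (Lp.memLp b) hg)]
    refine integral_congr_ae ?_
    filter_upwards [Lp.coeFn_add a b] with x hx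
    rw [hx, Pi.add_apply, add_mul]
  rw [key _ _ _ (S.memLp_magTest j hφ), key _ _ _ hφ.memLp, h φ hφ, h' φ hφ]

theorem HasMagDeriv.smul {j : Fin d} {u w : LTwo S.Ω} (c : ℂ) (h : S.HasMagDeriv j u w) :
    S.HasMagDeriv j (c • u) (c • w) := by
  intro φ hφ
  have key : ∀ (a : LTwo S.Ω) (g : Eucl d → ℂ),
      ∫ x in S.Ω, (c • a : LTwo S.Ω) x * g x = c * ∫ x in S.Ω, a x * g x := by
    intro a g
    rw [← integral_const_mul]
    refine integral_congr_ae ?_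
    filter_upwards [Lp.coeFn_smul c a] with x hx
    rw [hx, Pi.smul_apply, smul_eq_mul, mul_assoc]
  rw [key _ (fun x => conj (S.magTest j φ x)), key _ (fun x => conj (φ x)), h φ hφ]

variable (S)

/-- The magnetic Sobolev space `H¹_A(Ω)`. -/
def H1A : Submodule ℂ (LTwo S.Ω) where
  carrier := {u | ∀ j, ∃ w, S.HasMagDeriv j u w}
  zero_mem' := fun j => ⟨0, hasMagDeriv_zero j⟩
  add_mem' := fun hu hv j =>
    ⟨_, (hu j).choose_spec.add (hv j).choose_spec⟩
  smul_mem' := fun c _ hu j => ⟨_, (hu j).choose_spec.smul c⟩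

variable {S} in
theorem hasMagDeriv_magDeriv {u : LTwo S.Ω} (hu : u ∈ S.H1A) (j : Fin d) :
    S.HasMagDeriv j u (S.magDeriv j u) := by
  obtain ⟨w, hw⟩ := hu j
  rwa [hw.magDeriv_eq]

variable {S} in
theorem magDeriv_add {u v : LTwo S.Ω} (hu : u ∈ S.H1A) (hv : v ∈ S.H1A) (j : Fin d) :
    S.magDeriv j (u + v) = S.magDeriv j u + S.magDeriv j v :=
  ((hasMagDeriv_magDeriv hu j).add (hasMagDeriv_magDeriv hv j)).magDeriv_eq

variable {S} in
theorem magDeriv_smul {u : LTwo S.Ω} (hu : u ∈ S.H1A) (c : ℂ) (j : Fin d) :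
    S.magDeriv j (c • u) = c • S.magDeriv j u :=
  ((hasMagDeriv_magDeriv hu j).smul c).magDeriv_eq

/-- The norm `√(‖u‖² + ‖(-i∇ + A)u‖²)` of `H¹_A(Ω)`. -/
def normH1A (u : LTwo S.Ω) : ℝ := √(‖u‖ ^ 2 + ∑ j, ‖S.magDeriv j u‖ ^ 2)

variable {S} in
theorem normH1A_add_le {u v : LTwo S.Ω} (hu : u ∈ S.H1A) (hv : v ∈ S.H1A) :
    S.normH1A (u + v) ≤ 2 * (S.normH1A u + S.normH1A v) := by
  have hsq : ∀ a b : LTwo S.Ω, ‖a + b‖ ^ 2 ≤ 2 * (‖a‖ ^ 2 + ‖b‖ ^ 2) := by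
    intro a b
    nlinarith [norm_add_le a b, norm_nonneg (a + b), sq_nonneg (‖a‖ - ‖b‖)]
  have hn : ∀ a : LTwo S.Ω, 0 ≤ ‖a‖ ^ 2 + ∑ j, ‖S.magDeriv j a‖ ^ 2 := fun a => by positivity
  have hs : ∑ j, ‖S.magDeriv j (u + v)‖ ^ 2
      ≤ 2 * (∑ j, ‖S.magDeriv j u‖ ^ 2 + ∑ j, ‖S.magDeriv j v‖ ^ 2) := by
    rw [← Finset.sum_add_distrib, Finset.mul_sum]
    exact Finset.sum_le_sum fun j _ => by rw [magDeriv_add hu hv]; exact hsq _ _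
  refine Real.sqrt_le_iff.2 ⟨by unfold normH1A; positivity, ?_⟩
  have h1 : S.normH1A u ^ 2 = _ := Real.sq_sqrt (hn u)
  have h2 : S.normH1A v ^ 2 = _ := Real.sq_sqrt (hn v)
  have p1 : 0 ≤ S.normH1A u := Real.sqrt_nonneg _
  have p2 : 0 ≤ S.normH1A v := Real.sqrt_nonneg _
  nlinarith [hsq u v, mul_nonneg p1 p2]

variable {S} in
theorem normH1A_smul {u : LTwo S.Ω} (hu : u ∈ S.H1A) (c : ℂ) :
    S.normH1A (c • u) = ‖c‖ * S.normH1A u := by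
  unfold normH1A
  simp_rw [magDeriv_smul hu, norm_smul, mul_pow]
  rw [← Finset.mul_sum, ← mul_add, Real.sqrt_mul (by positivity), Real.sqrt_sq (norm_nonneg _)]

/-- `H¹_{A,0}(Ω)`: the closure of `𝒞_0^∞(Ω)` in `H¹_A(Ω)`. -/
def H1A0 : Submodule ℂ (LTwo S.Ω) where
  carrier := {u | u ∈ S.H1A ∧ ∀ ε > 0, ∃ (φ : Eucl d → ℂ) (v : LTwo S.Ω),
    IsTestFunction S.Ω φ ∧ v =ᵐ[volume.restrict S.Ω] φ ∧ v ∈ S.H1A ∧ S.normH1A (u - v) < ε}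
  zero_mem' := by
    refine ⟨zero_mem _, fun ε hε => ⟨0, 0, ⟨contDiff_const, HasCompactSupport.zero, ?_⟩,
      Lp.coeFn_zero _ _ _, zero_mem _, ?_⟩⟩
    · simp [tsupport]
    · have : S.normH1A 0 = 0 := by
        have := normH1A_smul (S := S) (zero_mem S.H1A) 0
        simpa using this
      simpa [this] using hε
  add_mem' := by
    rintro u u' ⟨hu, hu2⟩ ⟨hu', hu2'⟩
    refine ⟨add_mem hu hu', fun ε hε => ?_⟩
    obtain ⟨φ, v, hφ, hvφ, hv, hlt⟩ := hu2 (ε / 4) (by positivity)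
    obtain ⟨φ', v', hφ', hvφ', hv', hlt'⟩ := hu2' (ε / 4) (by positivity)
    refine ⟨φ + φ', v + v', ⟨hφ.1.add hφ'.1, hφ.2.1.add hφ'.2.1,
      (tsupport_add φ φ').trans (union_subset hφ.2.2 hφ'.2.2)⟩, ?_, add_mem hv hv', ?_⟩
    · exact (Lp.coeFn_add v v').trans (hvφ.add hvφ')
    · rw [add_sub_add_comm]
      have := normH1A_add_le (sub_mem hu hv) (sub_mem hu' hv')
      linarith
  smul_mem' := by
    rintro c u ⟨hu, hu2⟩
    refine ⟨Submodule.smul_mem _ c hu, fun ε hε => ?_⟩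
    obtain ⟨φ, v, hφ, hvφ, hv, hlt⟩ := hu2 (ε / (‖c‖ + 1)) (by positivity)
    refine ⟨c • φ, c • v, ⟨hφ.1.const_smul c, hφ.2.1.smul_left (f := fun _ => c),
      (tsupport_smul_subset_right (fun _ => c) φ).trans hφ.2.2⟩, ?_,
      Submodule.smul_mem _ c hv, ?_⟩
    · exact (Lp.coeFn_smul c v).trans (hvφ.const_smul c)
    · rw [← smul_sub, normH1A_smul (sub_mem hu hv)]
      rw [lt_div_iff₀ (by positivity)] at hlt
      have p : 0 ≤ S.normH1A (u - v) := Real.sqrt_nonneg _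
      nlinarith [norm_nonneg c]

/-- The variational space `𝒱 = {u ∈ H¹_{A,0}(Ω) : |V|^{1/2} u ∈ L²(Ω)}`. -/
def formDomain : Submodule ℂ (LTwo S.Ω) where
  carrier := {u | u ∈ S.H1A0 ∧
    MemLp (fun x => ((√‖S.V x‖ : ℝ) : ℂ) * u x) 2 (volume.restrict S.Ω)}
  zero_mem' := by
    refine ⟨zero_mem _, (MemLp.zero (ε := ℂ)).ae_eq ?_⟩
    filter_upwards [Lp.coeFn_zero ℂ 2 (volume.restrict S.Ω)] with x hx
    rw [hx, Pi.zero_apply, mul_zero]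
  add_mem' := by
    rintro u v ⟨hu, hu2⟩ ⟨hv, hv2⟩
    refine ⟨add_mem hu hv, (hu2.add hv2).ae_eq ?_⟩
    filter_upwards [Lp.coeFn_add u v] with x hx
    rw [hx, Pi.add_apply, Pi.add_apply, mul_add]
  smul_mem' := by
    rintro c u ⟨hu, hu2⟩
    refine ⟨Submodule.smul_mem _ c hu, (hu2.const_smul c).ae_eq ?_⟩
    filter_upwards [Lp.coeFn_smul c u] with x hx
    rw [hx, Pi.smul_apply, Pi.smul_apply, smul_eq_mul, smul_eq_mul, mul_left_comm]

/-! ### The sesquilinear form -/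

/-- `Q(u, v) = ⟨(-i∇ + A)u, (-i∇ + A)v⟩ + ∫_Ω V u v̄`, where `⟨·,·⟩` is linear in its first
argument (the inner product of Mathlib is linear in its second one). -/
def Q (u v : LTwo S.Ω) : ℂ :=
  (∑ j, inner ℂ (S.magDeriv j v) (S.magDeriv j u)) + ∫ x in S.Ω, S.V x * u x * conj (v x)

variable {S} in
theorem integrable_V {u v : LTwo S.Ω} (hu : u ∈ S.formDomain) (hv : v ∈ S.formDomain) :
    Integrable (fun x => S.V x * u x * conj (v x)) (volume.restrict S.Ω) := by
  refine (integrable_mul_conj hu.2 hv.2).mono ?_ (Eventually.of_forall fun x => ?_)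
  · exact ((S.continuousOn_V.aestronglyMeasurable S.isOpen_Ω.measurableSet).mul
      (Lp.memLp u).1).mul (Lp.memLp v).1.star
  · have := Real.mul_self_sqrt (norm_nonneg (S.V x))
    simp only [norm_mul, RCLike.norm_conj, Complex.norm_real, Real.norm_eq_abs,
      abs_of_nonneg (Real.sqrt_nonneg _)]
    rw [← this]
    simp only [Real.sqrt_mul_self (Real.sqrt_nonneg _)]
    apply le_of_eq; ring

variable {S} in
theorem Q_add_left {u u' v : LTwo S.Ω} (hu : u ∈ S.formDomain) (hu' : u' ∈ S.formDomain)
    (hv : v ∈ S.formDomain) : S.Q (u + u') v = S.Q u v + S.Q u' v := by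
  have e : ∫ x in S.Ω, S.V x * (u + u' : LTwo S.Ω) x * conj (v x)
      = (∫ x in S.Ω, S.V x * u x * conj (v x)) + ∫ x in S.Ω, S.V x * u' x * conj (v x) := by
    rw [← integral_add (integrable_V hu hv) (integrable_V hu' hv)]
    refine integral_congr_ae ?_
    filter_upwards [Lp.coeFn_add u u'] with x hx
    rw [hx, Pi.add_apply]; ring
  simp only [Q, e, magDeriv_add hu.1.1 hu'.1.1, inner_add_right, Finset.sum_add_distrib]
  ring

variable {S} in
theorem Q_smul_left {u v : LTwo S.Ω} (c : ℂ) (hu : u ∈ S.formDomain) :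
    S.Q (c • u) v = c * S.Q u v := by
  have e : ∫ x in S.Ω, S.V x * (c • u : LTwo S.Ω) x * conj (v x)
      = c * ∫ x in S.Ω, S.V x * u x * conj (v x) := by
    rw [← integral_const_mul]
    refine integral_congr_ae ?_
    filter_upwards [Lp.coeFn_smul c u] with x hx
    rw [hx, Pi.smul_apply, smul_eq_mul]; ring
  simp only [Q, e, magDeriv_smul hu.1.1, inner_smul_right, ← Finset.mul_sum]
  ring

variable {S} in
theorem Q_add_right {u v v' : LTwo S.Ω} (hu : u ∈ S.formDomain) (hv : v ∈ S.formDomain)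
    (hv' : v' ∈ S.formDomain) : S.Q u (v + v') = S.Q u v + S.Q u v' := by
  have e : ∫ x in S.Ω, S.V x * u x * conj ((v + v' : LTwo S.Ω) x)
      = (∫ x in S.Ω, S.V x * u x * conj (v x)) + ∫ x in S.Ω, S.V x * u x * conj (v' x) := by
    rw [← integral_add (integrable_V hu hv) (integrable_V hu hv')]
    refine integral_congr_ae ?_
    filter_upwards [Lp.coeFn_add v v'] with x hx
    rw [hx, Pi.add_apply, map_add]; ring
  simp only [Q, e, magDeriv_add hv.1.1 hv'.1.1, inner_add_left, Finset.sum_add_distrib]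
  ring

variable {S} in
theorem Q_smul_right {u v : LTwo S.Ω} (c : ℂ) (hv : v ∈ S.formDomain) :
    S.Q u (c • v) = conj c * S.Q u v := by
  have e : ∫ x in S.Ω, S.V x * u x * conj ((c • v : LTwo S.Ω) x)
      = conj c * ∫ x in S.Ω, S.V x * u x * conj (v x) := by
    rw [← integral_const_mul]
    refine integral_congr_ae ?_
    filter_upwards [Lp.coeFn_smul c v] with x hx
    rw [hx, Pi.smul_apply, smul_eq_mul, map_mul]; ring
  simp only [Q, e, magDeriv_smul hv.1.1, inner_smul_left, ← Finset.mul_sum]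
  ring

/-! ### Test functions belong to the form domain -/

variable {S} in
theorem hasMagDeriv_test (j : Fin d) {φ : Eucl d → ℂ} (hφ : IsTestFunction S.Ω φ) :
    S.HasMagDeriv j hφ.memLp.toLp (S.memLp_magTest j hφ).toLp := by
  intro χ hχ
  have e1 : ∫ x in S.Ω, (hφ.memLp.toLp : LTwo S.Ω) x * conj (S.magTest j χ x)
      = ∫ x in S.Ω, φ x * conj (S.magTest j χ x) := by
    refine integral_congr_ae ?_
    filter_upwards [hφ.memLp.coeFn_toLp] with x hx
    rw [hx]
  have e2 : ∫ x in S.Ω, ((S.memLp_magTest j hφ).toLp : LTwo S.Ω) x * conj (χ x)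
      = ∫ x in S.Ω, S.magTest j φ x * conj (χ x) := by
    refine integral_congr_ae ?_
    filter_upwards [(S.memLp_magTest j hφ).coeFn_toLp] with x hx
    rw [hx]
  have hout : ∀ {f : Eucl d → ℂ}, IsTestFunction S.Ω f → ∀ x, x ∉ S.Ω → f x = 0 :=
    fun hf x hx => image_eq_zero_of_notMem_tsupport fun h => hx (hf.2.2 h)
  rw [e1, e2, setIntegral_eq_integral_of_forall_compl_eq_zero (fun x hx => by simp [hout hφ x hx]),
    setIntegral_eq_integral_of_forall_compl_eq_zero (fun x hx => by simp [hout hχ x hx])]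
  set χc : Eucl d → ℂ := fun x => conj (χ x) with hχc
  have hdχ : Differentiable ℝ χ := hχ.1.differentiable (by simp)
  have hdφ : Differentiable ℝ φ := hφ.1.differentiable (by simp)
  have hconj : ∀ x, fderiv ℝ χc x (basisVec j) = conj (fderiv ℝ χ x (basisVec j)) := by
    intro x
    have : HasFDerivAt χc ((Complex.conjCLE : ℂ →L[ℝ] ℂ).comp (fderiv ℝ χ x)) x :=
      (Complex.conjCLE : ℂ →L[ℝ] ℂ).hasFDerivAt.comp x (hdχ x).hasFDerivAt
    rw [this.fderiv]; rfl
  have hcχ : Continuous χc := Complex.continuous_conj.comp hχ.1.continuous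
  have hdχc : Differentiable ℝ χc := fun x =>
    ((Complex.conjCLE : ℂ →L[ℝ] ℂ).differentiable.comp hdχ) x
  have c1 : Continuous (fun x => fderiv ℝ φ x (basisVec j)) :=
    (hφ.1.continuous_fderiv (by simp)).clm_apply continuous_const
  have c2 : Continuous (fun x => fderiv ℝ χc x (basisVec j)) := by
    simp_rw [hconj]
    exact Complex.continuous_conj.comp
      ((hχ.1.continuous_fderiv (by simp)).clm_apply continuous_const)
  have i1 : Integrable (fun x => fderiv ℝ φ x (basisVec j) * χc x) :=
    (c1.mul hcχ).integrable_of_hasCompactSupport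
      ((hφ.2.1.fderiv_apply (𝕜 := ℝ) (basisVec j)).mul_right)
  have i2 : Integrable (fun x => φ x * fderiv ℝ χc x (basisVec j)) :=
    (hφ.1.continuous.mul c2).integrable_of_hasCompactSupport hφ.2.1.mul_right
  have i3 : Integrable (fun x => φ x * χc x) :=
    (hφ.1.continuous.mul hcχ).integrable_of_hasCompactSupport hφ.2.1.mul_right
  have hA : ContinuousOn (fun x => ((S.A x j : ℝ) : ℂ)) S.Ω :=
    Complex.continuous_ofReal.comp_continuousOn
      ((EuclideanSpace.proj j : Eucl d →L[ℝ] ℝ).continuous.comp_continuousOn S.continuousOn_A)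
  have i4 : Integrable (fun x => ((S.A x j : ℂ) * φ x) * χc x) :=
    ((S.continuous_mul_test hA hφ.1.continuous hφ.2.2).mul
      hcχ).integrable_of_hasCompactSupport (hφ.2.1.mul_left.mul_right)
  have ibp := integral_mul_fderiv_eq_neg_fderiv_mul_of_integrable i1 i2 i3
    (fun x _ => hdφ x) (fun x _ => hdχc x)
  have l : (fun x => φ x * conj (S.magTest j χ x))
      = fun x => Complex.I * (φ x * fderiv ℝ χc x (basisVec j)) + ((S.A x j : ℂ) * φ x) * χc x := by
    funext x
    rw [hconj]
    simp only [magTest, map_add, map_mul, map_neg, Complex.conj_I, Complex.conj_ofReal,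
      neg_neg, hχc]
    ring
  have r : (fun x => S.magTest j φ x * χc x)
      = fun x => -Complex.I * (fderiv ℝ φ x (basisVec j) * χc x) + ((S.A x j : ℂ) * φ x) * χc x := by
    funext x
    simp only [magTest]
    ring
  rw [l, r, integral_add (i2.const_mul _) i4, integral_add (i1.const_mul _) i4,
    integral_const_mul, integral_const_mul, ibp]
  ring

variable {S} in
theorem test_mem_formDomain {φ : Eucl d → ℂ} (hφ : IsTestFunction S.Ω φ) :
    (hφ.memLp.toLp : LTwo S.Ω) ∈ S.formDomain := by
  have h1 : (hφ.memLp.toLp : LTwo S.Ω) ∈ S.H1A := fun j => ⟨_, hasMagDeriv_test j hφ⟩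
  refine ⟨⟨h1, fun ε hε => ⟨φ, _, hφ, hφ.memLp.coeFn_toLp, h1, ?_⟩⟩, ?_⟩
  · have : S.normH1A 0 = 0 := by
      have := normH1A_smul (S := S) (zero_mem S.H1A) 0
      simpa using this
    simpa [this] using hε
  · have hV : ContinuousOn (fun x => ((√‖S.V x‖ : ℝ) : ℂ)) S.Ω :=
      Complex.continuous_ofReal.comp_continuousOn S.continuousOn_V.norm.sqrt
    have h2 : MemLp (fun x => ((√‖S.V x‖ : ℝ) : ℂ) * φ x) 2 (volume.restrict S.Ω) :=
      ((S.continuous_mul_test hV hφ.1.continuous hφ.2.2).memLp_of_hasCompactSupport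
        hφ.2.1.mul_left).restrict _
    refine h2.ae_eq ?_
    filter_upwards [hφ.memLp.coeFn_toLp] with x hx
    rw [hx]

variable {S} in
theorem eq_of_inner_formDomain {f g : LTwo S.Ω}
    (h : ∀ v ∈ S.formDomain, inner ℂ v f = inner ℂ v g) : f = g := by
  rw [← sub_eq_zero]
  refine S.eq_zero_of_test _ fun φ hφ => ?_
  have h1 := h _ (test_mem_formDomain hφ)
  rw [← sub_eq_zero, ← inner_sub_right, L2.inner_def] at h1
  rw [← h1]
  refine integral_congr_ae ?_
  filter_upwards [hφ.memLp.coeFn_toLp] with x hx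
  rw [hx, RCLike.inner_apply]

/-! ### The operator -/

/-- The domain of the operator: those `u ∈ 𝒱` for which the form `v ↦ Q(u, v)` is continuous on
`𝒱` for the norm of `L²(Ω)`. -/
def opDomain : Submodule ℂ (LTwo S.Ω) where
  carrier := {u | u ∈ S.formDomain ∧ ∃ C : ℝ, ∀ v ∈ S.formDomain, ‖S.Q u v‖ ≤ C * ‖v‖}
  zero_mem' := by
    refine ⟨zero_mem _, 0, fun v hv => ?_⟩
    have := Q_smul_left (S := S) (v := v) 0 (zero_mem S.formDomain)
    rw [zero_smul, zero_mul] at this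
    simp [this]
  add_mem' := by
    rintro u u' ⟨hu, C, hC⟩ ⟨hu', C', hC'⟩
    refine ⟨add_mem hu hu', C + C', fun v hv => ?_⟩
    rw [Q_add_left hu hu' hv, add_mul]
    exact (norm_add_le _ _).trans (add_le_add (hC v hv) (hC' v hv))
  smul_mem' := by
    rintro c u ⟨hu, C, hC⟩
    refine ⟨Submodule.smul_mem _ c hu, ‖c‖ * C, fun v hv => ?_⟩
    rw [Q_smul_left c hu, norm_mul, mul_assoc]
    exact mul_le_mul_of_nonneg_left (hC v hv) (norm_nonneg c)

variable {S} in
/-- The Riesz representation of the form `v ↦ Q(u, v)`. -/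
theorem exists_riesz {u : LTwo S.Ω} (hu : u ∈ S.opDomain) :
    ∃ f : LTwo S.Ω, ∀ v ∈ S.formDomain, S.Q u v = inner ℂ v f := by
  obtain ⟨hu, C, hC⟩ := hu
  let ℓ : S.formDomain →ₗ[ℂ] ℂ :=
    { toFun := fun v => conj (S.Q u v)
      map_add' := fun v v' => by
        simp [Q_add_right hu v.2 v'.2]
      map_smul' := fun c v => by
        simp [Q_smul_right c v.2] }
  let L : StrongDual ℂ S.formDomain := ℓ.mkContinuous C fun v => by
    simpa [ℓ] using hC v v.2
  obtain ⟨g, hg, -⟩ := exists_extension_norm_eq S.formDomain L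
  refine ⟨(InnerProductSpace.toDual ℂ (LTwo S.Ω)).symm g, fun v hv => ?_⟩
  have h1 : g v = conj (S.Q u v) := hg ⟨v, hv⟩
  rw [← inner_conj_symm, InnerProductSpace.toDual_symm_apply, h1, Complex.conj_conj]

/-- The Dirichlet realisation `ℒ` of `(-i∇ + A)² + V`: the operator with domain `opDomain`
characterised by `Q(u, v) = ⟨ℒ u, v⟩` for all `v ∈ 𝒱`. -/
def op : LTwo S.Ω →ₗ.[ℂ] LTwo S.Ω where
  domain := S.opDomain
  toFun :=
    { toFun := fun u => (exists_riesz u.2).choose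
      map_add' := fun u u' => eq_of_inner_formDomain fun v hv => by
        rw [inner_add_right, ← (exists_riesz u.2).choose_spec v hv,
          ← (exists_riesz u'.2).choose_spec v hv, ← (exists_riesz (u + u').2).choose_spec v hv]
        exact Q_add_left u.2.1 u'.2.1 hv
      map_smul' := fun c u => eq_of_inner_formDomain fun v hv => by
        rw [RingHom.id_apply, inner_smul_right, ← (exists_riesz u.2).choose_spec v hv,
          ← (exists_riesz (c • u).2).choose_spec v hv]
        exact Q_smul_left c u.2.1 }

theorem Q_eq_inner_op (u : S.op.domain) {v : LTwo S.Ω} (hv : v ∈ S.formDomain) :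
    S.Q u v = inner ℂ v (S.op u) :=
  (exists_riesz u.2).choose_spec v hv

/-! ### The quantities entering the decay estimate -/

/-- `V_∞ = liminf_{|x| → ∞, x ∈ Ω} |V(x)| ∈ [0, ∞]` (which is `∞` if `Ω` is bounded). -/
def VInfty : ℝ≥0∞ :=
  liminf (fun x => ENNReal.ofReal ‖S.V x‖) (Bornology.cobounded (Eucl d) ⊓ 𝓟 S.Ω)

/-- The conformal factor `(γ₁|V| - Re λ - |Im λ| - γ₂)₊` of the Agmon metric. -/
def agmonWeight (γ₁ γ₂ : ℝ) (lam : ℂ) (x : Eucl d) : ℝ :=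
  max (γ₁ * ‖S.V x‖ - lam.re - |lam.im| - γ₂) 0

/-- The distance on `Ω` of the (degenerate) Riemannian metric `agmonWeight dx²`: the infimum of
the lengths of the `𝒞¹` curves in `Ω` joining the two points (`∞` if there is none). -/
def agmonEDist (γ₁ γ₂ : ℝ) (lam : ℂ) (x y : Eucl d) : ℝ≥0∞ :=
  ⨅ (c : ℝ → Eucl d) (_ : ContDiffOn ℝ 1 c (Icc 0 1)) (_ : MapsTo c (Icc 0 1) S.Ω)
    (_ : c 0 = x) (_ : c 1 = y),
    ∫⁻ t in Icc (0 : ℝ) 1,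
      ENNReal.ofReal (√(S.agmonWeight γ₁ γ₂ lam (c t)) * ‖derivWithin c (Icc 0 1) t‖)

/-- A choice of one base point `b x` in each connected component of `Ω`. If `Ω` is connected,
this means that `b` is constant on `Ω`, equal to a fixed point of `Ω`. -/
def IsBasePoint (b : Eucl d → Eucl d) : Prop :=
  ∀ x ∈ S.Ω, b x ∈ connectedComponentIn S.Ω x ∧
    ∀ y ∈ connectedComponentIn S.Ω x, b y = b x

/-- The Agmon distance `d_Ag(x)` to the base point of the component of `x`. -/
def agmonDist (γ₁ γ₂ : ℝ) (lam : ℂ) (b : Eucl d → Eucl d) (x : Eucl d) : ℝ :=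
  (S.agmonEDist γ₁ γ₂ lam (b x) x).toReal

end EMSystem

/-! ### Spectral notions for an unbounded operator -/

section Spectral

variable {H : Type*} [AddCommGroup H] [Module ℂ H]

/-- The spectrum of an operator `M` with domain in `H`: those `λ` for which `M - λ` is not
bijective from its domain onto `H`. -/
def unboundedSpectrum (M : H →ₗ.[ℂ] H) : Set ℂ :=
  {lam | ¬ Function.Bijective (fun u : M.domain => M u - lam • (u : H))}

/-- `Ker (M - λ)^k`, with the natural domains of the powers. -/
def kerPow (M : H →ₗ.[ℂ] H) (lam : ℂ) : ℕ → Set H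
  | 0 => {0}
  | k + 1 => {u | ∃ hu : u ∈ M.domain, M ⟨u, hu⟩ - lam • u ∈ kerPow M lam k}

/-- The algebraic (root) eigenspace `⋃_{k ≥ 1} Ker (M - λ)^k`. -/
def algebraicEigenspace (M : H →ₗ.[ℂ] H) (lam : ℂ) : Set H :=
  ⋃ k ≥ 1, kerPow M lam k

end Spectral

/-- The region `ρ_c = {μ ∈ ℂ : -c - Re μ - |Im μ| > 0}`. -/
def regionRho (c : ℝ) : Set ℂ := {μ | 0 < -c - μ.re - |μ.im|}

end

/-! The proof is Agmon's method with a complex multiplier. Write P_j = -i∂_j + A_j. For a test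
function φ and a real weight θ, consider Re Q(φ, θ²φ) + Im Q(φ, Φθ²φ). The real part produces
|P(θφ)|² + V₁|θφ|² - |∇θ|²|φ|². The imaginary part produces V₂²/m |θφ|², with errors in ∇Φ and ∇θ.
The magnetic term comes from the commutator [P_j, P_k] = -iB_{jk} tested against Ψ_{jk}; it costs a
quarter of the kinetic energy and a multiple of |∇Ψ|². By the hypothesis on the potentials, the
whole is at least the integral of ¼|P(θφ)|² + (γ₁|V| - γ₂)|θφ|² - 4|∇θ|²|φ|²
(`integral_coerciveIntegrand_le`). Subtracting λ costs Re λ + |Im λ|, since |Φ| ≤ 1, and the Agmon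
weight w appears. If θ behaves like e^{aD} with D the Agmon distance and a ≤ 1/3, then 4|∇θ|² uses
up only about 4/9 of wθ².

Outside a large ball w is at least some δ > 0, which controls θφ there. Inside the ball D may be
unbounded, because Ω is an arbitrary open set, possibly with infinitely many components. But D is
finite, so the part of the ball where D > n has small volume for large n, and on a set of small
volume the L² mass of θφ is a small fraction of its magnetic energy (`exists_nat_integral_sq_le`).
That fraction is absorbed by the left side; where D ≤ n, θ is bounded. This gives
`exists_agmon_estimate_test`, whose constant does not depend on θ.

To reach eigenfunctions, D is shown to be locally Lipschitz with constant √w, truncated at height N,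
mollified and cut off (`exists_smooth_weight`). The function ψ is replaced by a test function so
close in H¹_A that the error is harmless for this N, and Fatou's lemma lets N tend to infinity. The
result is proved in resolvent form: if e^{aD}(ℒ - λ)ψ is in L², so is e^{aD}ψ
(`memLp_exp_agmonDist`). Induction on k then covers the algebraic eigenspace. -/

noncomputable section

/-! ### Compactly supported 𝒞¹ functions and their magnetic derivatives -/

/-- Continuously differentiable functions with compact support in `Ω`. -/
structure IsC1Test {d : ℕ} (Ω : Set (Eucl d)) (f : Eucl d → ℂ) : Prop where
  contDiff : ContDiff ℝ 1 f
  hasCompactSupport : HasCompactSupport f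
  tsupport_subset : tsupport f ⊆ Ω

theorem IsTestFunction.isC1Test {d : ℕ} {Ω : Set (Eucl d)} {φ : Eucl d → ℂ}
    (h : IsTestFunction Ω φ) : IsC1Test Ω φ :=
  ⟨h.1.of_le (by simp), h.2.1, h.2.2⟩

/-- The coefficients A, V, Φ, Ψ are regular on Ω only; after multiplication by a function supported
in Ω their values elsewhere become irrelevant, because the product vanishes near every point off the
support. -/
theorem ContDiffOn.contDiff_mul_of_tsupport_subset {E : Type*} [NormedAddCommGroup E]
    [NormedSpace ℝ E] {Ω : Set E} (hΩ : IsOpen Ω) {n : WithTop ℕ∞} {g f : E → ℂ}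
    (hg : ContDiffOn ℝ n g Ω) (hf : ContDiff ℝ n f) (hs : tsupport f ⊆ Ω) :
    ContDiff ℝ n (fun x => g x * f x) := by
  refine contDiff_iff_contDiffAt.2 fun x => ?_
  by_cases hx : x ∈ tsupport f
  · exact (hg.contDiffAt (hΩ.mem_nhds (hs hx))).mul hf.contDiffAt
  · have h0 : (fun x => g x * f x) =ᶠ[𝓝 x] fun _ => 0 := by
      filter_upwards [notMem_tsupport_iff_eventuallyEq.1 hx] with y hy
      rw [hy, Pi.zero_apply, mul_zero]
    exact contDiffAt_const.congr_of_eventuallyEq h0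

namespace IsC1Test

variable {d : ℕ} {Ω : Set (Eucl d)} {f g : Eucl d → ℂ}

theorem continuous (hf : IsC1Test Ω f) : Continuous f := hf.contDiff.continuous

theorem differentiable (hf : IsC1Test Ω f) : Differentiable ℝ f :=
  hf.contDiff.differentiable (by simp)

theorem eq_zero (hf : IsC1Test Ω f) {x : Eucl d} (hx : x ∉ Ω) : f x = 0 :=
  image_eq_zero_of_notMem_tsupport fun h => hx (hf.tsupport_subset h)

theorem continuous_fderiv (hf : IsC1Test Ω f) (v : Eucl d) :
    Continuous (fun x => fderiv ℝ f x v) :=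
  (hf.contDiff.continuous_fderiv (by simp)).clm_apply continuous_const

theorem fderiv_eq_zero (hf : IsC1Test Ω f) {x : Eucl d} (hx : x ∉ Ω) : fderiv ℝ f x = 0 :=
  image_eq_zero_of_notMem_tsupport fun h =>
    hx (hf.tsupport_subset (tsupport_fderiv_subset (𝕜 := ℝ) h))

theorem memLp (hf : IsC1Test Ω f) : MemLp f 2 (volume.restrict Ω) :=
  (hf.continuous.memLp_of_hasCompactSupport hf.hasCompactSupport).restrict _

theorem mul_left (hΩ : IsOpen Ω) (hg : ContDiffOn ℝ 1 g Ω) (hf : IsC1Test Ω f) :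
    IsC1Test Ω (fun x => g x * f x) :=
  ⟨hg.contDiff_mul_of_tsupport_subset hΩ hf.contDiff hf.tsupport_subset,
    hf.hasCompactSupport.mul_left, tsupport_mul_subset_right.trans hf.tsupport_subset⟩

theorem fderiv_conj (hf : IsC1Test Ω f) (x v : Eucl d) :
    fderiv ℝ (fun x => conj (f x)) x v = conj (fderiv ℝ f x v) := by
  have : HasFDerivAt (fun x => conj (f x))
      ((Complex.conjCLE : ℂ →L[ℝ] ℂ).comp (fderiv ℝ f x)) x :=
    (Complex.conjCLE : ℂ →L[ℝ] ℂ).hasFDerivAt.comp x (hf.differentiable x).hasFDerivAt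
  rw [this.fderiv]; rfl

theorem star (hf : IsC1Test Ω f) : IsC1Test Ω (fun x => conj (f x)) := by
  refine ⟨(Complex.conjCLE : ℂ →L[ℝ] ℂ).contDiff.comp hf.contDiff,
    hf.hasCompactSupport.comp_left (g := fun z : ℂ => (starRingEnd ℂ) z) (map_zero _), ?_⟩
  have h : tsupport (fun x => conj (f x)) ⊆ tsupport f :=
    closure_mono fun x hx hx' => hx (by simp [hx'])
  exact h.trans hf.tsupport_subset

end IsC1Test

namespace EMSystem

variable {d : ℕ} (S : EMSystem d)

theorem contDiffOn_A_apply (j : Fin d) : ContDiffOn ℝ 2 (fun x => ((S.A x j : ℝ) : ℂ)) S.Ω :=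
  Complex.ofRealCLM.contDiff.comp_contDiffOn
    ((EuclideanSpace.proj j : Eucl d →L[ℝ] ℝ).contDiff.comp_contDiffOn S.smooth_A.1)

variable {S} {f g : Eucl d → ℂ}

theorem _root_.IsC1Test.continuous_magTest (hf : IsC1Test S.Ω f) (j : Fin d) :
    Continuous (S.magTest j f) :=
  (continuous_const.mul (hf.continuous_fderiv _)).add
    (S.continuous_mul_test (S.contDiffOn_A_apply j).continuousOn hf.continuous hf.tsupport_subset)

theorem _root_.IsC1Test.hasCompactSupport_magTest (hf : IsC1Test S.Ω f) (j : Fin d) :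
    HasCompactSupport (S.magTest j f) :=
  ((hf.hasCompactSupport.fderiv_apply (𝕜 := ℝ) (basisVec j)).mul_left
    (f := fun _ => -Complex.I)).add
    (hf.hasCompactSupport.mul_left (f := fun x => ((S.A x j : ℝ) : ℂ)))

theorem _root_.IsC1Test.magTest_eq_zero (hf : IsC1Test S.Ω f) (j : Fin d) {x : Eucl d}
    (hx : x ∉ S.Ω) : S.magTest j f x = 0 := by
  simp [magTest, hf.eq_zero hx, hf.fderiv_eq_zero hx]

theorem _root_.IsC1Test.memLp_magTest (hf : IsC1Test S.Ω f) (j : Fin d) :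
    MemLp (S.magTest j f) 2 (volume.restrict S.Ω) :=
  ((hf.continuous_magTest j).memLp_of_hasCompactSupport
    (hf.hasCompactSupport_magTest j)).restrict _

/-- The operators `-i ∂_j + A_j` are symmetric on `𝒞¹_c(Ω)`. -/
theorem integral_mul_conj_magTest (j : Fin d) (hf : IsC1Test S.Ω f) (hg : IsC1Test S.Ω g) :
    ∫ x, f x * conj (S.magTest j g x) = ∫ x, S.magTest j f x * conj (g x) := by
  have hgc := hg.star
  have i1 : Integrable (fun x => fderiv ℝ f x (basisVec j) * conj (g x)) :=
    ((hf.continuous_fderiv _).mul hgc.continuous).integrable_of_hasCompactSupport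
      hgc.hasCompactSupport.mul_left
  have i2 : Integrable (fun x => f x * fderiv ℝ (fun x => conj (g x)) x (basisVec j)) :=
    (hf.continuous.mul (hgc.continuous_fderiv _)).integrable_of_hasCompactSupport
      hf.hasCompactSupport.mul_right
  have i3 : Integrable (fun x => f x * conj (g x)) :=
    (hf.continuous.mul hgc.continuous).integrable_of_hasCompactSupport
      hf.hasCompactSupport.mul_right
  have i4 : Integrable (fun x => ((S.A x j : ℂ) * f x) * conj (g x)) :=
    ((S.continuous_mul_test (S.contDiffOn_A_apply j).continuousOn hf.continuous
      hf.tsupport_subset).mul hgc.continuous).integrable_of_hasCompactSupport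
      (hf.hasCompactSupport.mul_left.mul_right)
  have ibp := integral_mul_fderiv_eq_neg_fderiv_mul_of_integrable i1 i2 i3
    (fun x _ => hf.differentiable x) (fun x _ => hgc.differentiable x)
  have l : (fun x => f x * conj (S.magTest j g x))
      = fun x => Complex.I * (f x * fderiv ℝ (fun x => conj (g x)) x (basisVec j))
        + ((S.A x j : ℂ) * f x) * conj (g x) := by
    funext x
    rw [hg.fderiv_conj]
    simp only [magTest, map_add, map_mul, map_neg, Complex.conj_I, Complex.conj_ofReal, neg_neg]
    ring
  have r : (fun x => S.magTest j f x * conj (g x))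
      = fun x => -Complex.I * (fderiv ℝ f x (basisVec j) * conj (g x))
        + ((S.A x j : ℂ) * f x) * conj (g x) := by
    funext x
    simp only [magTest]
    ring
  rw [l, r, integral_add (i2.const_mul _) i4, integral_add (i1.const_mul _) i4,
    integral_const_mul, integral_const_mul, ibp]
  ring

theorem _root_.IsC1Test.hasMagDeriv (hf : IsC1Test S.Ω f) (j : Fin d) :
    S.HasMagDeriv j hf.memLp.toLp (hf.memLp_magTest j).toLp := by
  intro χ hχ
  have e1 : ∫ x in S.Ω, (hf.memLp.toLp : LTwo S.Ω) x * conj (S.magTest j χ x)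
      = ∫ x in S.Ω, f x * conj (S.magTest j χ x) := by
    refine integral_congr_ae ?_
    filter_upwards [hf.memLp.coeFn_toLp] with x hx
    rw [hx]
  have e2 : ∫ x in S.Ω, ((hf.memLp_magTest j).toLp : LTwo S.Ω) x * conj (χ x)
      = ∫ x in S.Ω, S.magTest j f x * conj (χ x) := by
    refine integral_congr_ae ?_
    filter_upwards [(hf.memLp_magTest j).coeFn_toLp] with x hx
    rw [hx]
  rw [e1, e2, setIntegral_eq_integral_of_forall_compl_eq_zero
    (fun x hx => by simp [hf.eq_zero hx]), setIntegral_eq_integral_of_forall_compl_eq_zero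
    (fun x hx => by simp [hχ.isC1Test.eq_zero hx])]
  exact integral_mul_conj_magTest j hf hχ.isC1Test

theorem _root_.IsC1Test.magDeriv_eq (hf : IsC1Test S.Ω f) (j : Fin d) :
    S.magDeriv j hf.memLp.toLp = (hf.memLp_magTest j).toLp :=
  (hf.hasMagDeriv j).magDeriv_eq

theorem _root_.IsC1Test.mem_H1A (hf : IsC1Test S.Ω f) :
    (hf.memLp.toLp : LTwo S.Ω) ∈ S.H1A := fun j => ⟨_, hf.hasMagDeriv j⟩

end EMSystem

/-! ### Mollification, and 𝒞¹_c functions in the form domain -/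

/-- Approximation of a `𝒞¹_c` function and of its derivative by test functions whose supports
stay in a neighbourhood of the support of `f`. -/
theorem IsC1Test.exists_isTestFunction_approx {d : ℕ} {Ω : Set (Eucl d)} (hΩ : IsOpen Ω)
    {f : Eucl d → ℂ} (hf : IsC1Test Ω f) :
    ∃ K, IsCompact K ∧ K ⊆ Ω ∧ ∀ ε > 0, ∃ φ, IsTestFunction Ω φ ∧ Function.support φ ⊆ K ∧
      Function.support f ⊆ K ∧
      (∀ x, ‖φ x - f x‖ ≤ ε) ∧ ∀ x, ‖fderiv ℝ φ x - fderiv ℝ f x‖ ≤ ε := by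
  obtain ⟨r, hr, hrΩ⟩ := hf.hasCompactSupport.isCompact.exists_cthickening_subset_open hΩ
    hf.tsupport_subset
  have hK : IsCompact (Metric.cthickening r (tsupport f)) :=
    hf.hasCompactSupport.isCompact.cthickening
  refine ⟨_, hK, hrΩ, fun ε hε => ?_⟩
  have hdc : Continuous (fderiv ℝ f) := hf.contDiff.continuous_fderiv (by simp)
  have hdcs : HasCompactSupport (fderiv ℝ f) := hf.hasCompactSupport.fderiv ℝ
  obtain ⟨δ₁, hδ₁, h₁⟩ := Metric.uniformContinuous_iff.1
    (hf.hasCompactSupport.uniformContinuous_of_continuous hf.continuous) ε hε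
  obtain ⟨δ₂, hδ₂, h₂⟩ := Metric.uniformContinuous_iff.1
    (hdcs.uniformContinuous_of_continuous hdc) ε hε
  obtain ⟨δ, hδ, hδr, hδ₁', hδ₂'⟩ : ∃ δ > 0, δ ≤ r ∧ δ ≤ δ₁ ∧ δ ≤ δ₂ :=
    ⟨min r (min δ₁ δ₂), by positivity, by simp, by simp, by simp⟩
  let ρ : ContDiffBump (0 : Eucl d) := ⟨δ / 2, δ, by positivity, by linarith⟩
  have hρ : ρ.rOut = δ := rfl
  let φ : Eucl d → ℂ :=
    convolution (ρ.normed volume) f (ContinuousLinearMap.lsmul ℝ ℝ) volume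
  have hsupp : Function.support φ ⊆ Metric.cthickening r (tsupport f) := by
    refine (support_convolution_subset _).trans ?_
    rw [ρ.support_normed_eq, hρ]
    rintro _ ⟨a, ha, y, hy, rfl⟩
    refine Metric.mem_cthickening_of_dist_le _ y _ _ (subset_tsupport f hy) ?_
    have : ‖a‖ < δ := by simpa using ha
    simpa [dist_eq_norm] using this.le.trans hδr
  have hts : tsupport φ ⊆ Metric.cthickening r (tsupport f) :=
    closure_minimal hsupp hK.isClosed
  refine ⟨φ, ⟨?_, ?_, hts.trans hrΩ⟩, hsupp,
    (subset_tsupport f).trans (Metric.self_subset_cthickening _), ?_, ?_⟩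
  · exact ρ.hasCompactSupport_normed.contDiff_convolution_left _ ρ.contDiff_normed
      hf.continuous.locallyIntegrable
  · exact HasCompactSupport.intro hK fun x hx => by
      by_contra h; exact hx (hsupp h)
  · intro x
    rw [← dist_eq_norm]
    refine ρ.dist_normed_convolution_le hf.continuous.aestronglyMeasurable fun y hy => ?_
    exact (h₁ (lt_of_lt_of_le (by simpa [hρ] using hy) hδ₁')).le
  · intro x
    -- The derivative falls on f, so φ and its differential are averages of f and its differential
    -- over balls of radius δ.
    have e : fderiv ℝ φ x
        = convolution (ρ.normed volume) (fderiv ℝ f) (ContinuousLinearMap.lsmul ℝ ℝ) volume x :=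
      (hf.hasCompactSupport.hasFDerivAt_convolution_right (ContinuousLinearMap.lsmul ℝ ℝ)
        ρ.continuous_normed.locallyIntegrable hf.contDiff x).fderiv
    rw [e, ← dist_eq_norm]
    refine ρ.dist_normed_convolution_le hdc.aestronglyMeasurable fun y hy => ?_
    exact (h₂ (lt_of_lt_of_le (by simpa [hρ] using hy) hδ₂')).le

namespace EMSystem

variable {d : ℕ} {S : EMSystem d} {f : Eucl d → ℂ}

theorem norm_toLp_le_of_forall_le {K : Set (Eucl d)} (hK : IsCompact K) {g : Eucl d → ℂ}
    (hg : MemLp g 2 (volume.restrict S.Ω)) (hs : ∀ x ∉ K, g x = 0) {C : ℝ} (hC : 0 ≤ C)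
    (h : ∀ x, ‖g x‖ ≤ C) : ‖hg.toLp‖ ≤ C * √(volume.real K) := by
  have hKm := hK.measurableSet
  rw [Lp.norm_toLp]
  have h1 : eLpNorm g 2 (volume.restrict S.Ω) ≤ eLpNorm (K.indicator fun _ => C) 2 volume := by
    refine (eLpNorm_mono_measure _ Measure.restrict_le_self).trans (eLpNorm_mono fun x => ?_)
    by_cases hx : x ∈ K
    · rw [indicator_of_mem hx, Real.norm_of_nonneg hC]; exact h x
    · rw [hs x hx, norm_zero]; exact norm_nonneg _
  rw [eLpNorm_indicator_const hKm (by norm_num) (by norm_num)] at h1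
  have h2 : ‖C‖ₑ * volume K ^ (1 / (2 : ℝ≥0∞).toReal) ≠ ⊤ :=
    ENNReal.mul_ne_top (by simp) (ENNReal.rpow_ne_top_of_nonneg (by simp) hK.measure_ne_top)
  refine (ENNReal.toReal_mono h2 h1).trans (le_of_eq ?_)
  rw [ENNReal.toReal_mul, toReal_enorm, Real.norm_of_nonneg hC, ← ENNReal.toReal_rpow,
    Real.sqrt_eq_rpow]
  simp [Measure.real]

/-- Φ is only 𝒞¹, so Φθ²φ is not a test function; this is what admits it as second argument of Q.
Mollifications inside one compact K converge uniformly with their gradients, and A is bounded on K,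
so they converge in H¹_A. -/
theorem _root_.IsC1Test.mem_formDomain (hf : IsC1Test S.Ω f) :
    (hf.memLp.toLp : LTwo S.Ω) ∈ S.formDomain := by
  refine ⟨⟨hf.mem_H1A, fun ε hε => ?_⟩, ?_⟩
  · obtain ⟨K, hK, hKΩ, happ⟩ := hf.exists_isTestFunction_approx S.isOpen_Ω
    have hAc : ContinuousOn S.A K := S.continuousOn_A.mono hKΩ
    obtain ⟨M, hM⟩ := hK.exists_bound_of_continuousOn hAc
    have hM0 : 0 ≤ max M 0 := le_max_right _ _
    set c : ℝ := (1 + max M 0) * √(volume.real K) with hc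
    have hc0 : 0 ≤ c := by positivity
    -- The difference and each of its d magnetic derivatives will have L² norm at most ηc, whence
    -- the factor √(1 + d).
    obtain ⟨η, hη, hηε⟩ : ∃ η > 0, η * (c * √(1 + d)) < ε :=
      ⟨ε / (c * √(1 + d) + 1), by positivity, by
        rw [div_mul_eq_mul_div, div_lt_iff₀ (by positivity)]
        nlinarith⟩
    obtain ⟨φ, hφ, hφK, hfK, h0, h1⟩ := happ η hη
    have hφ' := hφ.isC1Test
    refine ⟨φ, hφ'.memLp.toLp, hφ, hφ'.memLp.coeFn_toLp, hφ'.mem_H1A, ?_⟩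
    have hφz : ∀ x ∉ K, φ x = 0 := fun x hx => by_contra fun h => hx (hφK h)
    have hfz : ∀ x ∉ K, f x = 0 := fun x hx => by_contra fun h => hx (hfK h)
    have hKc := hK.isClosed
    have hdz : ∀ g : Eucl d → ℂ, Function.support g ⊆ K → ∀ x ∉ K, fderiv ℝ g x = 0 :=
      fun g hg x hx => image_eq_zero_of_notMem_tsupport fun h =>
        hx (closure_minimal hg hKc (tsupport_fderiv_subset (𝕜 := ℝ) h))
    have b0 : ‖(hf.memLp.toLp - hφ'.memLp.toLp : LTwo S.Ω)‖ ≤ η * c := by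
      rw [← MemLp.toLp_sub]
      refine (norm_toLp_le_of_forall_le hK _ (fun x hx => by simp [hφz x hx, hfz x hx]) hη.le
        fun x => ?_).trans ?_
      · rw [Pi.sub_apply, norm_sub_rev]; exact h0 x
      · rw [hc, ← mul_assoc]
        gcongr
        nlinarith
    have b1 : ∀ j, ‖S.magDeriv j (hf.memLp.toLp - hφ'.memLp.toLp : LTwo S.Ω)‖ ≤ η * c := by
      intro j
      have e := ((hf.hasMagDeriv j).add ((hφ'.hasMagDeriv j).smul (-1))).magDeriv_eq
      simp only [neg_smul, one_smul, ← sub_eq_add_neg] at e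
      rw [e, ← MemLp.toLp_sub, hc, ← mul_assoc]
      refine norm_toLp_le_of_forall_le hK _ (fun x hx => by
        simp [magTest, hφz x hx, hfz x hx, hdz φ hφK x hx, hdz f hfK x hx]) (by positivity)
        fun x => ?_
      by_cases hx : x ∈ K
      · have e2 : (S.magTest j f - S.magTest j φ) x
            = Complex.I * ((fderiv ℝ φ x - fderiv ℝ f x) (basisVec j))
              - (S.A x j : ℂ) * (φ x - f x) := by
          simp only [magTest, Pi.sub_apply, sub_apply]; ring
        rw [e2]
        have n1 : ‖(fderiv ℝ φ x - fderiv ℝ f x) (basisVec j)‖ ≤ η := by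
          refine (ContinuousLinearMap.le_opNorm _ _).trans ?_
          simpa using h1 x
        have n2 : ‖(S.A x j : ℂ)‖ ≤ max M 0 := by
          rw [Complex.norm_real]
          exact ((PiLp.norm_apply_le (S.A x) j).trans (hM x hx)).trans (le_max_left _ _)
        calc _ ≤ ‖Complex.I * ((fderiv ℝ φ x - fderiv ℝ f x) (basisVec j))‖
              + ‖(S.A x j : ℂ) * (φ x - f x)‖ := norm_sub_le _ _
          _ ≤ 1 * η + max M 0 * η := by
              rw [norm_mul, norm_mul, Complex.norm_I]
              gcongr
              exact h0 x
          _ = η * (1 + max M 0) := by ring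
      · simp only [magTest, Pi.sub_apply, hφz x hx, hfz x hx, hdz φ hφK x hx, hdz f hfK x hx]
        simp only [zero_apply, mul_zero, add_zero, sub_zero, norm_zero]
        positivity
    refine lt_of_le_of_lt (Real.sqrt_le_iff.2 ⟨by positivity, ?_⟩) hηε
    have hs : ∑ j, ‖S.magDeriv j (hf.memLp.toLp - hφ'.memLp.toLp : LTwo S.Ω)‖ ^ 2
        ≤ d * (η * c) ^ 2 := by
      refine (Finset.sum_le_card_nsmul _ _ ((η * c) ^ 2) fun j _ => ?_).trans (by simp)
      exact pow_le_pow_left₀ (norm_nonneg _) (b1 j) 2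
    have hb0 := pow_le_pow_left₀ (norm_nonneg _) b0 2
    rw [← mul_assoc, mul_pow, Real.sq_sqrt (by positivity)]
    linarith
  · have hV : ContinuousOn (fun x => ((√‖S.V x‖ : ℝ) : ℂ)) S.Ω :=
      Complex.continuous_ofReal.comp_continuousOn S.continuousOn_V.norm.sqrt
    have h2 : MemLp (fun x => ((√‖S.V x‖ : ℝ) : ℂ) * f x) 2 (volume.restrict S.Ω) :=
      ((S.continuous_mul_test hV hf.continuous hf.tsupport_subset).memLp_of_hasCompactSupport
        hf.hasCompactSupport.mul_left).restrict _
    refine h2.ae_eq ?_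
    filter_upwards [hf.memLp.coeFn_toLp] with x hx
    rw [hx]

end EMSystem

/-! ### Regularity of m, Φ, Ψ and the commutator of magnetic derivatives -/

theorem EuclideanSpace.norm_gradient_sq {d : ℕ} (g : Eucl d → ℝ) (x : Eucl d) :
    ‖gradient g x‖ ^ 2 = ∑ j, fderiv ℝ g x (basisVec j) ^ 2 := by
  rw [EuclideanSpace.norm_sq_eq]
  refine Finset.sum_congr rfl fun j _ => ?_
  have h : inner ℝ (gradient g x) (basisVec j) = fderiv ℝ g x (basisVec j) := by
    rw [gradient, InnerProductSpace.toDual_symm_apply]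
  rw [← h, EuclideanSpace.inner_single_right]
  simp

namespace EMSystem

variable {d : ℕ} (S : EMSystem d)

theorem contDiffOn_B (j k : Fin d) : ContDiffOn ℝ 1 (S.B j k) S.Ω := by
  have h : ContDiffOn ℝ 1 (fderiv ℝ S.A) S.Ω :=
    S.smooth_A.1.fderiv_of_isOpen S.isOpen_Ω (by norm_num)
  have h' : ∀ i l : Fin d, ContDiffOn ℝ 1 (fun x => fderiv ℝ S.A x (basisVec i) l) S.Ω :=
    fun i l => (EuclideanSpace.proj l : Eucl d →L[ℝ] ℝ).contDiff.comp_contDiffOn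
      (h.clm_apply contDiffOn_const)
  exact (h' j k).sub (h' k j)

theorem normSqB_nonneg (x : Eucl d) : 0 ≤ S.normSqB x :=
  Finset.sum_nonneg fun _ _ => Finset.sum_nonneg fun _ _ => sq_nonneg _

theorem mBV_sq (x : Eucl d) : S.mBV x ^ 2 = 1 + S.normSqB x + ‖S.V x‖ ^ 2 :=
  Real.sq_sqrt (by have := S.normSqB_nonneg x; positivity)

theorem one_le_mBV (x : Eucl d) : 1 ≤ S.mBV x := by
  refine Real.one_le_sqrt.2 ?_
  have := S.normSqB_nonneg x
  nlinarith [sq_nonneg ‖S.V x‖]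

theorem mBV_pos (x : Eucl d) : 0 < S.mBV x := zero_lt_one.trans_le (S.one_le_mBV x)

theorem contDiffOn_V : ContDiffOn ℝ 1 S.V S.Ω := S.smooth_V.1

theorem contDiffOn_mBV : ContDiffOn ℝ 1 S.mBV S.Ω := by
  refine ContDiffOn.sqrt ?_ fun x _ => ?_
  · refine (contDiffOn_const.add ?_).add (S.contDiffOn_V.norm_sq ℂ)
    exact ContDiffOn.sum fun j _ => ContDiffOn.sum fun k _ => (S.contDiffOn_B j k).pow 2
  · rw [← S.mBV_sq]
    exact (pow_pos (S.mBV_pos x) 2).ne'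

theorem contDiffOn_Φ : ContDiffOn ℝ 1 S.Φ S.Ω :=
  (Complex.imCLM.contDiff.comp_contDiffOn S.contDiffOn_V).div S.contDiffOn_mBV
    fun x _ => (S.mBV_pos x).ne'

theorem contDiffOn_Ψ (j k : Fin d) : ContDiffOn ℝ 1 (S.Ψ j k) S.Ω :=
  (S.contDiffOn_B j k).div S.contDiffOn_mBV fun x _ => (S.mBV_pos x).ne'

theorem norm_V_le_mBV (x : Eucl d) : ‖S.V x‖ ≤ S.mBV x :=
  abs_le_of_sq_le_sq' (by rw [S.mBV_sq]; linarith [S.normSqB_nonneg x]) (S.mBV_pos x).le |>.2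

theorem abs_B_le_mBV (j k : Fin d) (x : Eucl d) : |S.B j k x| ≤ S.mBV x := by
  refine abs_le_of_sq_le_sq ?_ (S.mBV_pos x).le
  have h : S.B j k x ^ 2 ≤ S.normSqB x :=
    (Finset.single_le_sum (f := fun k => S.B j k x ^ 2) (fun _ _ => sq_nonneg _)
      (Finset.mem_univ k)).trans (Finset.single_le_sum (f := fun j => ∑ k, S.B j k x ^ 2)
      (fun _ _ => Finset.sum_nonneg fun _ _ => sq_nonneg _) (Finset.mem_univ j))
  rw [S.mBV_sq]
  nlinarith [sq_nonneg ‖S.V x‖]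

theorem abs_Φ_le_one (x : Eucl d) : |S.Φ x| ≤ 1 := by
  rw [Φ, abs_div, abs_of_pos (S.mBV_pos x), div_le_one (S.mBV_pos x)]
  exact (Complex.abs_im_le_norm _).trans (S.norm_V_le_mBV x)

theorem abs_Ψ_le_one (j k : Fin d) (x : Eucl d) : |S.Ψ j k x| ≤ 1 := by
  rw [Ψ, abs_div, abs_of_pos (S.mBV_pos x), div_le_one (S.mBV_pos x)]
  exact S.abs_B_le_mBV j k x

variable {S}

theorem magTest_ofReal_mul (j : Fin d) {g : Eucl d → ℝ} {f : Eucl d → ℂ} {x : Eucl d}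
    (hg : DifferentiableAt ℝ g x) (hf : DifferentiableAt ℝ f x) :
    S.magTest j (fun y => (g y : ℂ) * f y) x
      = (g x : ℂ) * S.magTest j f x
        - Complex.I * ((fderiv ℝ g x (basisVec j) : ℝ) : ℂ) * f x := by
  have h : HasFDerivAt (fun y => (g y : ℂ)) (Complex.ofRealCLM.comp (fderiv ℝ g x)) x :=
    Complex.ofRealCLM.hasFDerivAt.comp x hg.hasFDerivAt
  have h' : HasFDerivAt (fun y => (g y : ℂ) * f y) _ x := h.mul hf.hasFDerivAt
  simp only [magTest, h'.fderiv]
  simp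
  ring

theorem _root_.IsC1Test.ofReal_mul {g : Eucl d → ℝ} {f : Eucl d → ℂ}
    (hg : ContDiffOn ℝ 1 g S.Ω) (hf : IsC1Test S.Ω f) :
    IsC1Test S.Ω (fun y => (g y : ℂ) * f y) :=
  hf.mul_left S.isOpen_Ω (Complex.ofRealCLM.contDiff.comp_contDiffOn hg)

theorem isC1Test_magTest (j : Fin d) {f : Eucl d → ℂ} (hf : ContDiff ℝ 2 f)
    (hc : HasCompactSupport f) (hs : tsupport f ⊆ S.Ω) : IsC1Test S.Ω (S.magTest j f) := by
  refine ⟨?_, IsC1Test.hasCompactSupport_magTest ⟨hf.of_le (by norm_num), hc, hs⟩ j, ?_⟩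
  · have h1 : ContDiff ℝ 1 (fun x => fderiv ℝ f x (basisVec j)) :=
      (hf.fderiv_right (by norm_num)).clm_apply contDiff_const
    exact (contDiff_const.mul h1).add (((S.contDiffOn_A_apply j).of_le
      (by norm_num)).contDiff_mul_of_tsupport_subset S.isOpen_Ω (hf.of_le (by norm_num)) hs)
  · refine (closure_minimal (fun x hx => ?_) (isClosed_tsupport f)).trans hs
    by_contra h
    refine hx ?_
    have hd : fderiv ℝ f x = 0 :=
      image_eq_zero_of_notMem_tsupport fun h' => h (tsupport_fderiv_subset (𝕜 := ℝ) h')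
    simp [magTest, image_eq_zero_of_notMem_tsupport h, hd]

/-- The commutator of two magnetic derivatives is the multiplication by `-i B_{jk}`. -/
theorem magTest_commutator (j k : Fin d) {f : Eucl d → ℂ} (hf : ContDiff ℝ 2 f) {x : Eucl d}
    (hx : x ∈ S.Ω) :
    S.magTest j (S.magTest k f) x - S.magTest k (S.magTest j f) x
      = -Complex.I * (S.B j k x : ℂ) * f x := by
  have hdf : DifferentiableAt ℝ (fderiv ℝ f) x :=
    ((hf.fderiv_right (m := 1) (by norm_num)).differentiable (by norm_num)) x
  have hA : DifferentiableAt ℝ S.A x :=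
    (S.smooth_A.1.contDiffAt (S.isOpen_Ω.mem_nhds hx)).differentiableAt (by norm_num)
  have hA' : ∀ i : Fin d, HasFDerivAt (fun y => ((S.A y i : ℝ) : ℂ))
      ((Complex.ofRealCLM.comp (EuclideanSpace.proj i : Eucl d →L[ℝ] ℝ)).comp (fderiv ℝ S.A x))
      x := fun i =>
    (Complex.ofRealCLM.comp (EuclideanSpace.proj i : Eucl d →L[ℝ] ℝ)).hasFDerivAt.comp x
      hA.hasFDerivAt
  have hff : HasFDerivAt f (fderiv ℝ f x) x :=
    (hf.differentiable (by norm_num) x).hasFDerivAt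
  have key : ∀ i l : Fin d, fderiv ℝ (S.magTest l f) x (basisVec i)
      = -Complex.I * fderiv ℝ (fderiv ℝ f) x (basisVec i) (basisVec l)
        + ((S.A x l : ℂ) * fderiv ℝ f x (basisVec i)
          + f x * ((fderiv ℝ S.A x (basisVec i) l : ℝ) : ℂ)) := by
    intro i l
    have h1 : HasFDerivAt (fun y => fderiv ℝ f y (basisVec l))
        ((ContinuousLinearMap.apply ℝ ℂ (basisVec l)).comp (fderiv ℝ (fderiv ℝ f) x)) x :=
      (ContinuousLinearMap.apply ℝ ℂ (basisVec l)).hasFDerivAt.comp x hdf.hasFDerivAt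
    have h2 := (h1.const_mul (-Complex.I)).add ((hA' l).mul hff)
    have h3 : HasFDerivAt (S.magTest l f) _ x := h2
    rw [h3.fderiv]
    simp
  have hsymm : fderiv ℝ (fderiv ℝ f) x (basisVec j) (basisVec k)
      = fderiv ℝ (fderiv ℝ f) x (basisVec k) (basisVec j) :=
    (hf.contDiffAt.isSymmSndFDerivAt (by simp)) _ _
  have e : ∀ i (g : Eucl d → ℂ), S.magTest i g x
    = -Complex.I * fderiv ℝ g x (basisVec i) + (S.A x i : ℂ) * g x := fun _ _ => rfl
  rw [e j (S.magTest k f), e k (S.magTest j f), key, key, hsymm, e k f, e j f, B]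
  push_cast
  ring

end EMSystem

/-! ### The form on 𝒞¹_c, the commutator identity and the pointwise inequalities -/

namespace EMSystem

variable {d : ℕ} {S : EMSystem d}

theorem _root_.IsC1Test.integrable_magTest_mul_conj {u v : Eucl d → ℂ} (hu : IsC1Test S.Ω u)
    (hv : IsC1Test S.Ω v) (j k : Fin d) :
    Integrable (fun x => S.magTest j u x * conj (S.magTest k v x)) :=
  ((hu.continuous_magTest j).mul
    (Complex.continuous_conj.comp (hv.continuous_magTest k))).integrable_of_hasCompactSupport
    (hu.hasCompactSupport_magTest j).mul_right

theorem integrable_V_mul_conj {u v : Eucl d → ℂ} (hu : IsC1Test S.Ω u)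
    (hv : IsC1Test S.Ω v) : Integrable (fun x => S.V x * u x * conj (v x)) :=
  ((S.continuous_mul_test S.continuousOn_V hu.continuous hu.tsupport_subset).mul
    hv.star.continuous).integrable_of_hasCompactSupport hu.hasCompactSupport.mul_left.mul_right

/-- The integrand of the sesquilinear form, for functions in `𝒞¹_c(Ω)`. -/
def formIntegrand (S : EMSystem d) (u v : Eucl d → ℂ) (x : Eucl d) : ℂ :=
  (∑ j, S.magTest j u x * conj (S.magTest j v x)) + S.V x * u x * conj (v x)

theorem integrable_formIntegrand {u v : Eucl d → ℂ} (hu : IsC1Test S.Ω u)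
    (hv : IsC1Test S.Ω v) : Integrable (S.formIntegrand u v) :=
  (integrable_finsetSum _ fun j _ => hu.integrable_magTest_mul_conj hv j j).add
    (integrable_V_mul_conj hu hv)

theorem Q_toLp {u v : Eucl d → ℂ} (hu : IsC1Test S.Ω u) (hv : IsC1Test S.Ω v) :
    S.Q hu.memLp.toLp hv.memLp.toLp = ∫ x, S.formIntegrand u v x := by
  have h1 : ∀ j, inner ℂ (S.magDeriv j hv.memLp.toLp) (S.magDeriv j hu.memLp.toLp)
      = ∫ x, S.magTest j u x * conj (S.magTest j v x) := by
    intro j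
    rw [hv.magDeriv_eq, hu.magDeriv_eq, L2.inner_def,
      ← setIntegral_eq_integral_of_forall_compl_eq_zero (s := S.Ω)
        (f := fun x => S.magTest j u x * conj (S.magTest j v x))
        (fun x hx => by simp [hu.magTest_eq_zero j hx])]
    refine integral_congr_ae ?_
    filter_upwards [(hu.memLp_magTest j).coeFn_toLp, (hv.memLp_magTest j).coeFn_toLp]
      with x h1 h2
    rw [h1, h2, RCLike.inner_apply]
  have h2 : ∫ x in S.Ω, S.V x * (hu.memLp.toLp : LTwo S.Ω) x
      * conj ((hv.memLp.toLp : LTwo S.Ω) x) = ∫ x, S.V x * u x * conj (v x) := by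
    rw [← setIntegral_eq_integral_of_forall_compl_eq_zero (s := S.Ω)
        (f := fun x => S.V x * u x * conj (v x)) (fun x hx => by simp [hu.eq_zero hx])]
    refine integral_congr_ae ?_
    filter_upwards [hu.memLp.coeFn_toLp, hv.memLp.coeFn_toLp] with x h1 h2
    rw [h1, h2]
  simp only [Q, h1, h2, formIntegrand]
  rw [integral_add (integrable_finsetSum _ fun j _ => hu.integrable_magTest_mul_conj hv j j)
    (integrable_V_mul_conj hu hv),
    integral_finsetSum _ fun j _ => hu.integrable_magTest_mul_conj hv j j]

/-- Integrand of the commutator identity. -/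
def commIntegrand (S : EMSystem d) (j k : Fin d) (f : Eucl d → ℂ) (x : Eucl d) : ℝ :=
  (Complex.I * (S.magTest k f x * conj (S.magTest j (fun y => (S.Ψ j k y : ℂ) * f y) x)
    - S.magTest j f x * conj (S.magTest k (fun y => (S.Ψ j k y : ℂ) * f y) x))).re
    - S.Ψ j k x * S.B j k x * ‖f x‖ ^ 2

/-- By symmetry P_j and P_k move off Ψ_{jk}f, leaving i⟨[P_j, P_k]f, Ψ_{jk}f⟩ = ∫ Ψ_{jk}B_{jk}|f|².
Second derivatives of f occur on the way. -/
theorem commIntegrand_integral (j k : Fin d) {f : Eucl d → ℂ} (hf : ContDiff ℝ 2 f)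
    (hc : HasCompactSupport f) (hs : tsupport f ⊆ S.Ω) :
    Integrable (S.commIntegrand j k f) ∧ ∫ x, S.commIntegrand j k f x = 0 := by
  have h1 : IsC1Test S.Ω f := ⟨hf.of_le (by norm_num), hc, hs⟩
  have hg : IsC1Test S.Ω (fun y => (S.Ψ j k y : ℂ) * f y) := h1.ofReal_mul (S.contDiffOn_Ψ j k)
  have hP : ∀ i, IsC1Test S.Ω (S.magTest i f) := fun i => isC1Test_magTest i hf hc hs
  have hBf : IsC1Test S.Ω (fun y => (S.B j k y : ℂ) * f y) := h1.ofReal_mul (S.contDiffOn_B j k)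
  have iA := h1.integrable_magTest_mul_conj hg k j
  have iB := h1.integrable_magTest_mul_conj hg j k
  have i1 : Integrable (fun x => S.magTest j (S.magTest k f) x * conj ((S.Ψ j k x : ℂ) * f x)) :=
    (((hP k).continuous_magTest j).mul hg.star.continuous).integrable_of_hasCompactSupport
      ((hP k).hasCompactSupport_magTest j).mul_right
  have i2 : Integrable (fun x => S.magTest k (S.magTest j f) x * conj ((S.Ψ j k x : ℂ) * f x)) :=
    (((hP j).continuous_magTest k).mul hg.star.continuous).integrable_of_hasCompactSupport
      ((hP j).hasCompactSupport_magTest k).mul_right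
  have i3 : Integrable (fun x => (((S.Ψ j k x * S.B j k x * ‖f x‖ ^ 2 : ℝ)) : ℂ)) := by
    have : Integrable (fun x => ((S.B j k x : ℂ) * f x) * conj ((S.Ψ j k x : ℂ) * f x)) :=
      (hBf.continuous.mul hg.star.continuous).integrable_of_hasCompactSupport
        hBf.hasCompactSupport.mul_right
    refine this.congr (Eventually.of_forall fun x => ?_)
    push_cast
    rw [← Complex.mul_conj', map_mul, Complex.conj_ofReal]
    ring
  have e1 := integral_mul_conj_magTest j (hP k) hg
  have e2 := integral_mul_conj_magTest k (hP j) hg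
  have iAB : Integrable (fun x => Complex.I * (S.magTest k f x
      * conj (S.magTest j (fun y => (S.Ψ j k y : ℂ) * f y) x)
    - S.magTest j f x * conj (S.magTest k (fun y => (S.Ψ j k y : ℂ) * f y) x))) :=
    (iA.sub iB).const_mul _
  have i12 : Integrable (fun x => Complex.I *
      (S.magTest j (S.magTest k f) x * conj ((S.Ψ j k x : ℂ) * f x)
        - S.magTest k (S.magTest j f) x * conj ((S.Ψ j k x : ℂ) * f x))) :=
    (i1.sub i2).const_mul _
  have hI : Integrable (fun x => Complex.I * (S.magTest k f x
      * conj (S.magTest j (fun y => (S.Ψ j k y : ℂ) * f y) x)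
    - S.magTest j f x * conj (S.magTest k (fun y => (S.Ψ j k y : ℂ) * f y) x))
    - ((S.Ψ j k x * S.B j k x * ‖f x‖ ^ 2 : ℝ) : ℂ)) := iAB.sub i3
  have hre : S.commIntegrand j k f = fun x => (Complex.I * (S.magTest k f x
      * conj (S.magTest j (fun y => (S.Ψ j k y : ℂ) * f y) x)
    - S.magTest j f x * conj (S.magTest k (fun y => (S.Ψ j k y : ℂ) * f y) x))
    - ((S.Ψ j k x * S.B j k x * ‖f x‖ ^ 2 : ℝ) : ℂ)).re := by
    funext x
    rw [commIntegrand, Complex.sub_re, Complex.ofReal_re]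
  have hz : ∫ x, (Complex.I * (S.magTest k f x
      * conj (S.magTest j (fun y => (S.Ψ j k y : ℂ) * f y) x)
    - S.magTest j f x * conj (S.magTest k (fun y => (S.Ψ j k y : ℂ) * f y) x))
    - ((S.Ψ j k x * S.B j k x * ‖f x‖ ^ 2 : ℝ) : ℂ)) = 0 := by
    rw [integral_sub iAB i3, integral_const_mul, integral_sub iA iB, e1, e2,
      ← integral_sub i1 i2, ← integral_const_mul, ← integral_sub i12 i3]
    refine integral_eq_zero_of_ae (Eventually.of_forall fun x => ?_)
    by_cases hx : x ∈ S.Ω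
    · have hcomm := magTest_commutator (S := S) j k hf hx
      have : ((S.Ψ j k x * S.B j k x * ‖f x‖ ^ 2 : ℝ) : ℂ)
          = (S.Ψ j k x : ℂ) * (S.B j k x : ℂ) * (f x * conj (f x)) := by
        rw [Complex.mul_conj']; push_cast; ring
      simp only [Pi.zero_apply, this, map_mul, Complex.conj_ofReal]
      linear_combination (Complex.I * (S.Ψ j k x : ℂ) * conj (f x)) * hcomm
        - ((S.Ψ j k x : ℂ) * (S.B j k x : ℂ) * (f x * conj (f x))) * Complex.I_sq
    · simp [h1.eq_zero hx]
  refine ⟨hre ▸ hI.re, ?_⟩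
  have := integral_re hI
  rw [hz] at this
  rw [hre]
  exact this.trans (by simp)

/-- The kinetic part in one direction j: p is P_jφ, z is φ, and (t, t'), (s, s') are the values and
j-th derivatives of θ and Φ, so that F below is P_j(θφ). -/
theorem form_term_ge (p z : ℂ) (t t' s s' : ℝ) (hs : |s| ≤ 1) :
    (23 / 36 : ℝ) * ‖(t : ℂ) * p - Complex.I * t' * z‖ ^ 2
        - 9 * s' ^ 2 * (t ^ 2 * ‖z‖ ^ 2) - 4 * t' ^ 2 * ‖z‖ ^ 2
      ≤ (p * conj ((t ^ 2 : ℝ) * p - Complex.I * ((2 * t * t' : ℝ) : ℂ) * z)).re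
        + (p * conj ((s * t ^ 2 : ℝ) * p
          - Complex.I * ((s' * t ^ 2 + 2 * s * t * t' : ℝ) : ℂ) * z)).im := by
  set F : ℂ := (t : ℂ) * p - Complex.I * t' * z with hF
  have hFr : F.re = t * p.re + t' * z.im := by simp [hF]
  have hFi : F.im = t * p.im - t' * z.re := by simp [hF]
  -- The real part is the exact localisation formula. The imaginary part reduces to Re(F z̄) times
  -- (s't + 2st'), since |p|² contributes nothing to it.
  have e : (p * conj ((t ^ 2 : ℝ) * p - Complex.I * ((2 * t * t' : ℝ) : ℂ) * z)).re
        + (p * conj ((s * t ^ 2 : ℝ) * p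
          - Complex.I * ((s' * t ^ 2 + 2 * s * t * t' : ℝ) : ℂ) * z)).im
      = ‖F‖ ^ 2 - t' ^ 2 * ‖z‖ ^ 2
        + (F.re * z.re + F.im * z.im) * (s' * t + 2 * s * t') := by
    rw [Complex.sq_norm, Complex.sq_norm, Complex.normSq_apply, Complex.normSq_apply, hFr, hFi]
    simp only [Complex.mul_re, Complex.mul_im, Complex.conj_re, Complex.conj_im, Complex.sub_re,
      Complex.sub_im, Complex.I_re, Complex.I_im, Complex.ofReal_re, Complex.ofReal_im]
    ring
  rw [e]
  have hq : (F.re * z.re + F.im * z.im) ^ 2 ≤ ‖F‖ ^ 2 * ‖z‖ ^ 2 := by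
    rw [Complex.sq_norm, Complex.sq_norm, Complex.normSq_apply, Complex.normSq_apply]
    nlinarith [sq_nonneg (F.re * z.im - F.im * z.re)]
  set q := F.re * z.re + F.im * z.im
  have hq' : |q| ≤ ‖F‖ * ‖z‖ :=
    abs_le_of_sq_le_sq (by rw [mul_pow]; exact hq) (by positivity)
  -- The Young weights put 9, the constant of the hypothesis, in front of (s't)². With the 1/3 spent
  -- in the next splitting, 1 - 1/36 - 1/3 = 23/36 of the kinetic term survives, and t'² receives 1
  -- + 3 = 4.
  have h1 : -(1 / 36 * ‖F‖ ^ 2 + 9 * (s' * t) ^ 2 * ‖z‖ ^ 2) ≤ q * (s' * t) := by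
    have : |q * (s' * t)| ≤ ‖F‖ * (‖z‖ * |s' * t|) := by
      rw [abs_mul, ← mul_assoc]; gcongr
    have h2 := neg_le_of_abs_le this
    nlinarith [sq_nonneg (‖F‖ / 6 - 3 * (‖z‖ * |s' * t|)), sq_abs (s' * t)]
  have h2 : -(1 / 3 * ‖F‖ ^ 2 + 3 * t' ^ 2 * ‖z‖ ^ 2) ≤ q * (2 * s * t') := by
    have : |q * (2 * s * t')| ≤ 2 * (‖F‖ * (‖z‖ * |t'|)) := by
      rw [abs_mul, abs_mul, abs_mul, abs_two]
      calc |q| * (2 * |s| * |t'|) ≤ (‖F‖ * ‖z‖) * (2 * 1 * |t'|) := by gcongr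
        _ = _ := by ring
    have h2 := neg_le_of_abs_le this
    nlinarith [sq_nonneg (‖F‖ - 3 * (‖z‖ * |t'|)), sq_abs t']
  nlinarith

/-- The two products ‖P‖‖P'‖ cost ‖P‖² + ‖P'‖², and each derivative of Ψ costs half a square more on
both sides, hence 3/2 and 1/2. -/
theorem comm_term_le (P P' f : ℂ) (s a b : ℝ) (hs : |s| ≤ 1) :
    (Complex.I * (P' * conj ((s : ℂ) * P - Complex.I * a * f)
      - P * conj ((s : ℂ) * P' - Complex.I * b * f))).re
      ≤ 3 / 2 * (‖P‖ ^ 2 + ‖P'‖ ^ 2) + 1 / 2 * (a ^ 2 + b ^ 2) * ‖f‖ ^ 2 := by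
  have h0 : ∀ (X Y : ℂ) (c : ℝ), ‖X * conj ((s : ℂ) * Y - Complex.I * c * f)‖
      ≤ ‖X‖ * ‖Y‖ + ‖X‖ * (|c| * ‖f‖) := by
    intro X Y c
    rw [norm_mul, RCLike.norm_conj, ← mul_add]
    gcongr
    refine (norm_sub_le _ _).trans ?_
    rw [norm_mul, norm_mul, norm_mul, Complex.norm_I, Complex.norm_real, Complex.norm_real,
      Real.norm_eq_abs, Real.norm_eq_abs, one_mul]
    gcongr
    exact mul_le_of_le_one_left (norm_nonneg _) hs
  refine (Complex.re_le_norm _).trans ?_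
  rw [norm_mul, Complex.norm_I, one_mul]
  refine (norm_sub_le _ _).trans ?_
  have h1 := h0 P' P a
  have h2 := h0 P P' b
  nlinarith [sq_nonneg (‖P‖ - ‖P'‖), sq_nonneg (‖P'‖ - |a| * ‖f‖), sq_nonneg (‖P‖ - |b| * ‖f‖),
    sq_abs a, sq_abs b]

end EMSystem

/-! ### The weighted coercivity estimate -/

namespace EMSystem

variable {d : ℕ} {S : EMSystem d}

/-- In the sum over all pairs each F_j² occurs 2d times with factor 3/2. The total 3d explains the
1/(12d) in the hypothesis: it makes the commutator cost exactly a quarter of the kinetic energy. -/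
theorem sum_comm_term_le (F : Fin d → ℝ) (a b N : Fin d → Fin d → ℝ) (r : ℝ) (hr : 0 ≤ r)
    (ha : ∀ j k, a j k ^ 2 ≤ N j k) (hb : ∀ j k, b j k ^ 2 ≤ N j k) :
    ∑ j, ∑ k, (3 / 2 * (F j ^ 2 + F k ^ 2) + 1 / 2 * (a j k ^ 2 + b j k ^ 2) * r)
      ≤ 3 * d * ∑ j, F j ^ 2 + (∑ j, ∑ k, N j k) * r := by
  have h1 : ∑ j, ∑ k, (3 / 2 * (F j ^ 2 + F k ^ 2) + 1 / 2 * (a j k ^ 2 + b j k ^ 2) * r)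
      ≤ ∑ j, ∑ k, (3 / 2 * (F j ^ 2 + F k ^ 2) + N j k * r) := by
    refine Finset.sum_le_sum fun j _ => Finset.sum_le_sum fun k _ => ?_
    have := ha j k
    have := hb j k
    nlinarith
  refine h1.trans (le_of_eq ?_)
  simp only [Finset.sum_add_distrib, ← Finset.mul_sum, ← Finset.sum_mul, Finset.sum_const,
    Finset.card_univ, Fintype.card_fin, nsmul_eq_mul]
  ring

theorem gradient_apply_sq_le (g : Eucl d → ℝ) (x : Eucl d) (j : Fin d) :
    fderiv ℝ g x (basisVec j) ^ 2 ≤ ‖gradient g x‖ ^ 2 := by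
  rw [EuclideanSpace.norm_gradient_sq]
  exact Finset.single_le_sum (f := fun j => fderiv ℝ g x (basisVec j) ^ 2)
    (fun _ _ => sq_nonneg _) (Finset.mem_univ j)

/-- The density in the lower bound of the weighted coercivity estimate. -/
def coerciveIntegrand (S : EMSystem d) (γ₁ γ₂ : ℝ) (θ : Eucl d → ℝ) (φ : Eucl d → ℂ)
    (x : Eucl d) : ℝ :=
  1 / 4 * ∑ j, ‖S.magTest j (fun y => (θ y : ℂ) * φ y) x‖ ^ 2
    + (γ₁ * ‖S.V x‖ - γ₂) * (θ x ^ 2 * ‖φ x‖ ^ 2) - 4 * ‖gradient θ x‖ ^ 2 * ‖φ x‖ ^ 2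

/-- The commutator terms, of zero integral, are subtracted with weight 1/(12d) to create
|B|²/(12dm). Of the kinetic part 23/36 - 1/4 remains, which exceeds 1/4; the |∇Ψ|² error has factor
1/(12d) ≤ 1 and is covered by the 9 of the hypothesis. -/
theorem coerciveIntegrand_le (hd : 1 ≤ d) {γ₁ γ₂ : ℝ} (hbound : S.PotentialBound γ₁ γ₂)
    {φ : Eucl d → ℂ} (hφ : IsTestFunction S.Ω φ) {θ : Eucl d → ℝ} (hθ : ContDiff ℝ ∞ θ)
    (x : Eucl d) :
    S.coerciveIntegrand γ₁ γ₂ θ φ x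
      ≤ (S.formIntegrand φ (fun y => ((θ y ^ 2 : ℝ) : ℂ) * φ y) x).re
        + (S.formIntegrand φ (fun y => ((S.Φ y * θ y ^ 2 : ℝ) : ℂ) * φ y) x).im
        - 1 / (12 * (d : ℝ)) *
          ∑ j, ∑ k, S.commIntegrand j k (fun y => (θ y : ℂ) * φ y) x := by
  by_cases hx : x ∈ S.Ω
  swap
  · have hf : IsC1Test S.Ω (fun y => (θ y : ℂ) * φ y) :=
      hφ.isC1Test.ofReal_mul (hθ.of_le (by simp)).contDiffOn
    have h0 := hf.eq_zero hx
    simp [coerciveIntegrand, formIntegrand, commIntegrand, hφ.isC1Test.magTest_eq_zero _ hx,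
      hf.magTest_eq_zero _ hx, hφ.isC1Test.eq_zero hx]
  have hD : (1 : ℝ) ≤ d := by exact_mod_cast hd
  have hnhds := S.isOpen_Ω.mem_nhds hx
  have dφ : DifferentiableAt ℝ φ x := hφ.isC1Test.differentiable x
  have dθ : DifferentiableAt ℝ θ x := hθ.differentiable (by simp) x
  have dΦ : DifferentiableAt ℝ S.Φ x :=
    (S.contDiffOn_Φ.contDiffAt hnhds).differentiableAt (by simp)
  have dΨ : ∀ j k, DifferentiableAt ℝ (S.Ψ j k) x := fun j k =>
    ((S.contDiffOn_Ψ j k).contDiffAt hnhds).differentiableAt (by simp)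
  have df : DifferentiableAt ℝ (fun y => (θ y : ℂ) * φ y) x :=
    (Complex.ofRealCLM.differentiableAt.comp x dθ).mul dφ
  set z := φ x with hz
  set t := θ x with ht
  set t' : Fin d → ℝ := fun j => fderiv ℝ θ x (basisVec j) with ht'
  set s := S.Φ x with hs
  set s' : Fin d → ℝ := fun j => fderiv ℝ S.Φ x (basisVec j) with hs'
  set F : Fin d → ℂ := fun j => S.magTest j (fun y => (θ y : ℂ) * φ y) x with hF
  have eF : ∀ j, F j = (t : ℂ) * S.magTest j φ x - Complex.I * t' j * z := fun j =>
    magTest_ofReal_mul j dθ dφ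
  have e1 : ∀ j, S.magTest j (fun y => ((θ y ^ 2 : ℝ) : ℂ) * φ y) x
      = ((t ^ 2 : ℝ) : ℂ) * S.magTest j φ x - Complex.I * ((2 * t * t' j : ℝ) : ℂ) * z := by
    intro j
    have hg : fderiv ℝ (fun y => θ y ^ 2) x (basisVec j) = 2 * t * t' j := by
      rw [(dθ.hasFDerivAt.pow 2).fderiv]
      simp [ht, ht']
    have h := magTest_ofReal_mul (S := S) (g := fun y => θ y ^ 2) j (dθ.pow 2) dφ
    rwa [hg] at h
  have e2 : ∀ j, S.magTest j (fun y => ((S.Φ y * θ y ^ 2 : ℝ) : ℂ) * φ y) x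
      = ((s * t ^ 2 : ℝ) : ℂ) * S.magTest j φ x
        - Complex.I * ((s' j * t ^ 2 + 2 * s * t * t' j : ℝ) : ℂ) * z := by
    intro j
    have hg : fderiv ℝ (fun y => S.Φ y * θ y ^ 2) x (basisVec j)
        = s' j * t ^ 2 + 2 * s * t * t' j := by
      have h : HasFDerivAt (fun y => S.Φ y * θ y ^ 2) _ x :=
        dΦ.hasFDerivAt.mul (dθ.hasFDerivAt.pow 2)
      rw [h.fderiv]
      simp [ht, ht', hs, hs']
      ring
    have h := magTest_ofReal_mul (S := S) (g := fun y => S.Φ y * θ y ^ 2) j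
      (dΦ.mul (dθ.pow 2)) dφ
    rwa [hg] at h
  have e3 : ∀ j k i, S.magTest i (fun y => (S.Ψ j k y : ℂ) * ((θ y : ℂ) * φ y)) x
      = (S.Ψ j k x : ℂ) * F i
        - Complex.I * ((fderiv ℝ (S.Ψ j k) x (basisVec i) : ℝ) : ℂ) * ((t : ℂ) * z) :=
    fun j k i => magTest_ofReal_mul i (dΨ j k) df
  have hfz : ‖(t : ℂ) * z‖ ^ 2 = t ^ 2 * ‖z‖ ^ 2 := by
    rw [norm_mul, mul_pow, Complex.norm_real, Real.norm_eq_abs, sq_abs]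
  set r := t ^ 2 * ‖z‖ ^ 2 with hr
  have hr0 : 0 ≤ r := by positivity
  set X := ∑ j, ‖F j‖ ^ 2 with hX
  have hX0 : 0 ≤ X := Finset.sum_nonneg fun _ _ => sq_nonneg _
  have hform : (23 / 36 : ℝ) * X - 9 * ‖gradient S.Φ x‖ ^ 2 * r
        - 4 * ‖gradient θ x‖ ^ 2 * ‖z‖ ^ 2 + ((S.V x).re + s * (S.V x).im) * r
      ≤ (S.formIntegrand φ (fun y => ((θ y ^ 2 : ℝ) : ℂ) * φ y) x).re
        + (S.formIntegrand φ (fun y => ((S.Φ y * θ y ^ 2 : ℝ) : ℂ) * φ y) x).im := by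
    have hsum := Finset.sum_le_sum fun j (_ : j ∈ Finset.univ) =>
      form_term_ge (S.magTest j φ x) z t (t' j) s (s' j) (S.abs_Φ_le_one x)
    simp only [← eF, ← e1, ← e2] at hsum
    have hV1 : (S.V x * z * conj (((t ^ 2 : ℝ) : ℂ) * z)).re = (S.V x).re * r := by
      rw [map_mul, Complex.conj_ofReal, hr, Complex.sq_norm, Complex.normSq_apply]
      simp only [Complex.mul_re, Complex.mul_im, Complex.conj_re, Complex.conj_im,
        Complex.ofReal_re, Complex.ofReal_im]
      ring
    have hV2 : (S.V x * z * conj (((s * t ^ 2 : ℝ) : ℂ) * z)).im = s * (S.V x).im * r := by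
      rw [map_mul, Complex.conj_ofReal, hr, Complex.sq_norm, Complex.normSq_apply]
      simp only [Complex.mul_re, Complex.mul_im, Complex.conj_re, Complex.conj_im,
        Complex.ofReal_re, Complex.ofReal_im]
      ring
    simp only [formIntegrand, Complex.add_re, Complex.add_im, Complex.re_sum, Complex.im_sum]
    simp only [← hz, ← ht, ← hs]
    rw [hV1, hV2, EuclideanSpace.norm_gradient_sq, EuclideanSpace.norm_gradient_sq]
    simp only [Finset.sum_sub_distrib, Finset.sum_add_distrib, ← Finset.mul_sum,
      ← Finset.sum_mul] at hsum
    linarith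
  have hcomm : ∑ j, ∑ k, S.commIntegrand j k (fun y => (θ y : ℂ) * φ y) x
      ≤ 3 * d * X + (∑ j, ∑ k, ‖gradient (S.Ψ j k) x‖ ^ 2) * r
        - S.normSqB x / S.mBV x * r := by
    have h1 : ∀ j k, S.commIntegrand j k (fun y => (θ y : ℂ) * φ y) x
        ≤ (3 / 2 * (‖F j‖ ^ 2 + ‖F k‖ ^ 2)
          + 1 / 2 * (fderiv ℝ (S.Ψ j k) x (basisVec j) ^ 2
            + fderiv ℝ (S.Ψ j k) x (basisVec k) ^ 2) * r)
          - S.B j k x ^ 2 / S.mBV x * r := by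
      intro j k
      have := comm_term_le (F j) (F k) ((t : ℂ) * z) (S.Ψ j k x)
        (fderiv ℝ (S.Ψ j k) x (basisVec j)) (fderiv ℝ (S.Ψ j k) x (basisVec k))
        (S.abs_Ψ_le_one j k x)
      rw [hfz] at this
      have h2 : S.Ψ j k x * S.B j k x = S.B j k x ^ 2 / S.mBV x := by
        rw [Ψ]; ring
      simp only [commIntegrand]
      rw [e3, e3]
      simp only [← hz, ← ht]
      rw [h2, hfz]
      linarith
    refine (Finset.sum_le_sum fun j _ => Finset.sum_le_sum fun k _ => h1 j k).trans ?_
    have h3 := sum_comm_term_le (fun j => ‖F j‖) (fun j k => fderiv ℝ (S.Ψ j k) x (basisVec j))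
      (fun j k => fderiv ℝ (S.Ψ j k) x (basisVec k)) (fun j k => ‖gradient (S.Ψ j k) x‖ ^ 2) r hr0
      (fun j k => gradient_apply_sq_le _ _ _) (fun j k => gradient_apply_sq_le _ _ _)
    simp only [Finset.sum_sub_distrib, ← Finset.sum_mul, ← Finset.sum_div]
    rw [← normSqB]
    linarith
  have hb := hbound x hx
  have hsV : s * (S.V x).im = (S.V x).im ^ 2 / S.mBV x := by rw [hs, Φ]; ring
  set N := ∑ j, ∑ k, ‖gradient (S.Ψ j k) x‖ ^ 2 with hN
  have hN0 : 0 ≤ N := Finset.sum_nonneg fun _ _ => Finset.sum_nonneg fun _ _ => sq_nonneg _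
  have hc' := mul_le_mul_of_nonneg_left hcomm (a := 1 / (12 * (d : ℝ))) (by positivity)
  have e4 : 1 / (12 * (d : ℝ)) * (3 * d * X + N * r - S.normSqB x / S.mBV x * r)
      = 1 / 4 * X + 1 / (12 * (d : ℝ)) * (N * r)
        - 1 / (12 * (d : ℝ)) * (S.normSqB x / S.mBV x) * r := by
    field_simp
    ring
  have h5 : 1 / (12 * (d : ℝ)) * (N * r) ≤ 1 * (N * r) := by
    refine mul_le_mul_of_nonneg_right ?_ (by positivity)
    rw [div_le_one (by positivity)]
    linarith
  have h6 := mul_le_mul_of_nonneg_right hb hr0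
  have h7 : ((S.V x).im ^ 2 + 1 / (12 * (d : ℝ)) * S.normSqB x) / S.mBV x
      = (S.V x).im ^ 2 / S.mBV x + 1 / (12 * (d : ℝ)) * (S.normSqB x / S.mBV x) := by ring
  rw [h7] at h6
  rw [hsV] at hform
  have h8 : S.coerciveIntegrand γ₁ γ₂ θ φ x
      = 1 / 4 * X + (γ₁ * ‖S.V x‖ - γ₂) * r - 4 * ‖gradient θ x‖ ^ 2 * ‖z‖ ^ 2 := rfl
  rw [h8]
  have h9 : 0 ≤ N * r := by positivity
  nlinarith

theorem integrable_coerciveIntegrand (γ₁ γ₂ : ℝ) {φ : Eucl d → ℂ} (hφ : IsTestFunction S.Ω φ)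
    {θ : Eucl d → ℝ} (hθ : ContDiff ℝ ∞ θ) : Integrable (S.coerciveIntegrand γ₁ γ₂ θ φ) := by
  have hθ1 : ContDiff ℝ 1 θ := hθ.of_le (by simp)
  have hf : IsC1Test S.Ω (fun y => (θ y : ℂ) * φ y) := hφ.isC1Test.ofReal_mul hθ1.contDiffOn
  have i1 : ∀ j, Integrable (fun x => ‖S.magTest j (fun y => (θ y : ℂ) * φ y) x‖ ^ 2) := by
    intro j
    have hc : Continuous (fun x => ‖S.magTest j (fun y => (θ y : ℂ) * φ y) x‖ ^ 2) :=
      (hf.continuous_magTest j).norm.pow 2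
    refine hc.integrable_of_hasCompactSupport ?_
    refine HasCompactSupport.intro (hf.hasCompactSupport_magTest j) fun x hx => ?_
    rw [image_eq_zero_of_notMem_tsupport hx, norm_zero, zero_pow two_ne_zero]
  have hV : Continuous (fun x => S.V x * φ x) :=
    S.continuous_mul_test S.continuousOn_V hφ.1.continuous hφ.2.2
  have i2 : Integrable (fun x => (γ₁ * ‖S.V x‖ - γ₂) * (θ x ^ 2 * ‖φ x‖ ^ 2)) := by
    -- V is continuous on Ω only, so |V||φ|² is written as |Vφ||φ|, which is continuous on the whole
    -- space.
    have hc : Continuous (fun x => γ₁ * (θ x ^ 2 * (‖S.V x * φ x‖ * ‖φ x‖))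
        - γ₂ * (θ x ^ 2 * ‖φ x‖ ^ 2)) :=
      (continuous_const.mul ((hθ.continuous.pow 2).mul (hV.norm.mul hφ.1.continuous.norm))).sub
        (continuous_const.mul ((hθ.continuous.pow 2).mul (hφ.1.continuous.norm.pow 2)))
    have hi := hc.integrable_of_hasCompactSupport (μ := volume) (by
      refine HasCompactSupport.intro hφ.2.1 fun x hx => ?_
      simp [image_eq_zero_of_notMem_tsupport hx])
    refine hi.congr (Eventually.of_forall fun x => ?_)
    simp only [norm_mul]
    ring
  have hg : Continuous (fun x => ‖gradient θ x‖) := by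
    have h : ∀ x, ‖gradient θ x‖ = ‖fderiv ℝ θ x‖ := fun x => by rw [gradient]; simp
    simp only [h]
    exact (hθ.continuous_fderiv (by simp)).norm
  have i3 : Integrable (fun x => 4 * ‖gradient θ x‖ ^ 2 * ‖φ x‖ ^ 2) := by
    have hc : Continuous (fun x => 4 * ‖gradient θ x‖ ^ 2 * ‖φ x‖ ^ 2) :=
      (continuous_const.mul (hg.pow 2)).mul (hφ.1.continuous.norm.pow 2)
    refine hc.integrable_of_hasCompactSupport ?_
    refine HasCompactSupport.intro hφ.2.1 fun x hx => ?_
    simp [image_eq_zero_of_notMem_tsupport hx]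
  have i4 : Integrable (fun x =>
      1 / 4 * ∑ j, ‖S.magTest j (fun y => (θ y : ℂ) * φ y) x‖ ^ 2) :=
    (integrable_finsetSum _ fun j _ => i1 j).const_mul _
  exact (i4.add i2).sub i3

/-- The weighted coercivity estimate. -/
theorem integral_coerciveIntegrand_le (hd : 1 ≤ d) {γ₁ γ₂ : ℝ}
    (hbound : S.PotentialBound γ₁ γ₂) {φ : Eucl d → ℂ} (hφ : IsTestFunction S.Ω φ)
    {θ : Eucl d → ℝ} (hθ : ContDiff ℝ ∞ θ) :
    ∫ x, S.coerciveIntegrand γ₁ γ₂ θ φ x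
      ≤ (∫ x, S.formIntegrand φ (fun y => ((θ y ^ 2 : ℝ) : ℂ) * φ y) x).re
        + (∫ x, S.formIntegrand φ (fun y => ((S.Φ y * θ y ^ 2 : ℝ) : ℂ) * φ y) x).im := by
  have hθ1 : ContDiff ℝ 1 θ := hθ.of_le (by simp)
  have h1 : IsC1Test S.Ω (fun y => ((θ y ^ 2 : ℝ) : ℂ) * φ y) :=
    hφ.isC1Test.ofReal_mul (g := fun y => θ y ^ 2) (hθ1.pow 2).contDiffOn
  have h2 : IsC1Test S.Ω (fun y => ((S.Φ y * θ y ^ 2 : ℝ) : ℂ) * φ y) :=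
    hφ.isC1Test.ofReal_mul (g := fun y => S.Φ y * θ y ^ 2)
      (S.contDiffOn_Φ.mul (hθ1.pow 2).contDiffOn)
  -- The commutator identity needs θφ of class 𝒞²; the Agmon distance, only locally Lipschitz, must
  -- therefore be mollified before it enters θ.
  have hf : ContDiff ℝ 2 (fun y => (θ y : ℂ) * φ y) :=
    (Complex.ofRealCLM.contDiff.comp (hθ.of_le (WithTop.coe_le_coe.2 le_top))).mul
      (hφ.1.of_le (WithTop.coe_le_coe.2 le_top))
  have hcomm := fun j k => commIntegrand_integral (S := S) j k hf hφ.2.1.mul_left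
    (tsupport_mul_subset_right.trans hφ.2.2)
  have i1 := integrable_formIntegrand hφ.isC1Test h1
  have i2 := integrable_formIntegrand hφ.isC1Test h2
  have i3 : Integrable (fun x => 1 / (12 * (d : ℝ)) *
      ∑ j, ∑ k, S.commIntegrand j k (fun y => (θ y : ℂ) * φ y) x) :=
    (integrable_finsetSum _ fun j _ => integrable_finsetSum _ fun k _ => (hcomm j k).1).const_mul _
  have e3 : ∫ x, 1 / (12 * (d : ℝ)) *
      ∑ j, ∑ k, S.commIntegrand j k (fun y => (θ y : ℂ) * φ y) x = 0 := by
    rw [integral_const_mul, integral_finsetSum _ fun j _ =>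
      integrable_finsetSum _ fun k _ => (hcomm j k).1]
    simp only [integral_finsetSum _ fun k _ => (hcomm _ k).1, (hcomm _ _).2]
    simp
  have i12 : Integrable (fun x =>
      (S.formIntegrand φ (fun y => ((θ y ^ 2 : ℝ) : ℂ) * φ y) x).re
        + (S.formIntegrand φ (fun y => ((S.Φ y * θ y ^ 2 : ℝ) : ℂ) * φ y) x).im) :=
    i1.re.add i2.im
  refine (integral_mono (integrable_coerciveIntegrand γ₁ γ₂ hφ hθ) (i12.sub i3)
    fun x => coerciveIntegrand_le hd hbound hφ hθ x).trans (le_of_eq ?_)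
  have hre := integral_re i1
  have him := integral_im i2
  simp only [RCLike.re_to_complex, RCLike.im_to_complex] at hre him
  refine (integral_sub i12 i3).trans ?_
  rw [e3, sub_zero]
  refine (integral_add i1.re i2.im).trans ?_
  exact congrArg₂ (· + ·) hre him

end EMSystem

/-! ### L² mass on sets of small volume, by averaging translations -/

section SmallVolume

variable {E F : Type*} [NormedAddCommGroup E] [NormedSpace ℝ E]
  [NormedAddCommGroup F] [NormedSpace ℝ F] [CompleteSpace F]

/-- The fundamental theorem of calculus along the segment, then the comparison of L¹ and L² norms on
the probability space [0, 1]. -/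
theorem enorm_sub_sq_le_lintegral_fderiv {f : E → F} (hf : ContDiff ℝ 1 f) (x h : E) :
    ‖f (x + h) - f x‖ₑ ^ 2
      ≤ ‖h‖ₑ ^ 2 * ∫⁻ t in Icc (0 : ℝ) 1, ‖fderiv ℝ f (x + t • h)‖ₑ ^ 2 := by
  have hd : ∀ t : ℝ, HasDerivAt (fun t : ℝ => f (x + t • h)) (fderiv ℝ f (x + t • h) h) t := by
    intro t
    have h1 : HasDerivAt (fun t : ℝ => x + t • h) h t := by
      simpa using ((hasDerivAt_id t).smul_const h).const_add x
    exact ((hf.differentiable (by simp)) _).hasFDerivAt.comp_hasDerivAt t h1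
  have hc : Continuous (fun t : ℝ => fderiv ℝ f (x + t • h) h) :=
    ((hf.continuous_fderiv (by simp)).comp (by fun_prop)).clm_apply continuous_const
  have hi := intervalIntegral.integral_eq_sub_of_hasDerivAt (a := 0) (b := 1)
    (fun t _ => hd t) (hc.intervalIntegrable _ _)
  simp only [one_smul, zero_smul, add_zero] at hi
  rw [intervalIntegral.integral_of_le zero_le_one, ← integral_Icc_eq_integral_Ioc] at hi
  have : IsProbabilityMeasure (volume.restrict (Icc (0 : ℝ) 1)) := ⟨by simp⟩
  have h1 : ‖f (x + h) - f x‖ₑ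
      ≤ eLpNorm (fun t : ℝ => fderiv ℝ f (x + t • h) h) 2 (volume.restrict (Icc (0 : ℝ) 1)) := by
    rw [← hi]
    refine (enorm_integral_le_lintegral_enorm _).trans ?_
    rw [← eLpNorm_one_eq_lintegral_enorm]
    exact eLpNorm_le_eLpNorm_of_exponent_le (by norm_num) hc.aestronglyMeasurable
  have h2 : eLpNorm (fun t : ℝ => fderiv ℝ f (x + t • h) h) 2
      (volume.restrict (Icc (0 : ℝ) 1)) ^ 2
      = ∫⁻ t in Icc (0 : ℝ) 1, ‖fderiv ℝ f (x + t • h) h‖ₑ ^ 2 := by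
    have := eLpNorm_nnreal_pow_eq_lintegral (p := 2)
      (f := fun t : ℝ => fderiv ℝ f (x + t • h) h) (μ := volume.restrict (Icc (0 : ℝ) 1))
      (by norm_num)
    simpa using this
  calc ‖f (x + h) - f x‖ₑ ^ 2 ≤ _ := pow_le_pow_left' h1 2
    _ = ∫⁻ t in Icc (0 : ℝ) 1, ‖fderiv ℝ f (x + t • h) h‖ₑ ^ 2 := h2
    _ ≤ ∫⁻ t in Icc (0 : ℝ) 1, ‖h‖ₑ ^ 2 * ‖fderiv ℝ f (x + t • h)‖ₑ ^ 2 := by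
        refine lintegral_mono fun t => ?_
        rw [mul_comm, ← mul_pow]
        exact pow_le_pow_left' (ContinuousLinearMap.le_opENorm _ _) 2
    _ = _ := lintegral_const_mul' _ _ (by finiteness)

variable [MeasurableSpace E] [BorelSpace E] [FiniteDimensional ℝ E]
  (μ : Measure E) [μ.IsAddHaarMeasure]

/-- After Fubini, each translate A + th stays in the ball of radius R + 1, and the measure is
translation invariant. -/
theorem lintegral_translation_sub_sq_le {f : E → F} (hf : ContDiff ℝ 1 f) {R : ℝ} {A : Set E}
    (hA : A ⊆ Metric.ball 0 R) {h : E} (hh : ‖h‖ ≤ 1) :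
    ∫⁻ x in A, ‖f (x + h) - f x‖ₑ ^ 2 ∂μ
      ≤ ‖h‖ₑ ^ 2 * ∫⁻ x in Metric.ball 0 (R + 1), ‖fderiv ℝ f x‖ₑ ^ 2 ∂μ := by
  have hc : Continuous (fderiv ℝ f) := hf.continuous_fderiv (by simp)
  refine (lintegral_mono fun x => enorm_sub_sq_le_lintegral_fderiv hf x h).trans ?_
  rw [lintegral_const_mul' _ _ (by finiteness)]
  refine mul_le_mul' le_rfl ?_
  have hm : Measurable (fun p : E × ℝ => ‖fderiv ℝ f (p.1 + p.2 • h)‖ₑ ^ 2) :=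
    (hc.comp (by fun_prop)).enorm.measurable.pow_const 2
  rw [lintegral_lintegral_swap hm.aemeasurable]
  have key : ∀ t ∈ Icc (0 : ℝ) 1, ∫⁻ x in A, ‖fderiv ℝ f (x + t • h)‖ₑ ^ 2 ∂μ
      ≤ ∫⁻ x in Metric.ball 0 (R + 1), ‖fderiv ℝ f x‖ₑ ^ 2 ∂μ := by
    intro t ht
    calc ∫⁻ x in A, ‖fderiv ℝ f (x + t • h)‖ₑ ^ 2 ∂μ
        ≤ ∫⁻ x in A, (Metric.ball (0 : E) (R + 1)).indicator
            (fun y => ‖fderiv ℝ f y‖ₑ ^ 2) (x + t • h) ∂μ := by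
          refine setLIntegral_mono ?_ fun x hx => ?_
          · exact ((hc.enorm.measurable.pow_const 2).indicator Metric.isOpen_ball.measurableSet).comp
              (measurable_id.add_const _)
          · have hx' : x + t • h ∈ Metric.ball (0 : E) (R + 1) := by
              have h1 := hA hx
              rw [mem_ball_zero_iff] at h1 ⊢
              have h2 : ‖t • h‖ ≤ 1 := by
                rw [norm_smul, Real.norm_of_nonneg ht.1]
                exact mul_le_one₀ ht.2 (norm_nonneg _) hh
              linarith [norm_add_le x (t • h)]
            rw [indicator_of_mem hx']
      _ ≤ ∫⁻ x, (Metric.ball (0 : E) (R + 1)).indicator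
            (fun y => ‖fderiv ℝ f y‖ₑ ^ 2) (x + t • h) ∂μ := setLIntegral_le_lintegral _ _
      _ = _ := by
          rw [lintegral_add_right_eq_self (μ := μ) (fun y => (Metric.ball (0 : E) (R + 1)).indicator
            (fun y => ‖fderiv ℝ f y‖ₑ ^ 2) y), lintegral_indicator Metric.isOpen_ball.measurableSet]
  refine (setLIntegral_mono measurable_const key).trans ?_
  simp

/-- The `L²` norm over a set of small volume is controlled by the gradient and a small multiple
of the full `L²` norm. -/
theorem lintegral_sq_le_of_subset_ball {f : E → F} (hf : ContDiff ℝ 1 f) {R : ℝ} {A : Set E}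
    (hA : A ⊆ Metric.ball 0 R) {ρ : ℝ} (hρ : 0 < ρ) (hρ1 : ρ ≤ 1) :
    ∫⁻ x in A, ‖f x‖ₑ ^ 2 ∂μ
      ≤ 2 * ENNReal.ofReal (ρ ^ 2) * (∫⁻ x in Metric.ball 0 (R + 1), ‖fderiv ℝ f x‖ₑ ^ 2 ∂μ)
        + 2 * (μ (Metric.ball 0 ρ))⁻¹ * μ A * ∫⁻ x, ‖f x‖ₑ ^ 2 ∂μ := by
  set D := ∫⁻ x in Metric.ball 0 (R + 1), ‖fderiv ℝ f x‖ₑ ^ 2 ∂μ with hD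
  set T := ∫⁻ x, ‖f x‖ₑ ^ 2 ∂μ with hT
  set B := Metric.ball (0 : E) ρ with hB
  have hfc := hf.continuous
  have hB0 : μ B ≠ 0 := (Metric.measure_ball_pos μ 0 hρ).ne'
  have hBt : μ B ≠ ⊤ := measure_ball_lt_top.ne
  -- For each shift h, f(x) is compared with f(x + h). Averaging over h in B then replaces the last
  -- integral by a full L² norm with the small factor μ(A)/μ(B).
  have h1 : ∀ h ∈ B, ∫⁻ x in A, ‖f x‖ₑ ^ 2 ∂μ
      ≤ 2 * (ENNReal.ofReal (ρ ^ 2) * D) + 2 * ∫⁻ x in A, ‖f (x + h)‖ₑ ^ 2 ∂μ := by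
    intro h hh
    have hh' : ‖h‖ < ρ := by simpa [hB] using hh
    have hm : Measurable (fun x => ‖f (x + h) - f x‖ₑ ^ 2) :=
      (((hfc.comp (continuous_id.add continuous_const)).sub hfc).enorm.measurable).pow_const 2
    calc ∫⁻ x in A, ‖f x‖ₑ ^ 2 ∂μ
        ≤ ∫⁻ x in A, (2 * ‖f (x + h) - f x‖ₑ ^ 2 + 2 * ‖f (x + h)‖ₑ ^ 2) ∂μ := by
          refine lintegral_mono fun x => ?_
          have e : ‖f x‖ₑ ≤ ‖f (x + h) - f x‖ₑ + ‖f (x + h)‖ₑ := by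
            have := enorm_sub_le (a := f (x + h)) (b := f (x + h) - f x)
            rw [sub_sub_cancel, add_comm] at this
            exact this
          refine (pow_le_pow_left' e 2).trans ?_
          rw [← mul_add]
          have := ENNReal.rpow_add_le_mul_rpow_add_rpow ‖f (x + h) - f x‖ₑ ‖f (x + h)‖ₑ
            (p := 2) (by norm_num)
          norm_num at this
          exact this
      _ = 2 * ∫⁻ x in A, ‖f (x + h) - f x‖ₑ ^ 2 ∂μ + 2 * ∫⁻ x in A, ‖f (x + h)‖ₑ ^ 2 ∂μ := by
          rw [lintegral_add_left (hm.const_mul 2), lintegral_const_mul' _ _ (by simp),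
            lintegral_const_mul' _ _ (by simp)]
      _ ≤ _ := by
          gcongr
          refine (lintegral_translation_sub_sq_le μ hf hA (hh'.le.trans hρ1)).trans ?_
          gcongr
          rw [ENNReal.ofReal_pow hρ.le, ← ofReal_norm]
          gcongr
  -- Integrating in h before x bounds the inner integral by T for every x, so only the volume of A
  -- remains.
  have h2 : ∫⁻ h in B, ∫⁻ x in A, ‖f (x + h)‖ₑ ^ 2 ∂μ ∂μ ≤ μ A * T := by
    have hm : Measurable (fun p : E × E => ‖f (p.2 + p.1)‖ₑ ^ 2) :=
      (hfc.comp (continuous_snd.add continuous_fst)).enorm.measurable.pow_const 2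
    rw [lintegral_lintegral_swap hm.aemeasurable]
    calc ∫⁻ x in A, ∫⁻ h in B, ‖f (x + h)‖ₑ ^ 2 ∂μ ∂μ ≤ ∫⁻ x in A, T ∂μ := by
          refine lintegral_mono fun x => (setLIntegral_le_lintegral _ _).trans ?_
          rw [lintegral_add_left_eq_self (μ := μ) (fun y => ‖f y‖ₑ ^ 2) x]
      _ = μ A * T := by rw [setLIntegral_const, mul_comm]
  have h3 : (∫⁻ x in A, ‖f x‖ₑ ^ 2 ∂μ) * μ B
      ≤ 2 * (ENNReal.ofReal (ρ ^ 2) * D) * μ B + 2 * (μ A * T) := by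
    rw [← setLIntegral_const]
    refine (setLIntegral_mono' Metric.isOpen_ball.measurableSet h1).trans ?_
    rw [lintegral_add_left measurable_const, setLIntegral_const,
      lintegral_const_mul' _ _ (by simp)]
    gcongr
  calc ∫⁻ x in A, ‖f x‖ₑ ^ 2 ∂μ = (∫⁻ x in A, ‖f x‖ₑ ^ 2 ∂μ) * μ B * (μ B)⁻¹ := by
        rw [mul_assoc, ENNReal.mul_inv_cancel hB0 hBt, mul_one]
    _ ≤ (2 * (ENNReal.ofReal (ρ ^ 2) * D) * μ B + 2 * (μ A * T)) * (μ B)⁻¹ := by gcongr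
    _ = 2 * (ENNReal.ofReal (ρ ^ 2) * D) * (μ B * (μ B)⁻¹) + 2 * (μ A * T) * (μ B)⁻¹ := by ring
    _ = _ := by rw [ENNReal.mul_inv_cancel hB0 hBt]; ring

end SmallVolume

/-! ### The Agmon distance is locally Lipschitz -/

/-- A smooth monotone function vanishing before `1 - η` and equal to `1` at `1`. -/
def lateTransition (η t : ℝ) : ℝ := Real.smoothTransition ((t - (1 - η)) / η)

theorem contDiff_lateTransition (η : ℝ) {n : ℕ∞} : ContDiff ℝ n (lateTransition η) :=
  Real.smoothTransition.contDiff.comp ((contDiff_id.sub contDiff_const).div_const _)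

theorem lateTransition_of_le {η t : ℝ} (hη : 0 < η) (ht : t ≤ 1 - η) : lateTransition η t = 0 :=
  Real.smoothTransition.zero_of_nonpos (div_nonpos_of_nonpos_of_nonneg (by linarith) hη.le)

theorem lateTransition_one {η : ℝ} (hη : 0 < η) : lateTransition η 1 = 1 :=
  Real.smoothTransition.one_of_one_le (by rw [le_div_iff₀ hη]; linarith)

theorem monotone_lateTransition {η : ℝ} (hη : 0 < η) : Monotone (lateTransition η) :=
  fun a b hab => Real.smoothTransition.monotone (by gcongr)

namespace EMSystem

variable {d : ℕ} {S : EMSystem d} {γ₁ γ₂ : ℝ} {lam : ℂ}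

/-- The length of a curve for the Agmon metric. -/
def agmonLength (S : EMSystem d) (γ₁ γ₂ : ℝ) (lam : ℂ) (c : ℝ → Eucl d) : ℝ≥0∞ :=
  ∫⁻ t in Icc (0 : ℝ) 1,
    ENNReal.ofReal (√(S.agmonWeight γ₁ γ₂ lam (c t)) * ‖derivWithin c (Icc 0 1) t‖)

/-- A 𝒞¹ curve followed by a segment need not be 𝒞¹. Instead the multiple θ(t)(x - y) is added to
the curve, with θ rising from 0 to 1 at the very end of the time interval. The extra length is at
most s|x - y|∫θ' plus what the original velocity contributes on that short interval. -/
theorem exists_curve_moving_endpoint {z : Eucl d} {r s : ℝ} (hball : Metric.ball z r ⊆ S.Ω)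
    (hs : 0 ≤ s) (hw : ∀ x ∈ Metric.ball z r, √(S.agmonWeight γ₁ γ₂ lam x) ≤ s)
    {p x y : Eucl d} (hx : x ∈ Metric.ball z r) (hy : y ∈ Metric.ball z r)
    {c : ℝ → Eucl d} (hc : ContDiffOn ℝ 1 c (Icc 0 1)) (hcΩ : MapsTo c (Icc 0 1) S.Ω)
    (hc0 : c 0 = p) (hc1 : c 1 = y) {τ : ℝ} (hτ : 0 < τ) :
    ∃ c' : ℝ → Eucl d, ContDiffOn ℝ 1 c' (Icc 0 1) ∧ MapsTo c' (Icc 0 1) S.Ω ∧ c' 0 = p ∧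
      c' 1 = x ∧ S.agmonLength γ₁ γ₂ lam c'
        ≤ S.agmonLength γ₁ γ₂ lam c + ENNReal.ofReal τ + ENNReal.ofReal (s * ‖x - y‖) := by
  have huniq : UniqueDiffOn ℝ (Icc (0 : ℝ) 1) := uniqueDiffOn_Icc zero_lt_one
  obtain ⟨M, hM⟩ := isCompact_Icc.exists_bound_of_continuousOn
    (hc.continuousOn_derivWithin huniq (by simp))
  have hM0 : 0 ≤ M := (norm_nonneg _).trans (hM 0 (by simp))
  rw [mem_ball_iff_norm] at hx hy
  set r₀ := max ‖x - z‖ ‖y - z‖ with hr₀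
  have hr₀r : r₀ < r := max_lt hx hy
  have hcont := Metric.continuousWithinAt_iff.1 (hc.continuousOn 1 (by simp)) (r - r₀)
    (by linarith)
  obtain ⟨η₁, hη₁, hcη⟩ := hcont
  -- During the last time η the curve c is within r - r₀ of y, and its velocity, at most M,
  -- contributes at most sMη ≤ τ.
  obtain ⟨η, hη, hη1, hηη, hητ⟩ : ∃ η > 0, η ≤ 1 ∧ η < η₁ ∧ s * M * η ≤ τ := by
    refine ⟨min 1 (min (η₁ / 2) (τ / (s * M + 1))), by positivity, by simp, ?_, ?_⟩
    · have : min 1 (min (η₁ / 2) (τ / (s * M + 1))) ≤ η₁ / 2 := by simp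
      linarith
    · have h1 : min 1 (min (η₁ / 2) (τ / (s * M + 1))) ≤ τ / (s * M + 1) := by simp
      calc _ ≤ s * M * (τ / (s * M + 1)) := by gcongr
        _ = τ * (s * M / (s * M + 1)) := by ring
        _ ≤ τ * 1 := by
            gcongr
            rw [div_le_one (by positivity)]
            linarith
        _ = τ := mul_one τ
  set θ := lateTransition η with hθ
  have hθs : ContDiff ℝ 1 θ := contDiff_lateTransition (n := 1) η
  have hθ0 : ∀ t, 0 ≤ θ t := fun t => Real.smoothTransition.nonneg _
  have hθ1 : ∀ t, θ t ≤ 1 := fun t => Real.smoothTransition.le_one _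
  have hθd : ∀ t, 0 ≤ deriv θ t := fun t => (monotone_lateTransition hη).deriv_nonneg
  set c' : ℝ → Eucl d := fun t => c t + θ t • (x - y) with hc'
  have hlate : ∀ t ∈ Icc (0 : ℝ) 1, 1 - η ≤ t → c' t ∈ Metric.ball z r := by
    intro t ht ht'
    have h1 : ‖c t - y‖ < r - r₀ := by
      have := hcη ht (by rw [Real.dist_eq, abs_sub_comm, abs_of_nonneg] <;> linarith [ht.2])
      rwa [hc1, dist_eq_norm] at this
    -- The second summand is a convex combination of x - z and y - z, of norm at most r₀, so the new
    -- curve ends inside the ball, where the weight is controlled.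
    have h2 : c' t - z = (c t - y) + (θ t • (x - z) + (1 - θ t) • (y - z)) := by
      simp only [hc']; module
    have h3 : ‖θ t • (x - z) + (1 - θ t) • (y - z)‖ ≤ r₀ := by
      refine (norm_add_le _ _).trans ?_
      rw [norm_smul, norm_smul, Real.norm_of_nonneg (hθ0 t),
        Real.norm_of_nonneg (by linarith [hθ1 t])]
      calc _ ≤ θ t * r₀ + (1 - θ t) * r₀ := by
            have := hθ0 t
            have : 0 ≤ 1 - θ t := by linarith [hθ1 t]
            gcongr
            · exact le_max_left _ _
            · exact le_max_right _ _
        _ = r₀ := by ring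
    rw [mem_ball_iff_norm, h2]
    linarith [norm_add_le (c t - y) (θ t • (x - z) + (1 - θ t) • (y - z))]
  have hearly : ∀ t ≤ 1 - η, c' t = c t := by
    intro t ht
    simp [hc', hθ, lateTransition_of_le hη ht]
  have hderiv : ∀ t ∈ Icc (0 : ℝ) 1, derivWithin c' (Icc 0 1) t
      = derivWithin c (Icc 0 1) t + deriv θ t • (x - y) := by
    intro t ht
    have h1 : HasDerivWithinAt c (derivWithin c (Icc 0 1) t) (Icc 0 1) t :=
      (hc.differentiableOn (by simp) t ht).hasDerivWithinAt
    have h2 : HasDerivWithinAt θ (deriv θ t) (Icc 0 1) t :=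
      ((hθs.differentiable (by simp)) t).hasDerivAt.hasDerivWithinAt
    exact (h1.add (h2.smul_const (x - y))).derivWithin (huniq t ht)
  have hθd0 : ∀ t < 1 - η, deriv θ t = 0 := by
    intro t ht
    have : θ =ᶠ[𝓝 t] fun _ => 0 := by
      filter_upwards [Iio_mem_nhds ht] with u hu
      exact lateTransition_of_le hη (le_of_lt hu)
    rw [this.deriv_eq, deriv_const]
  refine ⟨c', hc.add (hθs.contDiffOn.smul contDiffOn_const), fun t ht => ?_, ?_, ?_, ?_⟩
  · rcases le_or_gt (1 - η) t with h | h
    · exact hball (hlate t ht h)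
    · rw [hearly t h.le]; exact hcΩ ht
  · rw [hearly 0 (by linarith), hc0]
  · simp [hc', hθ, lateTransition_one hη, hc1]
  have hpt : ∀ t ∈ Icc (0 : ℝ) 1,
      ENNReal.ofReal (√(S.agmonWeight γ₁ γ₂ lam (c' t)) * ‖derivWithin c' (Icc 0 1) t‖)
      ≤ ENNReal.ofReal (√(S.agmonWeight γ₁ γ₂ lam (c t)) * ‖derivWithin c (Icc 0 1) t‖)
        + (Icc (1 - η) 1).indicator (fun _ => ENNReal.ofReal (s * M)) t
        + ENNReal.ofReal (deriv θ t * (s * ‖x - y‖)) := by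
    intro t ht
    rcases le_or_gt (1 - η) t with h | h
    · rw [indicator_of_mem (show t ∈ Icc (1 - η) 1 from ⟨h, ht.2⟩), add_assoc]
      refine le_add_of_nonneg_of_le (zero_le) ?_
      have hp : 0 ≤ deriv θ t * (s * ‖x - y‖) := mul_nonneg (hθd t) (by positivity)
      rw [← ENNReal.ofReal_add (by positivity) hp]
      refine ENNReal.ofReal_le_ofReal ?_
      calc _ ≤ s * (M + deriv θ t * ‖x - y‖) := by
            refine mul_le_mul (hw _ (hlate t ht h)) ?_ (norm_nonneg _) hs
            rw [hderiv t ht]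
            refine (norm_add_le _ _).trans (add_le_add (hM t ht) ?_)
            rw [norm_smul, Real.norm_of_nonneg (hθd t)]
        _ = _ := by ring
    · rw [hearly t h.le, hderiv t ht, hθd0 t h, zero_smul, add_zero, add_assoc]
      exact le_add_of_nonneg_right (zero_le)
  have hdc : Continuous (fun t => deriv θ t * (s * ‖x - y‖)) :=
    (hθs.continuous_deriv (by simp)).mul continuous_const
  calc S.agmonLength γ₁ γ₂ lam c' ≤ _ := setLIntegral_mono' measurableSet_Icc hpt
    _ = S.agmonLength γ₁ γ₂ lam c
        + (∫⁻ t in Icc (0 : ℝ) 1, (Icc (1 - η) 1).indicator (fun _ => ENNReal.ofReal (s * M)) t)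
        + ∫⁻ t in Icc (0 : ℝ) 1, ENNReal.ofReal (deriv θ t * (s * ‖x - y‖)) := by
        rw [lintegral_add_right _ hdc.measurable.ennreal_ofReal,
          lintegral_add_right _ (measurable_const.indicator measurableSet_Icc), agmonLength]
    _ ≤ _ := by
        gcongr
        · refine (setLIntegral_le_lintegral _ _).trans ?_
          rw [lintegral_indicator measurableSet_Icc, setLIntegral_const, Real.volume_Icc,
            ← ENNReal.ofReal_mul (by positivity)]
          refine ENNReal.ofReal_le_ofReal ?_
          simpa using hητ
        · rw [← ofReal_integral_eq_lintegral_ofReal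
            (hdc.integrableOn_Icc) (Eventually.of_forall fun t =>
              mul_nonneg (hθd t) (by positivity)), integral_Icc_eq_integral_Ioc,
            ← intervalIntegral.integral_of_le zero_le_one, intervalIntegral.integral_mul_const,
            intervalIntegral.integral_deriv_eq_sub
              (fun t _ => (hθs.differentiable (by simp)) t)
              ((hθs.continuous_deriv (by simp)).intervalIntegrable _ _), hθ,
            lateTransition_one hη, lateTransition_of_le hη (by linarith : (0 : ℝ) ≤ 1 - η)]
          simp

theorem agmonEDist_le_add {z : Eucl d} {r s : ℝ} (hball : Metric.ball z r ⊆ S.Ω)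
    (hs : 0 ≤ s) (hw : ∀ x ∈ Metric.ball z r, √(S.agmonWeight γ₁ γ₂ lam x) ≤ s)
    (p : Eucl d) {x y : Eucl d} (hx : x ∈ Metric.ball z r) (hy : y ∈ Metric.ball z r) :
    S.agmonEDist γ₁ γ₂ lam p x
      ≤ S.agmonEDist γ₁ γ₂ lam p y + ENNReal.ofReal (s * ‖x - y‖) := by
  conv_rhs => rw [agmonEDist]
  simp only [ENNReal.iInf_add]
  refine le_iInf fun c => le_iInf fun hc => le_iInf fun hcΩ => le_iInf fun hc0 =>
    le_iInf fun hc1 => ?_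
  refine ENNReal.le_of_forall_pos_le_add fun τ hτ _ => ?_
  obtain ⟨c', h1, h2, h3, h4, h5⟩ := exists_curve_moving_endpoint hball hs hw hx hy hc hcΩ hc0 hc1
    (τ := τ) (by exact_mod_cast hτ)
  rw [ENNReal.ofReal_coe_nnreal, add_right_comm] at h5
  refine le_trans ?_ h5
  exact iInf_le_of_le c' (iInf_le_of_le h1 (iInf_le_of_le h2 (iInf_le_of_le h3
    (iInf_le_of_le h4 le_rfl))))

theorem IsBasePoint.eq_of_mem_ball {b : Eucl d → Eucl d} (hb : S.IsBasePoint b) {z : Eucl d}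
    {r : ℝ} (hball : Metric.ball z r ⊆ S.Ω) {x y : Eucl d} (hx : x ∈ Metric.ball z r)
    (hy : y ∈ Metric.ball z r) : b x = b y :=
  ((hb x (hball hx)).2 y ((convex_ball z r).isPreconnected.subset_connectedComponentIn hx hball
    hy)).symm

theorem agmonDist_le_add {b : Eucl d → Eucl d} (hb : S.IsBasePoint b) {z : Eucl d} {r s : ℝ}
    (hball : Metric.ball z r ⊆ S.Ω) (hs : 0 ≤ s)
    (hw : ∀ x ∈ Metric.ball z r, √(S.agmonWeight γ₁ γ₂ lam x) ≤ s) {x y : Eucl d}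
    (hx : x ∈ Metric.ball z r) (hy : y ∈ Metric.ball z r) :
    S.agmonDist γ₁ γ₂ lam b x ≤ S.agmonDist γ₁ γ₂ lam b y + s * ‖x - y‖ := by
  have h := agmonEDist_le_add hball hs hw (b y) hx hy
  have h' := agmonEDist_le_add hball hs hw (b y) hy hx
  rw [agmonDist, agmonDist, hb.eq_of_mem_ball hball hx hy]
  -- Distances from the base point are infinite at both points or at neither; when infinite,
  -- `toReal` gives both the value 0.
  by_cases hy' : S.agmonEDist γ₁ γ₂ lam (b y) y = ⊤
  · have hx' : S.agmonEDist γ₁ γ₂ lam (b y) x = ⊤ := by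
      by_contra hne
      rw [hy', top_le_iff] at h'
      exact ENNReal.add_ne_top.2 ⟨hne, ENNReal.ofReal_ne_top⟩ h'
    rw [hx', hy']
    simp only [ENNReal.toReal_top, zero_add]
    positivity
  · have := ENNReal.toReal_mono (ENNReal.add_ne_top.2 ⟨hy', ENNReal.ofReal_ne_top⟩) h
    rwa [ENNReal.toReal_add hy' ENNReal.ofReal_ne_top, ENNReal.toReal_ofReal (by positivity)]
      at this

end EMSystem

/-! ### Smoothing a locally Lipschitz function with gradient control -/

/-- A function whose local Lipschitz constants are controlled by a continuous function `g` can be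
approximated, near a compact set, by smooth functions with gradient almost bounded by `g`. -/
theorem exists_contDiff_approx_of_local_lipschitz {d : ℕ} {Ω : Set (Eucl d)} (hΩ : IsOpen Ω)
    {W g : Eucl d → ℝ} (hg : ContinuousOn g Ω) (hg0 : ∀ x, 0 ≤ g x)
    (hW : ∀ (z : Eucl d) (r s : ℝ), Metric.ball z r ⊆ Ω → 0 ≤ s →
      (∀ x ∈ Metric.ball z r, g x ≤ s) →
      ∀ x ∈ Metric.ball z r, ∀ y ∈ Metric.ball z r, |W x - W y| ≤ s * ‖x - y‖)
    {K : Set (Eucl d)} (hK : IsCompact K) (hKΩ : K ⊆ Ω) {η : ℝ} (hη : 0 < η) :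
    ∃ W' : Eucl d → ℝ, ContDiff ℝ ∞ W' ∧
      ∀ x ∈ K, |W' x - W x| ≤ η ∧ ‖fderiv ℝ W' x‖ ≤ g x + η := by
  obtain ⟨r₀, hr₀, hr₀Ω⟩ := hK.exists_cthickening_subset_open hΩ hKΩ
  set K₂ := Metric.cthickening r₀ K with hK₂
  have hK₂c : IsCompact K₂ := hK.cthickening
  have hKK₂ : K ⊆ K₂ := Metric.self_subset_cthickening _
  obtain ⟨δ, hδ, hgδ⟩ := Metric.uniformContinuousOn_iff.1
    (hK₂c.uniformContinuousOn_of_continuous (hg.mono hr₀Ω)) η hη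
  obtain ⟨G, hG⟩ := hK.exists_bound_of_continuousOn (hg.mono hKΩ)
  -- The radius keeps balls around K inside K₂, makes g vary by less than η on them, and makes a
  -- function with Lipschitz constant |G| + η vary by at most η.
  obtain ⟨r, hr, hrr, hrδ, hrG⟩ : ∃ r > 0, r ≤ r₀ ∧ r ≤ δ ∧ (|G| + η) * r ≤ η := by
    refine ⟨min r₀ (min δ (η / (|G| + η))), by positivity, by simp, by simp, ?_⟩
    have h1 : min r₀ (min δ (η / (|G| + η))) ≤ η / (|G| + η) := by simp
    rw [le_div_iff₀ (by positivity)] at h1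
    linarith
  have hbK : ∀ x ∈ K, Metric.ball x r ⊆ K₂ := fun x hx y hy =>
    Metric.mem_cthickening_of_dist_le _ x _ _ hx ((Metric.mem_ball.1 hy).le.trans hrr)
  have hlip : ∀ x ∈ K, ∀ y ∈ Metric.ball x r, ∀ y' ∈ Metric.ball x r,
      |W y - W y'| ≤ (g x + η) * ‖y - y'‖ := by
    intro x hx
    refine hW x r (g x + η) ((hbK x hx).trans hr₀Ω) (add_nonneg (hg0 x) hη.le) fun y hy => ?_
    have := hgδ y (hbK x hx hy) x (hKK₂ hx) ((Metric.mem_ball.1 hy).trans_le hrδ)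
    rw [Real.dist_eq] at this
    linarith [(abs_lt.1 this).2]
  have hWc : ContinuousOn W Ω := by
    intro x hx
    obtain ⟨r', hr', hr'Ω⟩ := Metric.isOpen_iff.1 hΩ x hx
    have hgx := (hg x hx).eventually (gt_mem_nhds (lt_add_one (g x)))
    rw [eventually_iff, hΩ.nhdsWithin_eq hx] at hgx
    obtain ⟨r'', hr'', hgr⟩ := Metric.mem_nhds_iff.1 hgx
    have hb1 : Metric.ball x (min r' r'') ⊆ Metric.ball x r' := Metric.ball_subset_ball (by simp)
    have hb2 : Metric.ball x (min r' r'') ⊆ Metric.ball x r'' := Metric.ball_subset_ball (by simp)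
    have h := hW x (min r' r'') (g x + 1) (hb1.trans hr'Ω) (by linarith [hg0 x])
      fun y hy => (show g y < g x + 1 from hgr (hb2 hy)).le
    refine ContinuousAt.continuousWithinAt ?_
    have hx' : x ∈ Metric.ball x (min r' r'') := Metric.mem_ball_self (by positivity)
    refine continuousAt_of_locally_lipschitz (r := min r' r'') (by positivity) (g x + 1) ?_
    intro y hy
    rw [Real.dist_eq, dist_eq_norm]
    exact h y hy x hx'
  -- Truncation to K₂ makes the convolution globally defined and smooth; near K the mollifier does
  -- not notice it.
  set W₀ : Eucl d → ℝ := K₂.indicator W with hW₀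
  have hint : Integrable W₀ :=
    ((hWc.mono hr₀Ω).integrableOn_compact hK₂c).integrable_indicator hK₂c.measurableSet
  -- The outer radius r/2 lets both x and a nearby y be shifted by t without leaving the ball of
  -- radius r around x, where W has Lipschitz constant g x + η.
  let ρ : ContDiffBump (0 : Eucl d) := ⟨r / 4, r / 2, by positivity, by linarith⟩
  have hρ : ρ.rOut = r / 2 := rfl
  let W' : Eucl d → ℝ :=
    convolution (ρ.normed volume) W₀ (ContinuousLinearMap.lsmul ℝ ℝ) volume
  have hconv : ConvolutionExists (ρ.normed volume) W₀ (ContinuousLinearMap.lsmul ℝ ℝ) volume :=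
    ρ.hasCompactSupport_normed.convolutionExists_left _ ρ.continuous_normed hint.locallyIntegrable
  refine ⟨W', ρ.hasCompactSupport_normed.contDiff_convolution_left _ ρ.contDiff_normed
    hint.locallyIntegrable, fun x hx => ⟨?_, ?_⟩⟩
  · have hWx : W₀ x = W x := indicator_of_mem (hKK₂ hx) W
    rw [← hWx, ← Real.dist_eq]
    refine ρ.dist_normed_convolution_le hint.1 fun y hy => ?_
    have hy' : y ∈ Metric.ball x r := Metric.ball_subset_ball (by rw [hρ]; linarith) hy
    have hWy : W₀ y = W y := indicator_of_mem (hbK x hx hy') W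
    rw [hWx, hWy, Real.dist_eq]
    refine (hlip x hx y hy' x (Metric.mem_ball_self hr)).trans (le_trans ?_ hrG)
    have h1 : ‖y - x‖ ≤ r := by rw [← dist_eq_norm]; exact (Metric.mem_ball.1 hy').le
    have h2 : g x ≤ |G| := by
      have := hG x hx
      rw [Real.norm_of_nonneg (hg0 x)] at this
      exact this.trans (le_abs_self G)
    have := hg0 x
    gcongr
  · have hC : 0 ≤ g x + η := add_nonneg (hg0 x) hη.le
    refine norm_fderiv_le_of_lip' ℝ hC ?_
    filter_upwards [Metric.ball_mem_nhds x (half_pos hr)] with y hy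
    have e : W' y - W' x = ∫ t, ρ.normed volume t * (W₀ (y - t) - W₀ (x - t)) := by
      have := integral_sub (hconv y) (hconv x)
      simp only [ContinuousLinearMap.lsmul_apply, smul_eq_mul, ← mul_sub] at this
      exact this.symm
    rw [e]
    calc ‖∫ t, ρ.normed volume t * (W₀ (y - t) - W₀ (x - t))‖
        ≤ ∫ t, ρ.normed volume t * ((g x + η) * ‖y - x‖) := by
          refine norm_integral_le_of_norm_le (ρ.integrable_normed.mul_const _)
            (Eventually.of_forall fun t => ?_)
          rw [norm_mul, Real.norm_of_nonneg (ρ.nonneg_normed t)]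
          by_cases ht : t ∈ Metric.ball (0 : Eucl d) (r / 2)
          · refine mul_le_mul_of_nonneg_left ?_ (ρ.nonneg_normed t)
            have ht' : ‖t‖ < r / 2 := by simpa using ht
            have hyx : ‖y - x‖ < r / 2 := by rwa [← dist_eq_norm]
            have h1 : y - t ∈ Metric.ball x r := by
              rw [mem_ball_iff_norm, sub_right_comm]
              linarith [norm_sub_le (y - x) t]
            have h2 : x - t ∈ Metric.ball x r := by
              rw [mem_ball_iff_norm, sub_right_comm, sub_self, zero_sub, norm_neg]
              linarith
            have h3 := hlip x hx _ h1 _ h2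
            rw [hW₀, indicator_of_mem (hbK x hx h1), indicator_of_mem (hbK x hx h2)]
            simpa using h3
          · have : ρ.normed volume t = 0 := by
              by_contra hne
              have : t ∈ Function.support (ρ.normed volume) := hne
              rw [ρ.support_normed_eq] at this
              exact ht this
            simp [this]
      _ = (g x + η) * ‖y - x‖ := by
          rw [integral_mul_const, ρ.integral_normed, one_mul]

/-! ### Bounds on the coefficients in bounded parts of Ω -/

/-- A bounded part of Ω is not compact; the continuous extension to the closure supplies bounds
valid up to the boundary. -/
theorem ContDiffUpToClosure.exists_bound {d k j : ℕ} {F : Type*} [NormedAddCommGroup F]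
    [NormedSpace ℝ F] {f : Eucl d → F} {Ω : Set (Eucl d)} (h : ContDiffUpToClosure k f Ω)
    (hj : j ≤ k) (R : ℝ) :
    ∃ C, ∀ x ∈ Ω, ‖x‖ ≤ R → ‖iteratedFDeriv ℝ j f x‖ ≤ C := by
  obtain ⟨g, hg, hgf⟩ := h.2 j hj
  have hK : IsCompact (closure Ω ∩ Metric.closedBall 0 R) :=
    (isCompact_closedBall _ _).inter_left isClosed_closure
  obtain ⟨C, hC⟩ := hK.exists_bound_of_continuousOn (hg.mono inter_subset_left)
  refine ⟨C, fun x hx hR => ?_⟩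
  rw [← hgf hx]
  exact hC x ⟨subset_closure hx, by simpa using hR⟩

namespace EMSystem

variable {d : ℕ} {S : EMSystem d} {γ₁ γ₂ : ℝ}

theorem norm_fderiv_eq_gradient (g : Eucl d → ℝ) (x : Eucl d) :
    ‖fderiv ℝ g x‖ = ‖gradient g x‖ := by
  rw [gradient]; simp

theorem exists_bound_V (S : EMSystem d) (R : ℝ) :
    ∃ C, 0 ≤ C ∧ ∀ x ∈ S.Ω, ‖x‖ ≤ R → ‖S.V x‖ ≤ C := by
  obtain ⟨C, hC⟩ := S.smooth_V.exists_bound (Nat.zero_le 1) R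
  refine ⟨max C 0, le_max_right _ _, fun x hx hR => le_max_of_le_left ?_⟩
  simpa using hC x hx hR

theorem exists_bound_A (S : EMSystem d) (R : ℝ) :
    ∃ C, 0 ≤ C ∧ ∀ x ∈ S.Ω, ‖x‖ ≤ R → ‖S.A x‖ ≤ C := by
  obtain ⟨C, hC⟩ := S.smooth_A.exists_bound (Nat.zero_le 2) R
  refine ⟨max C 0, le_max_right _ _, fun x hx hR => le_max_of_le_left ?_⟩
  simpa using hC x hx hR

theorem exists_bound_mBV (S : EMSystem d) (R : ℝ) :
    ∃ C, 0 ≤ C ∧ ∀ x ∈ S.Ω, ‖x‖ ≤ R → S.mBV x ≤ C := by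
  obtain ⟨C, hC0, hC⟩ := S.exists_bound_V R
  obtain ⟨C', hC'⟩ := S.smooth_A.exists_bound (j := 1) (by norm_num) R
  have hB : ∀ x ∈ S.Ω, ‖x‖ ≤ R → ∀ j k, S.B j k x ^ 2 ≤ (2 * C') ^ 2 := by
    intro x hx hR j k
    have h1 : ∀ i l : Fin d, |fderiv ℝ S.A x (basisVec i) l| ≤ C' := fun i l => by
      refine (PiLp.norm_apply_le (fderiv ℝ S.A x (basisVec i)) l).trans ?_
      refine ((fderiv ℝ S.A x).le_opNorm _).trans ?_
      have := hC' x hx hR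
      rw [norm_iteratedFDeriv_one] at this
      simpa using this
    rw [sq_le_sq]
    refine le_trans ?_ (le_abs_self _)
    rw [B]
    refine (abs_sub _ _).trans ?_
    linarith [h1 j k, h1 k j]
  refine ⟨√(1 + ∑ _j : Fin d, ∑ _k : Fin d, (2 * C') ^ 2 + C ^ 2), Real.sqrt_nonneg _,
    fun x hx hR => Real.sqrt_le_sqrt ?_⟩
  gcongr
  · exact Finset.sum_le_sum fun j _ => Finset.sum_le_sum fun k _ => hB x hx hR j k
  · exact hC x hx hR

/-- The hypothesis on the potentials bounds 9|∇Φ|² by m + V₁ + γ₂ - γ₁|V|, and m is bounded on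
bounded parts of Ω. -/
theorem exists_bound_fderiv_Φ (hd : 1 ≤ d) (hγ₁ : 0 < γ₁) (hbound : S.PotentialBound γ₁ γ₂)
    (R : ℝ) : ∃ C, 0 ≤ C ∧ ∀ x ∈ S.Ω, ‖x‖ ≤ R → ‖fderiv ℝ S.Φ x‖ ≤ C := by
  obtain ⟨C, hC0, hC⟩ := S.exists_bound_mBV R
  refine ⟨√(2 * C + |γ₂|), Real.sqrt_nonneg _, fun x hx hR => ?_⟩
  rw [norm_fderiv_eq_gradient]
  refine Real.le_sqrt_of_sq_le ?_
  have hb := hbound x hx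
  have hm := S.mBV_pos x
  have hD : (1 : ℝ) ≤ d := by exact_mod_cast hd
  have h1 : ((S.V x).im ^ 2 + 1 / (12 * (d : ℝ)) * S.normSqB x) / S.mBV x ≤ S.mBV x := by
    rw [div_le_iff₀ hm, ← sq, S.mBV_sq]
    have h2 : (S.V x).im ^ 2 ≤ ‖S.V x‖ ^ 2 := by
      rw [Complex.sq_norm, Complex.normSq_apply]; nlinarith [sq_nonneg (S.V x).re]
    have h3 : 1 / (12 * (d : ℝ)) * S.normSqB x ≤ 1 * S.normSqB x := by
      refine mul_le_mul_of_nonneg_right ?_ (S.normSqB_nonneg x)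
      rw [div_le_one (by positivity)]
      linarith
    linarith
  have h4 : (S.V x).re ≤ S.mBV x :=
    ((le_abs_self _).trans (Complex.abs_re_le_norm _)).trans (S.norm_V_le_mBV x)
  have h5 : 0 ≤ ∑ j, ∑ k, ‖gradient (S.Ψ j k) x‖ ^ 2 :=
    Finset.sum_nonneg fun _ _ => Finset.sum_nonneg fun _ _ => sq_nonneg _
  have h6 : 0 ≤ γ₁ * ‖S.V x‖ := by positivity
  have h7 := hC x hx hR
  have h8 := neg_abs_le γ₂
  have h9 := le_abs_self γ₂
  nlinarith [sq_nonneg ‖gradient S.Φ x‖]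

/-! ### Sets of small volume -/

/-- The magnetic energy density `|(-i∇ + A) f|² + |f|²`. -/
def energyDensity (S : EMSystem d) (f : Eucl d → ℂ) (x : Eucl d) : ℝ :=
  ∑ j, ‖S.magTest j f x‖ ^ 2 + ‖f x‖ ^ 2

theorem _root_.IsC1Test.integrable_norm_sq {f : Eucl d → ℂ} (hf : IsC1Test S.Ω f) :
    Integrable (fun x => ‖f x‖ ^ 2) := by
  have hc : Continuous (fun x => ‖f x‖ ^ 2) := hf.continuous.norm.pow 2
  refine hc.integrable_of_hasCompactSupport ?_
  refine HasCompactSupport.intro hf.hasCompactSupport fun x hx => ?_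
  rw [image_eq_zero_of_notMem_tsupport hx, norm_zero, zero_pow two_ne_zero]

theorem _root_.IsC1Test.integrable_magTest_norm_sq {f : Eucl d → ℂ} (hf : IsC1Test S.Ω f) :
    Integrable (fun x => ∑ j, ‖S.magTest j f x‖ ^ 2) := by
  refine integrable_finsetSum _ fun j _ => ?_
  have hc : Continuous (fun x => ‖S.magTest j f x‖ ^ 2) := (hf.continuous_magTest j).norm.pow 2
  refine hc.integrable_of_hasCompactSupport ?_
  refine HasCompactSupport.intro (hf.hasCompactSupport_magTest j) fun x hx => ?_
  rw [image_eq_zero_of_notMem_tsupport hx, norm_zero, zero_pow two_ne_zero]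

theorem norm_sq_le_sum_basisVec (T : Eucl d →L[ℝ] ℂ) : ‖T‖ ^ 2 ≤ ∑ j, ‖T (basisVec j)‖ ^ 2 := by
  have h : ‖T‖ ≤ √(∑ j, ‖T (basisVec j)‖ ^ 2) := by
    refine T.opNorm_le_bound (Real.sqrt_nonneg _) fun x => ?_
    have hx : x = ∑ j, x j • basisVec j := by
      have := (EuclideanSpace.basisFun (Fin d) ℝ).sum_repr x
      simpa [basisVec] using this.symm
    have h1 : T x = ∑ j, x j • T (basisVec j) := by
      conv_lhs => rw [hx]
      simp
    rw [h1, EuclideanSpace.norm_eq x, mul_comm]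
    refine (norm_sum_le _ _).trans ?_
    simp only [norm_smul]
    exact Real.sum_mul_le_sqrt_mul_sqrt _ _ _
  calc ‖T‖ ^ 2 ≤ √(∑ j, ‖T (basisVec j)‖ ^ 2) ^ 2 := by gcongr
    _ = _ := Real.sq_sqrt (Finset.sum_nonneg fun _ _ => sq_nonneg _)

/-- From ∂_j f = iP_j f - iA_j f, with A bounded on the ball: the small volume estimate involves the
ordinary gradient, while the coercivity controls the magnetic one. -/
theorem norm_fderiv_sq_le_energyDensity {f : Eucl d → ℂ} (hf : IsC1Test S.Ω f) {M R : ℝ}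
    (hM : ∀ x ∈ S.Ω, ‖x‖ ≤ R → ‖S.A x‖ ≤ M) {x : Eucl d} (hx : ‖x‖ ≤ R) :
    ‖fderiv ℝ f x‖ ^ 2 ≤ 2 * (1 + M ^ 2) * S.energyDensity f x := by
  by_cases hxΩ : x ∈ S.Ω
  · have h1 : ∀ j, ‖fderiv ℝ f x (basisVec j)‖ ^ 2
        ≤ 2 * ‖S.magTest j f x‖ ^ 2 + 2 * (S.A x j) ^ 2 * ‖f x‖ ^ 2 := by
      intro j
      have e : fderiv ℝ f x (basisVec j)
          = Complex.I * S.magTest j f x - Complex.I * ((S.A x j : ℂ) * f x) := by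
        simp only [magTest]
        linear_combination (fderiv ℝ f x (basisVec j)) * Complex.I_sq
      have h2 : ‖fderiv ℝ f x (basisVec j)‖ ≤ ‖S.magTest j f x‖ + |S.A x j| * ‖f x‖ := by
        rw [e]
        refine (norm_sub_le _ _).trans (le_of_eq ?_)
        simp
      have h3 : (|S.A x j| * ‖f x‖) ^ 2 = (S.A x j) ^ 2 * ‖f x‖ ^ 2 := by rw [mul_pow, sq_abs]
      calc _ ≤ (‖S.magTest j f x‖ + |S.A x j| * ‖f x‖) ^ 2 := by gcongr
        _ ≤ 2 * (‖S.magTest j f x‖ ^ 2 + (|S.A x j| * ‖f x‖) ^ 2) := add_sq_le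
        _ = _ := by rw [h3]; ring
    have h2 : ∑ j, (S.A x j) ^ 2 ≤ M ^ 2 := by
      rw [← EuclideanSpace.real_norm_sq_eq]
      exact pow_le_pow_left₀ (norm_nonneg _) (hM x hxΩ hx) 2
    calc _ ≤ _ := norm_sq_le_sum_basisVec _
      _ ≤ _ := Finset.sum_le_sum fun j _ => h1 j
      _ = 2 * ∑ j, ‖S.magTest j f x‖ ^ 2 + 2 * (∑ j, (S.A x j) ^ 2) * ‖f x‖ ^ 2 := by
          rw [Finset.sum_add_distrib, ← Finset.mul_sum, ← Finset.sum_mul, ← Finset.mul_sum]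
      _ ≤ 2 * ∑ j, ‖S.magTest j f x‖ ^ 2 + 2 * M ^ 2 * ‖f x‖ ^ 2 := by gcongr
      _ ≤ _ := by
          have : 0 ≤ ∑ j, ‖S.magTest j f x‖ ^ 2 := Finset.sum_nonneg fun _ _ => sq_nonneg _
          rw [energyDensity]
          nlinarith [sq_nonneg ‖f x‖, mul_nonneg (sq_nonneg M) this]
  · rw [hf.fderiv_eq_zero hxΩ, norm_zero, zero_pow two_ne_zero]
    have : 0 ≤ ∑ j, ‖S.magTest j f x‖ ^ 2 := Finset.sum_nonneg fun _ _ => sq_nonneg _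
    rw [energyDensity]
    positivity

/-- The `L²` mass in the part of a ball where a real function `D` is large is small compared to
the magnetic energy. -/
theorem exists_nat_integral_sq_le {D : Eucl d → ℝ} (hD : ContinuousOn D S.Ω) (R : ℝ) {τ : ℝ}
    (hτ : 0 < τ) :
    ∃ n : ℕ, ∀ f, IsC1Test S.Ω f →
      ∫ x in {x | x ∈ S.Ω ∧ (n : ℝ) < D x} ∩ Metric.ball 0 R, ‖f x‖ ^ 2
        ≤ τ * ∫ x, S.energyDensity f x := by
  obtain ⟨M, hM0, hM⟩ := S.exists_bound_A (R + 1)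
  -- The translation term has factor 2ρ² times the 2(1 + M²) of the gradient comparison; it gets
  -- half of τ.
  obtain ⟨ρ, hρ, hρ1, hρτ⟩ : ∃ ρ > 0, ρ ≤ 1 ∧ 4 * (1 + M ^ 2) * ρ ^ 2 ≤ τ / 2 := by
    refine ⟨min 1 (τ / (8 * (1 + M ^ 2))), by positivity, by simp, ?_⟩
    set ρ := min 1 (τ / (8 * (1 + M ^ 2))) with hρ
    have h0 : 0 < ρ := by positivity
    have h1 : ρ ≤ 1 := by simp [hρ]
    have h2 : ρ ≤ τ / (8 * (1 + M ^ 2)) := by simp [hρ]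
    rw [le_div_iff₀ (by positivity)] at h2
    nlinarith [sq_nonneg M, mul_pos h0 h0]
  set A : ℕ → Set (Eucl d) := fun n => {x | x ∈ S.Ω ∧ (n : ℝ) < D x} ∩ Metric.ball 0 R with hA
  have hAm : ∀ n, MeasurableSet (A n) := fun n =>
    ((hD.isOpen_inter_preimage S.isOpen_Ω isOpen_Ioi).inter Metric.isOpen_ball).measurableSet
  -- D takes finite real values and the ball has finite volume, so these decreasing sets with empty
  -- intersection have volumes tending to 0.
  have hlim : Tendsto (fun n => volume (A n)) atTop (𝓝 0) := by
    have hanti : Antitone A := fun n m hnm x hx =>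
      ⟨⟨hx.1.1, lt_of_le_of_lt (by exact_mod_cast hnm) hx.1.2⟩, hx.2⟩
    have := tendsto_measure_iInter_atTop (μ := volume) (fun n => (hAm n).nullMeasurableSet) hanti
      ⟨0, (measure_mono inter_subset_right).trans_lt measure_ball_lt_top |>.ne⟩
    have he : ⋂ n, A n = ∅ := by
      refine eq_empty_of_forall_notMem fun x hx => ?_
      obtain ⟨n, hn⟩ := exists_nat_gt (D x)
      exact absurd ((mem_iInter.1 hx n).1.2) (not_lt.2 hn.le)
    rwa [he, measure_empty] at this
  set β := volume (Metric.ball (0 : Eucl d) ρ) with hβ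
  have hβ0 : β ≠ 0 := (Metric.measure_ball_pos volume 0 hρ).ne'
  have hβt : β ≠ ⊤ := measure_ball_lt_top.ne
  obtain ⟨n, hn⟩ := (hlim.eventually (gt_mem_nhds
    (ENNReal.mul_pos (ENNReal.ofReal_pos.2 (show 0 < τ / 4 by positivity)).ne' hβ0))).exists
  refine ⟨n, fun f hf => ?_⟩
  set X := ∫ x, S.energyDensity f x with hX
  have iE : Integrable (S.energyDensity f) := hf.integrable_magTest_norm_sq.add hf.integrable_norm_sq
  have hE0 : ∀ x, 0 ≤ S.energyDensity f x := fun x =>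
    add_nonneg (Finset.sum_nonneg fun _ _ => sq_nonneg _) (sq_nonneg _)
  have hX0 : 0 ≤ X := integral_nonneg hE0
  have e : ∀ x, ‖f x‖ₑ ^ 2 = ENNReal.ofReal (‖f x‖ ^ 2) := fun x => by
    rw [ENNReal.ofReal_pow (norm_nonneg _), ofReal_norm]
  have h1 : ENNReal.ofReal (∫ x in A n, ‖f x‖ ^ 2) = ∫⁻ x in A n, ‖f x‖ₑ ^ 2 := by
    simp only [e]
    exact ofReal_integral_eq_lintegral_ofReal hf.integrable_norm_sq.integrableOn
      (Eventually.of_forall fun _ => sq_nonneg _)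
  have hXl : ∫⁻ x, ENNReal.ofReal (S.energyDensity f x) = ENNReal.ofReal X :=
    (ofReal_integral_eq_lintegral_ofReal iE (Eventually.of_forall hE0)).symm
  have h2 : ∫⁻ x, ‖f x‖ₑ ^ 2 ≤ ENNReal.ofReal X := by
    rw [← hXl]
    refine lintegral_mono fun x => ?_
    simp only [e]
    exact ENNReal.ofReal_le_ofReal
      (le_add_of_nonneg_left (Finset.sum_nonneg fun _ _ => sq_nonneg _))
  have h3 : ∫⁻ x in Metric.ball 0 (R + 1), ‖fderiv ℝ f x‖ₑ ^ 2
      ≤ ENNReal.ofReal (2 * (1 + M ^ 2)) * ENNReal.ofReal X := by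
    rw [← hXl, ← lintegral_const_mul' _ _ ENNReal.ofReal_ne_top]
    refine (setLIntegral_mono' Metric.isOpen_ball.measurableSet fun x hx => ?_).trans
      (setLIntegral_le_lintegral _ _)
    rw [← ENNReal.ofReal_mul (by positivity), ← ofReal_norm,
      ← ENNReal.ofReal_pow (norm_nonneg _)]
    exact ENNReal.ofReal_le_ofReal (norm_fderiv_sq_le_energyDensity hf hM (by
      rw [mem_ball_zero_iff] at hx; exact hx.le))
  have h4 := lintegral_sq_le_of_subset_ball volume hf.contDiff (A := A n) (R := R)
    inter_subset_right hρ hρ1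
  rw [← h1] at h4
  have h5 : 2 * β⁻¹ * volume (A n) ≤ ENNReal.ofReal (τ / 2) := by
    calc 2 * β⁻¹ * volume (A n) ≤ 2 * β⁻¹ * (ENNReal.ofReal (τ / 4) * β) := by gcongr
      _ = 2 * ENNReal.ofReal (τ / 4) * (β⁻¹ * β) := by ring
      _ = ENNReal.ofReal (τ / 2) := by
          rw [ENNReal.inv_mul_cancel hβ0 hβt, mul_one,
            show (2 : ℝ≥0∞) = ENNReal.ofReal 2 by simp, ← ENNReal.ofReal_mul (by norm_num)]
          congr 1
          ring
  have h6 : ENNReal.ofReal (∫ x in A n, ‖f x‖ ^ 2) ≤ ENNReal.ofReal (τ * X) := by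
    calc _ ≤ _ := h4
      _ ≤ 2 * ENNReal.ofReal (ρ ^ 2) * (ENNReal.ofReal (2 * (1 + M ^ 2)) * ENNReal.ofReal X)
          + ENNReal.ofReal (τ / 2) * ENNReal.ofReal X := by gcongr
      _ = ENNReal.ofReal ((4 * (1 + M ^ 2) * ρ ^ 2) * X + τ / 2 * X) := by
          rw [show (2 : ℝ≥0∞) = ENNReal.ofReal 2 by simp, ← ENNReal.ofReal_mul (by positivity),
            ← ENNReal.ofReal_mul (by positivity), ← ENNReal.ofReal_mul (by positivity),
            ← ENNReal.ofReal_mul (by positivity), ← ENNReal.ofReal_add (by positivity)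
            (by positivity)]
          congr 1
          ring
      _ ≤ _ := by
          refine ENNReal.ofReal_le_ofReal ?_
          nlinarith
  exact (ENNReal.ofReal_le_ofReal_iff (by positivity)).1 h6

end EMSystem

/-! ### The Agmon estimate for test functions -/

namespace EMSystem

variable {d : ℕ} {S : EMSystem d} {γ₁ γ₂ : ℝ}

/-- The pairing `Q(φ, u) - lam ⟨φ, u⟩` on `𝒞¹_c(Ω)`. -/
def shiftedForm (S : EMSystem d) (lam : ℂ) (φ u : Eucl d → ℂ) : ℂ :=
  (∫ x, S.formIntegrand φ u x) - lam * ∫ x, φ x * conj (u x)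

/-- Both integrals are real and |Φ| ≤ 1, so λ enters only through Re λ + |Im λ|: this is the
combination in the Agmon metric. -/
theorem re_mul_add_im_mul_le {φ : Eucl d → ℂ} (hφ : IsTestFunction S.Ω φ) {θ : Eucl d → ℝ}
    (hθ : ContDiff ℝ ∞ θ) (lam : ℂ) :
    (lam * ∫ x, φ x * conj (((θ x ^ 2 : ℝ) : ℂ) * φ x)).re
      + (lam * ∫ x, φ x * conj (((S.Φ x * θ x ^ 2 : ℝ) : ℂ) * φ x)).im
      ≤ (lam.re + |lam.im|) * ∫ x, θ x ^ 2 * ‖φ x‖ ^ 2 := by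
  have hθ1 : ContDiff ℝ 1 θ := hθ.of_le (by simp)
  have hf : IsC1Test S.Ω (fun y => (θ y : ℂ) * φ y) := hφ.isC1Test.ofReal_mul hθ1.contDiffOn
  have i1 : Integrable (fun x => θ x ^ 2 * ‖φ x‖ ^ 2) := by
    refine hf.integrable_norm_sq.congr (Eventually.of_forall fun x => ?_)
    simp [mul_pow]
  have e1 : ∫ x, φ x * conj (((θ x ^ 2 : ℝ) : ℂ) * φ x)
      = ((∫ x, θ x ^ 2 * ‖φ x‖ ^ 2 : ℝ) : ℂ) := by
    rw [← integral_complex_ofReal]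
    refine integral_congr_ae (Eventually.of_forall fun x => ?_)
    simp only [map_mul, Complex.conj_ofReal]
    push_cast
    rw [← Complex.mul_conj']
    ring
  have e2 : ∫ x, φ x * conj (((S.Φ x * θ x ^ 2 : ℝ) : ℂ) * φ x)
      = ((∫ x, S.Φ x * (θ x ^ 2 * ‖φ x‖ ^ 2) : ℝ) : ℂ) := by
    rw [← integral_complex_ofReal]
    refine integral_congr_ae (Eventually.of_forall fun x => ?_)
    simp only [map_mul, Complex.conj_ofReal]
    push_cast
    rw [← Complex.mul_conj']
    ring
  have h2 : |∫ x, S.Φ x * (θ x ^ 2 * ‖φ x‖ ^ 2)| ≤ ∫ x, θ x ^ 2 * ‖φ x‖ ^ 2 := by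
    rw [← Real.norm_eq_abs]
    refine norm_integral_le_of_norm_le i1 (Eventually.of_forall fun x => ?_)
    rw [norm_mul, Real.norm_of_nonneg (show 0 ≤ θ x ^ 2 * ‖φ x‖ ^ 2 by positivity)]
    exact mul_le_of_le_one_left (by positivity) (S.abs_Φ_le_one x)
  rw [e1, e2, Complex.re_mul_ofReal, Complex.im_mul_ofReal, add_mul]
  refine add_le_add le_rfl ((le_abs_self _).trans ?_)
  rw [abs_mul]
  exact mul_le_mul_of_nonneg_left h2 (abs_nonneg _)

/-- The Agmon estimate for test functions, with constants independent of the weight. -/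
theorem exists_agmon_estimate_test (hd : 1 ≤ d) (hbound : S.PotentialBound γ₁ γ₂)
    (hγ₁ : 0 < γ₁) {lam : ℂ} {δ : ℝ} (hδ : 0 < δ) {R : ℝ}
    (hκ : ∀ x ∈ S.Ω, R ≤ ‖x‖ → δ ≤ γ₁ * ‖S.V x‖ - lam.re - |lam.im| - γ₂)
    {D : Eucl d → ℝ} (hD : ContinuousOn D S.Ω) {a : ℝ} (ha : 0 ≤ a) :
    ∃ C, 0 ≤ C ∧ ∀ (φ : Eucl d → ℂ) (θ : Eucl d → ℝ), IsTestFunction S.Ω φ → ContDiff ℝ ∞ θ →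
      (∀ x ∈ tsupport φ, 4 * ‖gradient θ x‖ ^ 2
        ≤ (9 / 16 * S.agmonWeight γ₁ γ₂ lam x + δ / 16) * θ x ^ 2 + 1) →
      (∀ x ∈ tsupport φ, θ x ^ 2 ≤ Real.exp (2 * (a * D x) + 2)) →
      3 * δ / 16 * ∫ x, θ x ^ 2 * ‖φ x‖ ^ 2
        ≤ C * (∫ x, ‖φ x‖ ^ 2)
          + (S.shiftedForm lam φ (fun y => ((θ y ^ 2 : ℝ) : ℂ) * φ y)).re
          + (S.shiftedForm lam φ (fun y => ((S.Φ y * θ y ^ 2 : ℝ) : ℂ) * φ y)).im := by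
  set c₀ := lam.re + |lam.im| + γ₂ with hc₀
  set C₁ := |c₀| + δ with hC₁
  have hC₁0 : 0 < C₁ := by positivity
  -- C₁ makes up for the most negative value the potential term can take in the ball; τ is such that
  -- C₁τ times the energy is absorbed by ¼ of the kinetic term and by δ/16 of the mass.
  set τ := min (1 / 4) (δ / 16) / C₁ with hτ
  have hτ0 : 0 < τ := by positivity
  have hτ1 : C₁ * τ ≤ 1 / 4 := by
    rw [hτ, mul_div_cancel₀ _ hC₁0.ne']; exact min_le_left _ _
  have hτ2 : C₁ * τ ≤ δ / 16 := by
    rw [hτ, mul_div_cancel₀ _ hC₁0.ne']; exact min_le_right _ _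
  obtain ⟨n, hn⟩ := exists_nat_integral_sq_le hD R hτ0
  set E := Real.exp (2 * (a * n) + 2) with hE
  refine ⟨C₁ * E + 1, by positivity, fun φ θ hφ hθ H1 H2 => ?_⟩
  have hθ1 : ContDiff ℝ 1 θ := hθ.of_le (by simp)
  set f : Eucl d → ℂ := fun y => (θ y : ℂ) * φ y with hfdef
  have hf : IsC1Test S.Ω f := hφ.isC1Test.ofReal_mul hθ1.contDiffOn
  have hfn : ∀ x, ‖f x‖ ^ 2 = θ x ^ 2 * ‖φ x‖ ^ 2 := fun x => by simp [hfdef, mul_pow]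
  set A : Set (Eucl d) := {x | x ∈ S.Ω ∧ (n : ℝ) < D x} ∩ Metric.ball 0 R with hA
  have hAm : MeasurableSet A :=
    ((hD.isOpen_inter_preimage S.isOpen_Ω isOpen_Ioi).inter Metric.isOpen_ball).measurableSet
  -- Outside the ball of radius R the weight suffices. Inside it the deficit is charged to A, the
  -- small set where D > n, and elsewhere to |φ|², because θ² ≤ E where D ≤ n.
  have hpt : ∀ x, 1 / 4 * ∑ j, ‖S.magTest j f x‖ ^ 2 + δ / 4 * ‖f x‖ ^ 2
      ≤ (S.coerciveIntegrand γ₁ γ₂ θ φ x - (lam.re + |lam.im|) * ‖f x‖ ^ 2)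
        + (C₁ * A.indicator (fun y => ‖f y‖ ^ 2) x + (C₁ * E + 1) * ‖φ x‖ ^ 2) := by
    intro x
    by_cases hx : x ∈ tsupport φ
    swap
    · have h0 : φ x = 0 := image_eq_zero_of_notMem_tsupport hx
      have h1 : f x = 0 := by simp [hfdef, h0]
      have h2 : 0 ≤ C₁ * A.indicator (fun y => ‖f y‖ ^ 2) x :=
        mul_nonneg hC₁0.le (indicator_nonneg (fun _ _ => sq_nonneg _) _)
      have h3 : S.coerciveIntegrand γ₁ γ₂ θ φ x = 1 / 4 * ∑ j, ‖S.magTest j f x‖ ^ 2 := by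
        simp [coerciveIntegrand, h0, hfdef]
      rw [h3, h0, h1]
      simp only [norm_zero]
      linarith
    have hxΩ : x ∈ S.Ω := hφ.2.2 hx
    have e : S.coerciveIntegrand γ₁ γ₂ θ φ x = 1 / 4 * ∑ j, ‖S.magTest j f x‖ ^ 2
        + (γ₁ * ‖S.V x‖ - γ₂) * ‖f x‖ ^ 2 - 4 * ‖gradient θ x‖ ^ 2 * ‖φ x‖ ^ 2 := by
      rw [hfn]; rfl
    rw [e]
    have hφ0 : 0 ≤ ‖φ x‖ ^ 2 := sq_nonneg _
    have hf0 : 0 ≤ ‖f x‖ ^ 2 := sq_nonneg _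
    have g1 : 4 * ‖gradient θ x‖ ^ 2 * ‖φ x‖ ^ 2
        ≤ (9 / 16 * S.agmonWeight γ₁ γ₂ lam x + δ / 16) * ‖f x‖ ^ 2 + ‖φ x‖ ^ 2 := by
      have := mul_le_mul_of_nonneg_right (H1 x hx) hφ0
      rw [hfn]
      linarith
    set κ := γ₁ * ‖S.V x‖ - lam.re - |lam.im| - γ₂ with hκdef
    have hκ' : γ₁ * ‖S.V x‖ - γ₂ = κ + (lam.re + |lam.im|) := by rw [hκdef]; ring
    have hw : S.agmonWeight γ₁ γ₂ lam x = max κ 0 := rfl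
    rw [hw] at g1
    have hind0 : 0 ≤ A.indicator (fun y => ‖f y‖ ^ 2) x :=
      indicator_nonneg (fun _ _ => sq_nonneg _) _
    have hE0 : 0 ≤ C₁ * E * ‖φ x‖ ^ 2 := by positivity
    have hC1ind : 0 ≤ C₁ * A.indicator (fun y => ‖f y‖ ^ 2) x := mul_nonneg hC₁0.le hind0
    rw [hκ']
    rcases le_or_gt R ‖x‖ with hR | hR
    -- Here 7/16 κ - δ/16 ≥ 3δ/8, more than the δ/4 required.
    · have h1 : δ ≤ κ := hκ x hxΩ hR
      rw [max_eq_left (hδ.le.trans h1)] at g1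
      nlinarith
    · have h1 : -|c₀| ≤ κ - 9 / 16 * max κ 0 := by
        have h2 : -|c₀| ≤ κ := by
          have : 0 ≤ γ₁ * ‖S.V x‖ := by positivity
          have := le_abs_self c₀
          rw [hκdef]
          linarith
        rcases le_total κ 0 with h | h
        · rw [max_eq_right h]; linarith
        · rw [max_eq_left h]; linarith [abs_nonneg c₀]
      have h3 : ‖f x‖ ^ 2 ≤ A.indicator (fun y => ‖f y‖ ^ 2) x + E * ‖φ x‖ ^ 2 := by
        by_cases hxA : x ∈ A
        · rw [indicator_of_mem hxA]
          have : 0 ≤ E * ‖φ x‖ ^ 2 := by positivity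
          linarith
        · have hDn : D x ≤ n := by
            by_contra hlt
            exact hxA ⟨⟨hxΩ, not_le.1 hlt⟩, by simpa using hR⟩
          rw [indicator_of_notMem hxA, zero_add, hfn]
          refine mul_le_mul_of_nonneg_right ((H2 x hx).trans ?_) hφ0
          rw [hE]
          gcongr
      have h4 := mul_le_mul_of_nonneg_left h3 hC₁0.le
      have h5 := mul_le_mul_of_nonneg_right h1 hf0
      have h6 : C₁ * ‖f x‖ ^ 2 = |c₀| * ‖f x‖ ^ 2 + δ * ‖f x‖ ^ 2 := by rw [hC₁]; ring
      have h7 : 0 ≤ δ * ‖f x‖ ^ 2 := by positivity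
      linarith
  have iF := hf.integrable_magTest_norm_sq
  have iff := hf.integrable_norm_sq
  have iφ := hφ.isC1Test.integrable_norm_sq
  have iC := integrable_coerciveIntegrand (S := S) γ₁ γ₂ hφ hθ
  have iA : Integrable (A.indicator (fun y => ‖f y‖ ^ 2)) := iff.indicator hAm
  have j1 : Integrable (fun x => 1 / 4 * ∑ j, ‖S.magTest j f x‖ ^ 2 + δ / 4 * ‖f x‖ ^ 2) :=
    (iF.const_mul _).add (iff.const_mul _)
  have j2 : Integrable (fun x => S.coerciveIntegrand γ₁ γ₂ θ φ x
      - (lam.re + |lam.im|) * ‖f x‖ ^ 2) := iC.sub (iff.const_mul _)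
  have j3 : Integrable (fun x => C₁ * A.indicator (fun y => ‖f y‖ ^ 2) x
      + (C₁ * E + 1) * ‖φ x‖ ^ 2) := (iA.const_mul _).add (iφ.const_mul _)
  have hint := (integral_mono j1 (j2.add j3) hpt).trans_eq (integral_add j2 j3)
  have k1 : ∫ x, (1 / 4 * ∑ j, ‖S.magTest j f x‖ ^ 2 + δ / 4 * ‖f x‖ ^ 2)
      = 1 / 4 * (∫ x, ∑ j, ‖S.magTest j f x‖ ^ 2) + δ / 4 * ∫ x, ‖f x‖ ^ 2 := by
    rw [integral_add (iF.const_mul _) (iff.const_mul _), integral_const_mul, integral_const_mul]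
  have k2 : ∫ x, (S.coerciveIntegrand γ₁ γ₂ θ φ x - (lam.re + |lam.im|) * ‖f x‖ ^ 2)
      = (∫ x, S.coerciveIntegrand γ₁ γ₂ θ φ x) - (lam.re + |lam.im|) * ∫ x, ‖f x‖ ^ 2 := by
    rw [integral_sub iC (iff.const_mul _), integral_const_mul]
  have k4 : ∫ x, (C₁ * A.indicator (fun y => ‖f y‖ ^ 2) x + (C₁ * E + 1) * ‖φ x‖ ^ 2)
      = C₁ * (∫ x in A, ‖f x‖ ^ 2) + (C₁ * E + 1) * ∫ x, ‖φ x‖ ^ 2 := by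
    rw [integral_add (iA.const_mul _) (iφ.const_mul _), integral_const_mul, integral_const_mul,
      integral_indicator hAm]
  rw [k1, k2, k4] at hint
  have hsmall := hn f hf
  have k3 : ∫ x, S.energyDensity f x
      = (∫ x, ∑ j, ‖S.magTest j f x‖ ^ 2) + ∫ x, ‖f x‖ ^ 2 := integral_add iF iff
  rw [k3] at hsmall
  have hco := integral_coerciveIntegrand_le hd hbound hφ hθ
  have hlam := re_mul_add_im_mul_le hφ hθ lam
  have hff : ∫ x, θ x ^ 2 * ‖φ x‖ ^ 2 = ∫ x, ‖f x‖ ^ 2 := by simp only [hfn]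
  rw [hff] at hlam ⊢
  simp only [shiftedForm, Complex.sub_re, Complex.sub_im]
  set X := ∫ x, ∑ j, ‖S.magTest j f x‖ ^ 2
  set Y := ∫ x, ‖f x‖ ^ 2
  have hX : 0 ≤ X := integral_nonneg fun x => Finset.sum_nonneg fun _ _ => sq_nonneg _
  have hY : 0 ≤ Y := integral_nonneg fun x => sq_nonneg _
  have h1 := mul_le_mul_of_nonneg_left hsmall hC₁0.le
  have h2 := mul_le_mul_of_nonneg_right hτ1 hX
  have h3 := mul_le_mul_of_nonneg_right hτ2 hY
  have h4 : C₁ * (τ * (X + Y)) = C₁ * τ * X + C₁ * τ * Y := by ring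
  linarith

end EMSystem

/-! ### Slowly varying cutoffs and continuity of the form in H¹_A -/

/-- Dilating a fixed bump makes its gradient as small as desired; in the application it must
compensate a factor e^{aN+1}. -/
theorem exists_cutoff (d : ℕ) (R : ℝ) {ε : ℝ} (hε : 0 < ε) :
    ∃ χ : Eucl d → ℝ, ContDiff ℝ ∞ χ ∧ (∀ x, 0 ≤ χ x) ∧ (∀ x, χ x ≤ 1) ∧
      (∀ x ∈ Metric.ball 0 R, χ x = 1) ∧ (∀ x, ‖fderiv ℝ χ x‖ ≤ ε) ∧
      ∃ R', ∀ x, χ x ≠ 0 → ‖x‖ ≤ R' := by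
  let β : ContDiffBump (0 : Eucl d) := ⟨1, 2, by norm_num, by norm_num⟩
  have hβ : ContDiff ℝ ∞ β := β.contDiff
  obtain ⟨L, hL⟩ := (hβ.continuous_fderiv (by simp)).bounded_above_of_compact_support
    (β.hasCompactSupport.fderiv ℝ)
  have hL0 : 0 ≤ L := (norm_nonneg _).trans (hL 0)
  obtain ⟨s, hs, hsR, hsε⟩ : ∃ s > 0, s * R ≤ 1 ∧ L * s ≤ ε := by
    refine ⟨min (1 / (|R| + 1)) (ε / (L + 1)), by positivity, ?_, ?_⟩
    · have h1 : min (1 / (|R| + 1)) (ε / (L + 1)) ≤ 1 / (|R| + 1) := min_le_left _ _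
      rw [le_div_iff₀ (by positivity)] at h1
      have h2 : 0 < min (1 / (|R| + 1)) (ε / (L + 1)) := by positivity
      nlinarith [le_abs_self R]
    · have h1 : min (1 / (|R| + 1)) (ε / (L + 1)) ≤ ε / (L + 1) := min_le_right _ _
      rw [le_div_iff₀ (by positivity)] at h1
      have h2 : 0 < min (1 / (|R| + 1)) (ε / (L + 1)) := by positivity
      nlinarith
  refine ⟨fun x => β (s • x), hβ.comp (contDiff_const_smul s), fun x => β.nonneg,
    fun x => β.le_one, fun x hx => ?_, fun x => ?_, 2 / s, fun x hx => ?_⟩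
  · refine β.one_of_mem_closedBall ?_
    have hx' : ‖x‖ < R := by simpa using hx
    simp only [mem_closedBall_zero_iff, norm_smul, Real.norm_of_nonneg hs.le]
    exact (by gcongr : s * ‖x‖ ≤ s * R).trans hsR
  · have h1 : HasFDerivAt (fun x : Eucl d => s • x) (s • ContinuousLinearMap.id ℝ (Eucl d)) x :=
      (hasFDerivAt_id x).const_smul s
    have h2 := ((hβ.differentiable (by simp)) (s • x)).hasFDerivAt.comp x h1
    have h3 : HasFDerivAt (fun x => β (s • x)) _ x := h2
    rw [h3.fderiv]
    refine (ContinuousLinearMap.opNorm_comp_le _ _).trans ?_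
    have h4 : ‖s • ContinuousLinearMap.id ℝ (Eucl d)‖ ≤ s := by
      rw [norm_smul, Real.norm_of_nonneg hs.le]
      exact mul_le_of_le_one_right hs.le ContinuousLinearMap.norm_id_le
    exact (mul_le_mul (hL _) h4 (norm_nonneg _) hL0).trans hsε
  · have h1 : s • x ∈ Function.support β := hx
    rw [β.support_eq] at h1
    have h2 : s * ‖x‖ < 2 := by
      simpa [norm_smul, Real.norm_of_nonneg hs.le] using h1
    rw [le_div_iff₀ hs]
    linarith

theorem norm_toLp_le_mul_add {d : ℕ} {Ω : Set (Eucl d)} {h p q : Eucl d → ℂ}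
    (hh : MemLp h 2 (volume.restrict Ω)) (hp : MemLp p 2 (volume.restrict Ω))
    (hq : MemLp q 2 (volume.restrict Ω)) {G : ℝ} (hG : 0 ≤ G)
    (hle : ∀ x, ‖h x‖ ≤ G * (‖p x‖ + ‖q x‖)) :
    ‖hh.toLp‖ ≤ G * (‖hp.toLp‖ + ‖hq.toLp‖) := by
  have h1 : eLpNorm h 2 (volume.restrict Ω)
      ≤ ENNReal.ofReal G * (eLpNorm p 2 (volume.restrict Ω) + eLpNorm q 2 (volume.restrict Ω)) := by
    calc eLpNorm h 2 (volume.restrict Ω)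
        ≤ eLpNorm (fun x => G * (‖p x‖ + ‖q x‖)) 2 (volume.restrict Ω) := eLpNorm_mono_real hle
      _ = ENNReal.ofReal G * eLpNorm ((fun x => ‖p x‖) + fun x => ‖q x‖) 2
            (volume.restrict Ω) := by
          rw [← Real.enorm_of_nonneg hG]
          exact eLpNorm_const_smul G _ _ _
      _ ≤ _ := by
          gcongr
          refine (eLpNorm_add_le hp.1.norm hq.1.norm (by norm_num)).trans ?_
          rw [eLpNorm_norm, eLpNorm_norm]
  have h2 := ENNReal.toReal_mono (ENNReal.mul_ne_top ENNReal.ofReal_ne_top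
    (ENNReal.add_ne_top.2 ⟨hp.2.ne, hq.2.ne⟩)) h1
  rw [ENNReal.toReal_mul, ENNReal.toReal_add hp.2.ne hq.2.ne, ENNReal.toReal_ofReal hG] at h2
  simpa only [Lp.norm_toLp] using h2

namespace EMSystem

variable {d : ℕ} {S : EMSystem d}

theorem norm_le_normH1A (u : LTwo S.Ω) : ‖u‖ ≤ S.normH1A u := by
  refine Real.le_sqrt_of_sq_le (le_add_of_nonneg_right ?_)
  exact Finset.sum_nonneg fun _ _ => sq_nonneg _

theorem norm_magDeriv_le_normH1A (u : LTwo S.Ω) (j : Fin d) :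
    ‖S.magDeriv j u‖ ≤ S.normH1A u := by
  refine Real.le_sqrt_of_sq_le (le_add_of_nonneg_of_le (sq_nonneg _) ?_)
  exact Finset.single_le_sum (f := fun j => ‖S.magDeriv j u‖ ^ 2) (fun _ _ => sq_nonneg _)
    (Finset.mem_univ j)

theorem normH1A_nonneg (u : LTwo S.Ω) : 0 ≤ S.normH1A u := Real.sqrt_nonneg _

theorem inner_toLp_toLp {u v : Eucl d → ℂ} (hu : IsC1Test S.Ω u) (hv : IsC1Test S.Ω v) :
    inner ℂ (hv.memLp.toLp : LTwo S.Ω) hu.memLp.toLp = ∫ x, u x * conj (v x) := by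
  rw [L2.inner_def, ← setIntegral_eq_integral_of_forall_compl_eq_zero (s := S.Ω)
    (f := fun x => u x * conj (v x)) (fun x hx => by simp [hu.eq_zero hx])]
  refine integral_congr_ae ?_
  filter_upwards [hu.memLp.coeFn_toLp, hv.memLp.coeFn_toLp] with x h1 h2
  rw [h1, h2, RCLike.inner_apply]

theorem shiftedForm_eq {lam : ℂ} {u v : Eucl d → ℂ} (hu : IsC1Test S.Ω u)
    (hv : IsC1Test S.Ω v) :
    S.shiftedForm lam u v
      = S.Q hu.memLp.toLp hv.memLp.toLp - lam * inner ℂ (hv.memLp.toLp : LTwo S.Ω)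
        hu.memLp.toLp := by
  rw [shiftedForm, Q_toLp hu hv, inner_toLp_toLp hu hv]

/-- Continuity of the form against `g φ`, where `g` is bounded with bounded gradient and vanishes
where the potential is large. -/
theorem norm_form_mul_le (lam : ℂ) {w : LTwo S.Ω} {φ : Eucl d → ℂ}
    (hφ : IsC1Test S.Ω φ) {g : Eucl d → ℝ} (hg : ContDiffOn ℝ 1 g S.Ω) {G C : ℝ} (hC : 0 ≤ C)
    (hG : 0 ≤ G)
    (hgG : ∀ x ∈ tsupport φ, |g x| ≤ G ∧ ‖fderiv ℝ g x‖ ≤ G ∧ (g x ≠ 0 → ‖S.V x‖ ≤ C)) :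
    ‖S.Q w (hφ.ofReal_mul hg).memLp.toLp
        - lam * inner ℂ ((hφ.ofReal_mul hg).memLp.toLp : LTwo S.Ω) w‖
      ≤ (2 * d + C + ‖lam‖) * G * (S.normH1A w * S.normH1A hφ.memLp.toLp) := by
  set hu := hφ.ofReal_mul hg with hudef
  set v : LTwo S.Ω := hφ.memLp.toLp with hv
  set u : LTwo S.Ω := hu.memLp.toLp with hudef'
  set a := S.normH1A w with ha
  set b := S.normH1A v with hb
  have ha0 : 0 ≤ a := normH1A_nonneg _
  have hb0 : 0 ≤ b := normH1A_nonneg _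
  have hpt : ∀ x, ‖(g x : ℂ) * φ x‖ ≤ G * ‖φ x‖ := by
    intro x
    by_cases hx : x ∈ tsupport φ
    · rw [norm_mul, Complex.norm_real]
      exact mul_le_mul_of_nonneg_right (hgG x hx).1 (norm_nonneg _)
    · simp [image_eq_zero_of_notMem_tsupport hx]
  have h0 : ‖u‖ ≤ G * b := by
    have h1 : ‖u‖ ≤ G * ‖v‖ := by
      refine Lp.norm_le_mul_norm_of_ae_le_mul ?_
      filter_upwards [hu.memLp.coeFn_toLp, hφ.memLp.coeFn_toLp] with x h1 h2
      rw [h1, h2]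
      exact hpt x
    exact h1.trans (mul_le_mul_of_nonneg_left (norm_le_normH1A _) hG)
  have h1 : ∀ j, ‖S.magDeriv j u‖ ≤ 2 * G * b := by
    intro j
    have hle : ∀ x, ‖S.magTest j (fun y => (g y : ℂ) * φ y) x‖
        ≤ G * (‖S.magTest j φ x‖ + ‖φ x‖) := by
      intro x
      by_cases hx : x ∈ tsupport φ
      · have hxΩ := hφ.tsupport_subset hx
        rw [magTest_ofReal_mul j ((hg.contDiffAt (S.isOpen_Ω.mem_nhds hxΩ)).differentiableAt
          (by simp)) (hφ.differentiable x), mul_add]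
        refine (norm_sub_le _ _).trans ?_
        rw [norm_mul, norm_mul, norm_mul, Complex.norm_I, one_mul, Complex.norm_real,
          Complex.norm_real]
        have h2 : ‖fderiv ℝ g x (basisVec j)‖ ≤ G := by
          refine ((fderiv ℝ g x).le_opNorm _).trans ?_
          simpa using (hgG x hx).2.1
        have h3 : ‖g x‖ ≤ G := (hgG x hx).1
        gcongr
      · have h2 : (fun y => (g y : ℂ) * φ y) =ᶠ[𝓝 x] fun _ => 0 := by
          filter_upwards [notMem_tsupport_iff_eventuallyEq.1 hx] with y hy
          rw [hy, Pi.zero_apply, mul_zero]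
        have h3 : S.magTest j (fun y => (g y : ℂ) * φ y) x = 0 := by
          simp only [magTest]
          rw [h2.fderiv_eq, h2.eq_of_nhds]
          simp
        rw [h3, norm_zero]
        positivity
    have h2 := norm_toLp_le_mul_add (hu.memLp_magTest j) (hφ.memLp_magTest j) hφ.memLp hG hle
    rw [← hu.magDeriv_eq, ← hφ.magDeriv_eq] at h2
    have h3 := norm_magDeriv_le_normH1A v j
    have h4 := norm_le_normH1A v
    calc _ ≤ G * (‖S.magDeriv j v‖ + ‖v‖) := h2
      _ ≤ G * (b + b) := by gcongr
      _ = 2 * G * b := by ring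
  have h2 : ‖∑ j, inner ℂ (S.magDeriv j u) (S.magDeriv j w)‖ ≤ 2 * d * G * (a * b) := by
    refine (norm_sum_le _ _).trans ?_
    refine (Finset.sum_le_card_nsmul _ _ (2 * G * b * a) fun j _ => ?_).trans (le_of_eq ?_)
    · refine (norm_inner_le_norm _ _).trans ?_
      exact mul_le_mul (h1 j) (norm_magDeriv_le_normH1A w j) (norm_nonneg _) (by positivity)
    · simp
      ring
  have h3 : ‖∫ x in S.Ω, S.V x * w x * conj (u x)‖ ≤ C * G * (a * b) := by
    -- V is moved to the compactly supported factor, where it is bounded by C, so that w need only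
    -- be small in H¹_A and no norm of |V|^{1/2}w is involved.
    have hV : IsC1Test S.Ω (fun x => conj (S.V x) * ((g x : ℂ) * φ x)) :=
      hu.mul_left S.isOpen_Ω ((Complex.conjCLE : ℂ →L[ℝ] ℂ).contDiff.comp_contDiffOn
        S.contDiffOn_V)
    have e : ∫ x in S.Ω, S.V x * w x * conj (u x)
        = inner ℂ (hV.memLp.toLp : LTwo S.Ω) w := by
      rw [L2.inner_def]
      refine integral_congr_ae ?_
      filter_upwards [hu.memLp.coeFn_toLp, hV.memLp.coeFn_toLp] with x h1 h2
      rw [h1, h2, RCLike.inner_apply]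
      simp only [map_mul, Complex.conj_conj]
      ring
    rw [e]
    have h4 : ‖(hV.memLp.toLp : LTwo S.Ω)‖ ≤ C * G * ‖v‖ := by
      refine Lp.norm_le_mul_norm_of_ae_le_mul ?_
      filter_upwards [hV.memLp.coeFn_toLp, hφ.memLp.coeFn_toLp] with x h1 h2
      rw [h1, h2]
      by_cases hx : x ∈ tsupport φ
      · by_cases hgx : g x = 0
        · simp only [hgx, Complex.ofReal_zero, zero_mul, mul_zero, norm_zero]
          positivity
        · rw [norm_mul, RCLike.norm_conj, mul_assoc]
          exact mul_le_mul ((hgG x hx).2.2 hgx) (hpt x) (norm_nonneg _) hC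
      · simp [image_eq_zero_of_notMem_tsupport hx]
    refine (norm_inner_le_norm _ _).trans ?_
    calc _ ≤ (C * G * ‖v‖) * ‖w‖ := by gcongr
      _ ≤ (C * G * b) * a := by
          gcongr
          · exact norm_le_normH1A v
          · exact norm_le_normH1A w
      _ = _ := by ring
  have h4 : ‖lam * inner ℂ u w‖ ≤ ‖lam‖ * G * (a * b) := by
    rw [norm_mul]
    calc _ ≤ ‖lam‖ * (‖u‖ * ‖w‖) := by gcongr; exact norm_inner_le_norm _ _
      _ ≤ ‖lam‖ * ((G * b) * a) := by
          gcongr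
          exact norm_le_normH1A w
      _ = _ := by ring
  refine (norm_sub_le _ _).trans ?_
  have h5 : ‖S.Q w u‖ ≤ 2 * d * G * (a * b) + C * G * (a * b) :=
    (norm_add_le _ _).trans (add_le_add h2 h3)
  linarith

end EMSystem

theorem integral_norm_mul_norm_le {α : Type*} [MeasurableSpace α] {μ : Measure α} {p q : α → ℂ}
    (hp : MemLp p 2 μ) (hq : MemLp q 2 μ) :
    ∫ x, ‖p x‖ * ‖q x‖ ∂μ ≤ ‖hp.toLp‖ * ‖hq.toLp‖ := by
  have h := real_inner_le_norm (hp.norm.toLp : Lp ℝ 2 μ) hq.norm.toLp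
  rw [L2.inner_def, Lp.norm_toLp, Lp.norm_toLp, eLpNorm_norm, eLpNorm_norm] at h
  rw [Lp.norm_toLp, Lp.norm_toLp]
  refine le_trans (le_of_eq ?_) h
  refine integral_congr_ae ?_
  filter_upwards [hp.norm.coeFn_toLp, hq.norm.coeFn_toLp] with x h1 h2
  rw [h1, h2]
  simp [mul_comm]

/-! ### Smooth weights built from the Agmon distance -/

namespace EMSystem

variable {d : ℕ} {S : EMSystem d} {γ₁ γ₂ : ℝ} {lam : ℂ} {b : Eucl d → Eucl d}

theorem continuousOn_agmonWeight : ContinuousOn (S.agmonWeight γ₁ γ₂ lam) S.Ω :=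
  ((((continuousOn_const.mul S.continuousOn_V.norm).sub continuousOn_const).sub
    continuousOn_const).sub continuousOn_const).sup continuousOn_const

theorem agmonWeight_nonneg (x : Eucl d) : 0 ≤ S.agmonWeight γ₁ γ₂ lam x := le_max_right _ _

theorem abs_agmonDist_sub_le (hb : S.IsBasePoint b) {z : Eucl d} {r s : ℝ}
    (hball : Metric.ball z r ⊆ S.Ω) (hs : 0 ≤ s)
    (hw : ∀ x ∈ Metric.ball z r, √(S.agmonWeight γ₁ γ₂ lam x) ≤ s) {x y : Eucl d}
    (hx : x ∈ Metric.ball z r) (hy : y ∈ Metric.ball z r) :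
    |S.agmonDist γ₁ γ₂ lam b x - S.agmonDist γ₁ γ₂ lam b y| ≤ s * ‖x - y‖ := by
  rw [abs_sub_le_iff]
  have h1 := agmonDist_le_add hb hball hs hw hx hy
  have h2 := agmonDist_le_add hb hball hs hw hy hx
  rw [norm_sub_rev] at h2
  constructor <;> linarith

theorem continuousOn_agmonDist (hb : S.IsBasePoint b) :
    ContinuousOn (S.agmonDist γ₁ γ₂ lam b) S.Ω := by
  intro x hx
  obtain ⟨r', hr', hr'Ω⟩ := Metric.isOpen_iff.1 S.isOpen_Ω x hx
  have hg := (continuousOn_agmonWeight (S := S) (γ₁ := γ₁) (γ₂ := γ₂) (lam := lam)).sqrt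
  have hgx := (hg x hx).eventually (gt_mem_nhds (lt_add_one _))
  rw [eventually_iff, S.isOpen_Ω.nhdsWithin_eq hx] at hgx
  obtain ⟨r'', hr'', hgr⟩ := Metric.mem_nhds_iff.1 hgx
  have hb1 : Metric.ball x (min r' r'') ⊆ Metric.ball x r' := Metric.ball_subset_ball (by simp)
  have hb2 : Metric.ball x (min r' r'') ⊆ Metric.ball x r'' := Metric.ball_subset_ball (by simp)
  have hx' : x ∈ Metric.ball x (min r' r'') := Metric.mem_ball_self (by positivity)
  refine ContinuousAt.continuousWithinAt (continuousAt_of_locally_lipschitz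
    (r := min r' r'') (by positivity) (√(S.agmonWeight γ₁ γ₂ lam x) + 1) fun y hy => ?_)
  rw [Real.dist_eq, dist_eq_norm]
  exact abs_agmonDist_sub_le hb (hb1.trans hr'Ω) (by positivity)
    (fun y hy => le_of_lt (hgr (hb2 hy))) hy hx'

set_option maxHeartbeats 400000 in
/-- Smooth weights approximating a truncated and cut off exponential of the Agmon distance. -/
theorem exists_smooth_weight (hb : S.IsBasePoint b) {a δ : ℝ} (ha : 0 < a) (ha' : a ≤ 1 / 3)
    (hδ : 0 < δ) (N : ℕ) {χ : Eucl d → ℝ} (hχ : ContDiff ℝ ∞ χ) (hχ0 : ∀ x, 0 ≤ χ x)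
    (hχ1 : ∀ x, χ x ≤ 1) (hχd : ∀ x, ‖fderiv ℝ χ x‖ ≤ (Real.exp (a * N + 1))⁻¹ / 6)
    {K : Set (Eucl d)} (hK : IsCompact K) (hKΩ : K ⊆ S.Ω) :
    ∃ θ : Eucl d → ℝ, ContDiff ℝ ∞ θ ∧ (∀ x, χ x = 0 → θ x = 0) ∧ ∀ x ∈ K,
      4 * ‖gradient θ x‖ ^ 2 ≤ (9 / 16 * S.agmonWeight γ₁ γ₂ lam x + δ / 16) * θ x ^ 2 + 1 ∧
      0 ≤ θ x ∧ θ x ≤ Real.exp (a * S.agmonDist γ₁ γ₂ lam b x + 1) ∧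
      θ x ≤ Real.exp (a * N + 1) ∧
      Real.exp (a * min (S.agmonDist γ₁ γ₂ lam b x) N) * χ x ≤ Real.exp 1 * θ x := by
  set D := S.agmonDist γ₁ γ₂ lam b with hD
  set w := S.agmonWeight γ₁ γ₂ lam with hw
  -- 656 = 16 · 41, where 41 is an upper bound for the coefficient 81/2 that η² acquires below.
  obtain ⟨η, hη, hη1, hηδ⟩ : ∃ η > 0, η ≤ 1 ∧ 41 * η ^ 2 ≤ δ / 16 := by
    refine ⟨min 1 (δ / 656), by positivity, by simp, ?_⟩
    have h1 : min 1 (δ / 656) ≤ 1 := by simp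
    have h2 : min 1 (δ / 656) ≤ δ / 656 := by simp
    have h3 : 0 < min 1 (δ / 656) := by positivity
    nlinarith
  obtain ⟨W, hW, hWK⟩ := exists_contDiff_approx_of_local_lipschitz S.isOpen_Ω
    (W := fun x => a * min (D x) N) (g := fun x => a * √(w x))
    (continuousOn_const.mul continuousOn_agmonWeight.sqrt) (fun x => by positivity)
    (by
      intro z r s hball hs hws x hx y hy
      have h1 := abs_agmonDist_sub_le (γ₁ := γ₁) (γ₂ := γ₂) (lam := lam) hb hball
        (s := s / a) (by positivity) (fun x hx => by
          rw [le_div_iff₀ ha, mul_comm]; exact hws x hx) hx hy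
      rw [← mul_sub, abs_mul, abs_of_pos ha]
      have h2 : |min (D x) N - min (D y) N| ≤ |D x - D y| := by
        refine (abs_min_sub_min_le_max _ _ _ _).trans ?_
        simp
      calc a * |min (D x) N - min (D y) N| ≤ a * (s / a * ‖x - y‖) := by
            gcongr; exact h2.trans h1
        _ = s * ‖x - y‖ := by field_simp) hK hKΩ hη
  refine ⟨fun x => Real.exp (W x) * χ x, (Real.contDiff_exp.comp hW).mul hχ,
    fun x hx => by simp [hx], fun x hx => ?_⟩
  obtain ⟨hWx, hWd⟩ := hWK x hx
  set E := Real.exp (W x) with hE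
  have hE0 : 0 < E := Real.exp_pos _
  have hmin1 : min (D x) N ≤ D x := min_le_left _ _
  have hmin2 : min (D x) (N : ℝ) ≤ N := min_le_right _ _
  have hWabs := abs_le.1 hWx
  have hEN : E ≤ Real.exp (a * N + 1) := by
    refine Real.exp_le_exp.2 ?_
    have := mul_le_mul_of_nonneg_left hmin2 ha.le
    linarith [hWabs.2]
  have hED : E ≤ Real.exp (a * D x + 1) := by
    refine Real.exp_le_exp.2 ?_
    have := mul_le_mul_of_nonneg_left hmin1 ha.le
    linarith [hWabs.2]
  have hEχ : E * χ x ≤ E := mul_le_of_le_one_right hE0.le (hχ1 x)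
  refine ⟨?_, mul_nonneg hE0.le (hχ0 x), hEχ.trans hED, hEχ.trans hEN, ?_⟩
  · rw [← norm_fderiv_eq_gradient]
    have h1 : HasFDerivAt (fun x => Real.exp (W x) * χ x) _ x :=
      ((hW.differentiable (by simp) x).hasFDerivAt.exp).mul
        (hχ.differentiable (by simp) x).hasFDerivAt
    have h2 : ‖fderiv ℝ (fun x => Real.exp (W x) * χ x) x‖
        ≤ E * ‖fderiv ℝ χ x‖ + χ x * (E * ‖fderiv ℝ W x‖) := by
      rw [h1.fderiv]
      refine (norm_add_le _ _).trans (le_of_eq ?_)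
      rw [norm_smul, norm_smul, norm_smul, Real.norm_of_nonneg hE0.le,
        Real.norm_of_nonneg (hχ0 x)]
    -- The cutoff is so flat that its gradient remains bounded after multiplication by the weight;
    -- it is paid for by the additive 1 in the gradient condition.
    have h3 : E * ‖fderiv ℝ χ x‖ ≤ 1 / 6 := by
      calc _ ≤ Real.exp (a * N + 1) * ((Real.exp (a * N + 1))⁻¹ / 6) := by
            gcongr; exact hχd x
        _ = 1 / 6 := by field_simp
    have h4 : χ x * (E * ‖fderiv ℝ W x‖) ≤ (E * χ x) * (a * √(w x) + η) := by
      have : 0 ≤ E * χ x := mul_nonneg hE0.le (hχ0 x)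
      calc _ = (E * χ x) * ‖fderiv ℝ W x‖ := by ring
        _ ≤ _ := by gcongr
    set θ := E * χ x with hθ
    have hθ0 : 0 ≤ θ := mul_nonneg hE0.le (hχ0 x)
    have hw0 : 0 ≤ w x := agmonWeight_nonneg x
    set q := √(w x) with hq
    have hq2 : q ^ 2 = w x := Real.sq_sqrt hw0
    have hq0 : 0 ≤ q := Real.sqrt_nonneg _
    have haq : a * q ≤ q / 3 := by nlinarith
    have h5 : ‖fderiv ℝ (fun x => Real.exp (W x) * χ x) x‖ ≤ 1 / 6 + θ * (q / 3 + η) := by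
      have : θ * (a * q + η) ≤ θ * (q / 3 + η) := by gcongr
      linarith
    have h6 := pow_le_pow_left₀ (norm_nonneg _) h5 2
    -- Starting from slope q/3, the two Young inequalities raise 4/9 to 4 · 9/8 · 1/8 = 9/16, still
    -- below 1; the second turns 4 · (1/6)² into exactly 1.
    have h7 : (q / 3 + η) ^ 2 ≤ q ^ 2 / 8 + 9 * η ^ 2 := by
      nlinarith [sq_nonneg (q / 3 - 8 * η)]
    have h8 : (1 / 6 + θ * (q / 3 + η)) ^ 2 ≤ 1 / 4 + 9 / 8 * θ ^ 2 * (q / 3 + η) ^ 2 := by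
      nlinarith [sq_nonneg (8 / 6 - θ * (q / 3 + η))]
    have h9 : 9 / 8 * θ ^ 2 * (q / 3 + η) ^ 2 ≤ 9 / 8 * θ ^ 2 * (q ^ 2 / 8 + 9 * η ^ 2) := by
      gcongr
    have h10 := mul_le_mul_of_nonneg_right hηδ (sq_nonneg θ)
    have h11 : 0 ≤ θ ^ 2 * η ^ 2 := by positivity
    have h12 : 4 * (9 / 8 * θ ^ 2 * (q ^ 2 / 8 + 9 * η ^ 2))
        = 9 / 16 * q ^ 2 * θ ^ 2 + 81 / 2 * (θ ^ 2 * η ^ 2) := by ring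
    have h13 : 41 * η ^ 2 * θ ^ 2 = 41 * (θ ^ 2 * η ^ 2) := by ring
    have h14 : (9 / 16 * w x + δ / 16) * θ ^ 2
        = 9 / 16 * q ^ 2 * θ ^ 2 + δ / 16 * θ ^ 2 := by rw [hq2]; ring
    change _ ≤ (9 / 16 * w x + δ / 16) * θ ^ 2 + 1
    rw [h14]
    linarith
  · rw [← mul_assoc, ← Real.exp_add]
    refine mul_le_mul_of_nonneg_right (Real.exp_le_exp.2 ?_) (hχ0 x)
    linarith [hWabs.1]

end EMSystem

/-! ### From test functions to functions in the domain of the operator -/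

namespace EMSystem

variable {d : ℕ} {S : EMSystem d} {γ₁ γ₂ : ℝ} {lam : ℂ} {b : Eucl d → Eucl d}

theorem norm_toLp_sq_eq_integral {f : Eucl d → ℂ} (hf : IsC1Test S.Ω f) :
    ‖(hf.memLp.toLp : LTwo S.Ω)‖ ^ 2 = ∫ x, ‖f x‖ ^ 2 := by
  have h := inner_toLp_toLp hf hf
  rw [inner_self_eq_norm_sq_to_K] at h
  have e : ∫ x, f x * conj (f x) = ((∫ x, ‖f x‖ ^ 2 : ℝ) : ℂ) := by
    rw [← integral_complex_ofReal]
    refine integral_congr_ae (Eventually.of_forall fun x => ?_)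
    simp only [Complex.mul_conj']
    push_cast
    rfl
  rw [e] at h
  refine Complex.ofReal_injective ?_
  rw [Complex.ofReal_pow]
  exact h

/-- Here φ approximates ψ, and Q(φ, u) - λ⟨φ, u⟩ splits into ⟨(ℒ - λ)ψ, u⟩ and the form applied to φ
- ψ. The first is bounded linearly in ‖θφ‖ by the decay of (ℒ - λ)ψ; the second is small with φ - ψ
in H¹_A. -/
theorem norm_shiftedForm_le {ψ : S.op.domain} {D : Eucl d → ℝ} {a : ℝ}
    (hf₀ : MemLp (fun x => ((Real.exp (a * D x) : ℝ) : ℂ)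
      * (S.op ψ - lam • (ψ : LTwo S.Ω) : LTwo S.Ω) x) 2 (volume.restrict S.Ω))
    {φ : Eucl d → ℂ} (hφ : IsC1Test S.Ω φ) {θ : Eucl d → ℝ}
    (hf : IsC1Test S.Ω (fun y => (θ y : ℂ) * φ y))
    (hθ0 : ∀ x ∈ tsupport φ, 0 ≤ θ x ∧ θ x ≤ Real.exp (a * D x + 1))
    {g : Eucl d → ℝ} (hg : ContDiffOn ℝ 1 g S.Ω) (hgθ : ∀ x, |g x| ≤ θ x ^ 2) {G C : ℝ}
    (hC : 0 ≤ C) (hG : 0 ≤ G)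
    (hgG : ∀ x ∈ tsupport φ, |g x| ≤ G ∧ ‖fderiv ℝ g x‖ ≤ G ∧ (g x ≠ 0 → ‖S.V x‖ ≤ C)) :
    ‖S.shiftedForm lam φ (fun y => (g y : ℂ) * φ y)‖
      ≤ Real.exp 1 * (‖hf₀.toLp‖ * ‖(hf.memLp.toLp : LTwo S.Ω)‖)
        + (2 * d + C + ‖lam‖) * G
          * (S.normH1A (hφ.memLp.toLp - (ψ : LTwo S.Ω)) * S.normH1A hφ.memLp.toLp) := by
  set hu := hφ.ofReal_mul hg with hudef
  set v : LTwo S.Ω := hφ.memLp.toLp with hv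
  set u : LTwo S.Ω := hu.memLp.toLp with hudef'
  set f₀ : LTwo S.Ω := S.op ψ - lam • (ψ : LTwo S.Ω) with hf₀def
  have hψ : (ψ : LTwo S.Ω) ∈ S.formDomain := ψ.2.1
  have hw : v - (ψ : LTwo S.Ω) ∈ S.formDomain := sub_mem hφ.mem_formDomain hψ
  have e : S.shiftedForm lam φ (fun y => (g y : ℂ) * φ y)
      = inner ℂ u f₀ + (S.Q (v - ψ) u - lam * inner ℂ u (v - (ψ : LTwo S.Ω))) := by
    rw [shiftedForm_eq hφ hu, ← hv]
    have h1 := Q_add_left hψ hw hu.mem_formDomain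
    rw [add_sub_cancel] at h1
    rw [h1, Q_eq_inner_op S ψ hu.mem_formDomain, hf₀def, inner_sub_right, inner_sub_right,
      inner_smul_right]
    ring
  -- One factor θ of |g| ≤ θ² is traded for e · e^{aD} and given to (ℒ - λ)ψ; the other stays with
  -- φ.
  have h1 : ‖inner ℂ u f₀‖ ≤ Real.exp 1 * (‖hf₀.toLp‖ * ‖(hf.memLp.toLp : LTwo S.Ω)‖) := by
    rw [L2.inner_def]
    have h2 := integral_norm_mul_norm_le hf₀ hf.memLp
    have i1 := hf₀.norm.integrable_mul hf.memLp.norm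
    refine le_trans ?_ (mul_le_mul_of_nonneg_left h2 (Real.exp_pos 1).le)
    rw [← integral_const_mul]
    refine norm_integral_le_of_norm_le (i1.const_mul _) ?_
    filter_upwards [hu.memLp.coeFn_toLp] with x hx
    rw [hx, RCLike.inner_apply, norm_mul, RCLike.norm_conj]
    by_cases hxs : x ∈ tsupport φ
    · obtain ⟨h3, h4⟩ := hθ0 x hxs
      have h5 : ‖(g x : ℂ) * φ x‖ ≤ (Real.exp 1 * Real.exp (a * D x)) * (θ x * ‖φ x‖) := by
        rw [norm_mul, Complex.norm_real, ← mul_assoc]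
        refine mul_le_mul_of_nonneg_right ?_ (norm_nonneg _)
        refine (hgθ x).trans ?_
        rw [sq, ← Real.exp_add, add_comm 1]
        exact mul_le_mul_of_nonneg_right h4 h3
      simp only [norm_mul, Complex.norm_real, Real.norm_of_nonneg h3,
        Real.norm_of_nonneg (Real.exp_pos _).le] at h5 ⊢
      calc ‖f₀ x‖ * (‖g x‖ * ‖φ x‖)
          ≤ ‖f₀ x‖ * ((Real.exp 1 * Real.exp (a * D x)) * (θ x * ‖φ x‖)) := by gcongr
        _ = _ := by ring
    · have h0 : φ x = 0 := image_eq_zero_of_notMem_tsupport hxs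
      simp [h0]
  rw [e]
  exact (norm_add_le _ _).trans (add_le_add h1 (norm_form_mul_le lam hφ hg hC hG hgG))

theorem normH1A_sub_comm {u v : LTwo S.Ω} (hu : u ∈ S.H1A) (hv : v ∈ S.H1A) :
    S.normH1A (u - v) = S.normH1A (v - u) := by
  have h := normH1A_smul (sub_mem hv hu) (-1 : ℂ)
  rw [neg_one_smul, neg_sub] at h
  simpa using h

theorem _root_.eLpNorm_le_of_norm_le_add {α : Type*} [MeasurableSpace α] {μ ν : Measure α}
    {h p q : α → ℂ} (hμν : μ ≤ ν) (hp : MemLp p 2 ν) (hq : MemLp q 2 ν) {A B : ℝ} (hA : 0 ≤ A)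
    (hB : 0 ≤ B) (hle : ∀ᵐ x ∂μ, ‖h x‖ ≤ A * ‖p x‖ + B * ‖q x‖) :
    eLpNorm h 2 μ ≤ ENNReal.ofReal (A * ‖hp.toLp‖ + B * ‖hq.toLp‖) := by
  calc eLpNorm h 2 μ ≤ eLpNorm (fun x => A * ‖p x‖ + B * ‖q x‖) 2 μ := eLpNorm_mono_ae_real hle
    _ ≤ eLpNorm ((fun x => A * ‖p x‖) + fun x => B * ‖q x‖) 2 ν := eLpNorm_mono_measure _ hμν
    _ ≤ eLpNorm (fun x => A * ‖p x‖) 2 ν + eLpNorm (fun x => B * ‖q x‖) 2 ν :=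
        eLpNorm_add_le (hp.1.norm.const_mul _) (hq.1.norm.const_mul _) (by norm_num)
    _ = ENNReal.ofReal A * eLpNorm p 2 ν + ENNReal.ofReal B * eLpNorm q 2 ν := by
        congr 1
        · rw [← Real.enorm_of_nonneg hA, ← eLpNorm_norm p]
          exact eLpNorm_const_smul A _ _ _
        · rw [← Real.enorm_of_nonneg hB, ← eLpNorm_norm q]
          exact eLpNorm_const_smul B _ _ _
    _ = _ := by
        rw [Lp.norm_toLp, Lp.norm_toLp, ENNReal.ofReal_add (by positivity) (by positivity),
          ENNReal.ofReal_mul hA, ENNReal.ofReal_mul hB, ENNReal.ofReal_toReal hp.2.ne,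
          ENNReal.ofReal_toReal hq.2.ne]

set_option maxHeartbeats 1600000 in
/-- Uniform bounds for truncations, in the resolvent form: if `(ℒ - lam) ψ` decays, so does `ψ`. -/
theorem exists_bound_truncated (hd : 1 ≤ d) (hγ₁ : 0 < γ₁) (hbound : S.PotentialBound γ₁ γ₂)
    {δ : ℝ} (hδ : 0 < δ) {R : ℝ}
    (hκ : ∀ x ∈ S.Ω, R ≤ ‖x‖ → δ ≤ γ₁ * ‖S.V x‖ - lam.re - |lam.im| - γ₂)
    (hb : S.IsBasePoint b) {a : ℝ} (ha : 0 < a) (ha' : a ≤ 1 / 3) (ψ : S.op.domain)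
    (hf₀ : MemLp (fun x => ((Real.exp (a * S.agmonDist γ₁ γ₂ lam b x) : ℝ) : ℂ)
      * (S.op ψ - lam • (ψ : LTwo S.Ω) : LTwo S.Ω) x) 2 (volume.restrict S.Ω)) :
    ∃ K : ℝ, ∀ N : ℕ, eLpNorm (fun x =>
      ((Real.exp (a * min (S.agmonDist γ₁ γ₂ lam b x) N) : ℝ) : ℂ) * (ψ : LTwo S.Ω) x) 2
      ((volume.restrict S.Ω).restrict (Metric.ball 0 N)) ≤ ENNReal.ofReal K := by
  set D := S.agmonDist γ₁ γ₂ lam b with hD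
  obtain ⟨C, hC0, hC⟩ := exists_agmon_estimate_test hd hbound hγ₁ hδ hκ
    (continuousOn_agmonDist (γ₁ := γ₁) (γ₂ := γ₂) (lam := lam) hb) ha.le
  set M := ‖hf₀.toLp‖ with hM
  have hM0 : 0 ≤ M := norm_nonneg _
  set P := S.normH1A ψ with hP
  have hP0 : 0 ≤ P := normH1A_nonneg _
  have hψ : (ψ : LTwo S.Ω) ∈ S.H1A0 := ψ.2.1.1
  set e₁ := Real.exp 1 with he₁
  have he₁0 : 0 < e₁ := Real.exp_pos 1
  set K₁ := (C * (P + 1) ^ 2 + 2 + 16 * (e₁ * M) ^ 2 / δ) * (8 / δ) with hK₁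
  -- Everything in this bound is fixed before N. The constants T, L, G, Q₀ below do depend on N, but
  -- they enter only through products with the approximation error t.
  refine ⟨1 + e₁ * √K₁, fun N => ?_⟩
  set T := Real.exp (a * N + 1) with hT
  have hT0 : 0 < T := Real.exp_pos _
  obtain ⟨χ, hχ, hχ0, hχ1, hχb, hχd, R', hR'⟩ := exists_cutoff d N
    (ε := T⁻¹ / 6) (by positivity)
  obtain ⟨CV, hCV0, hCV⟩ := S.exists_bound_V R'
  obtain ⟨CΦ, hCΦ0, hCΦ⟩ := exists_bound_fderiv_Φ hd hγ₁ hbound R'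
  set wb := γ₁ * CV + |lam.re + |lam.im| + γ₂| with hwb
  have hwb0 : 0 ≤ wb := by positivity
  -- The weight θ will be built on the support of φ, which is not yet chosen. Its size T and
  -- gradient bound L must be known beforehand, and they depend on N and the cutoff only.
  set L := √((9 / 16 * wb + δ / 16) * T ^ 2 + 1) with hL
  have hL0 : 0 ≤ L := Real.sqrt_nonneg _
  set G := T ^ 2 * (1 + CΦ) + 2 * T * L with hG
  have hG0 : 0 ≤ G := by positivity
  set Q₀ := (2 * d + CV + ‖lam‖) * G with hQ₀
  have hQ₀0 : 0 ≤ Q₀ := by positivity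
  -- T t ≤ 1 controls the weighted difference of ψ and φ; the last condition makes the form applied
  -- to that difference contribute at most 1.
  obtain ⟨t, ht, ht1, htT, htQ⟩ : ∃ t > 0, t ≤ 1 ∧ T * t ≤ 1 ∧ Q₀ * (t * (2 * (P + 1))) ≤ 1 := by
    refine ⟨min 1 (min T⁻¹ (1 / (Q₀ * (2 * (P + 1)) + 1))), by positivity, by simp, ?_, ?_⟩
    · have h1 : min 1 (min T⁻¹ (1 / (Q₀ * (2 * (P + 1)) + 1))) ≤ T⁻¹ :=
        (min_le_right _ _).trans (min_le_left _ _)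
      calc _ ≤ T * T⁻¹ := by gcongr
        _ = 1 := mul_inv_cancel₀ hT0.ne'
    · have h1 : min 1 (min T⁻¹ (1 / (Q₀ * (2 * (P + 1)) + 1))) ≤ 1 / (Q₀ * (2 * (P + 1)) + 1) :=
        (min_le_right _ _).trans (min_le_right _ _)
      have h2 : 0 < min 1 (min T⁻¹ (1 / (Q₀ * (2 * (P + 1)) + 1))) := by positivity
      rw [le_div_iff₀ (by positivity)] at h1
      nlinarith
  obtain ⟨φ, v, hφ, hvφ, hv, hlt⟩ := hψ.2 t ht
  have hφ1 := hφ.isC1Test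
  have hve : v = hφ1.memLp.toLp := Lp.ext (hvφ.trans hφ1.memLp.coeFn_toLp.symm)
  have hlt' : S.normH1A (v - (ψ : LTwo S.Ω)) < t := by rwa [normH1A_sub_comm hv hψ.1]
  have hvP : S.normH1A v ≤ 2 * (P + 1) := by
    have h := normH1A_add_le hψ.1 (sub_mem hv hψ.1)
    rw [add_sub_cancel] at h
    linarith
  have hvn : ‖v‖ ≤ P + 1 := by
    have h1 : ‖v‖ ≤ ‖(ψ : LTwo S.Ω)‖ + ‖v - (ψ : LTwo S.Ω)‖ := by
      simpa using norm_add_le (ψ : LTwo S.Ω) (v - (ψ : LTwo S.Ω))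
    have h2 := norm_le_normH1A (ψ : LTwo S.Ω)
    have h3 := norm_le_normH1A (v - (ψ : LTwo S.Ω))
    linarith
  obtain ⟨θ, hθ, hθχ, hθK⟩ := exists_smooth_weight (γ₁ := γ₁) (γ₂ := γ₂) (lam := lam) hb ha ha' hδ
    N hχ hχ0 hχ1 hχd hφ.2.1.isCompact hφ.2.2
  have hθ1 : ContDiff ℝ 1 θ := hθ.of_le (by simp)
  have hf : IsC1Test S.Ω (fun y => (θ y : ℂ) * φ y) := hφ1.ofReal_mul hθ1.contDiffOn
  set Y := ‖(hf.memLp.toLp : LTwo S.Ω)‖ with hY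
  have hY0 : 0 ≤ Y := norm_nonneg _
  have hYint : ∫ x, θ x ^ 2 * ‖φ x‖ ^ 2 = Y ^ 2 := by
    rw [hY, norm_toLp_sq_eq_integral hf]
    refine integral_congr_ae (Eventually.of_forall fun x => ?_)
    simp [mul_pow]
  have hφint : ∫ x, ‖φ x‖ ^ 2 = ‖v‖ ^ 2 := by rw [hve, norm_toLp_sq_eq_integral hφ1]
  have hest := hC φ θ hφ hθ (fun x hx => (hθK x hx).1) (fun x hx => by
    obtain ⟨-, h0, h1, -⟩ := hθK x hx
    calc θ x ^ 2 ≤ Real.exp (a * D x + 1) ^ 2 := by gcongr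
      _ = Real.exp (2 * (a * D x) + 2) := by
          rw [← Real.exp_nat_mul]; congr 1; push_cast; ring)
  rw [hYint, hφint] at hest
  have hθR : ∀ x, θ x ≠ 0 → ‖x‖ ≤ R' := fun x hx => hR' x fun h => hx (hθχ x h)
  have hθT : ∀ x ∈ tsupport φ, |θ x| ≤ T := fun x hx => by
    obtain ⟨-, h0, -, h1, -⟩ := hθK x hx
    rwa [abs_of_nonneg h0]
  have hθL : ∀ x ∈ tsupport φ, θ x ≠ 0 → ‖fderiv ℝ θ x‖ ≤ L := by
    intro x hx hx0
    obtain ⟨h1, -⟩ := hθK x hx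
    have hVx := hCV x (hφ.2.2 hx) (hθR x hx0)
    have hwx : S.agmonWeight γ₁ γ₂ lam x ≤ wb := by
      refine max_le ?_ hwb0
      have := mul_le_mul_of_nonneg_left hVx hγ₁.le
      have := neg_abs_le (lam.re + |lam.im| + γ₂)
      rw [hwb]
      linarith
    rw [norm_fderiv_eq_gradient]
    refine Real.le_sqrt_of_sq_le ?_
    have h3 : θ x ^ 2 ≤ T ^ 2 := sq_le_sq' (abs_le.1 (hθT x hx)).1 (abs_le.1 (hθT x hx)).2
    have h4 : (9 / 16 * S.agmonWeight γ₁ γ₂ lam x + δ / 16) * θ x ^ 2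
        ≤ (9 / 16 * wb + δ / 16) * T ^ 2 := by
      gcongr
    have h5 := sq_nonneg ‖gradient θ x‖
    linarith
  have hθfd : ∀ x, fderiv ℝ (fun y => θ y ^ 2) x = (2 * θ x) • fderiv ℝ θ x := by
    intro x
    rw [((hθ1.differentiable (by simp) x).hasFDerivAt.pow 2).fderiv]
    simp
  have hfd2 : ∀ x ∈ tsupport φ, ‖fderiv ℝ (fun y => θ y ^ 2) x‖ ≤ 2 * T * L := by
    intro x hx
    rw [hθfd, norm_smul, Real.norm_eq_abs, abs_mul, abs_two]
    by_cases hx0 : θ x = 0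
    · rw [hx0, abs_zero, mul_zero, zero_mul]; positivity
    · have := hθT x hx
      have := hθL x hx hx0
      gcongr
  have hsqT : ∀ x ∈ tsupport φ, θ x ^ 2 ≤ T ^ 2 := fun x hx =>
    sq_le_sq' (abs_le.1 (hθT x hx)).1 (abs_le.1 (hθT x hx)).2
  have hθ0' : ∀ x ∈ tsupport φ, 0 ≤ θ x ∧ θ x ≤ Real.exp (a * D x + 1) := fun x hx =>
    ⟨(hθK x hx).2.1, (hθK x hx).2.2.1⟩
  have hTG : T ^ 2 ≤ G := by
    have : 0 ≤ T ^ 2 * CΦ := by positivity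
    have : 0 ≤ 2 * T * L := by positivity
    rw [hG]; linarith
  have hfin : e₁ * (M * Y) + Q₀ * (S.normH1A (v - (ψ : LTwo S.Ω)) * S.normH1A v) ≤ e₁ * (M * Y) + 1 := by
    refine add_le_add le_rfl (le_trans ?_ htQ)
    have := normH1A_nonneg v
    have := normH1A_nonneg (v - (ψ : LTwo S.Ω))
    gcongr
  have hT1 : ‖S.shiftedForm lam φ (fun y => ((θ y ^ 2 : ℝ) : ℂ) * φ y)‖ ≤ e₁ * (M * Y) + 1 := by
    refine le_trans ?_ hfin
    rw [hve]
    refine norm_shiftedForm_le (g := fun y => θ y ^ 2) hf₀ hφ1 hf hθ0' (hθ1.pow 2).contDiffOn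
      (fun x => by rw [abs_of_nonneg (sq_nonneg _)]) hCV0 hG0 fun x hx => ⟨?_, ?_, fun h => ?_⟩
    · rw [abs_of_nonneg (sq_nonneg _)]
      exact (hsqT x hx).trans hTG
    · refine (hfd2 x hx).trans ?_
      rw [hG]
      exact le_add_of_nonneg_left (by positivity)
    · exact hCV x (hφ.2.2 hx) (hθR x fun h0 => h (by simp [h0]))
  have hT2 : ‖S.shiftedForm lam φ (fun y => ((S.Φ y * θ y ^ 2 : ℝ) : ℂ) * φ y)‖
      ≤ e₁ * (M * Y) + 1 := by
    refine le_trans ?_ hfin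
    rw [hve]
    have habs : ∀ x, |S.Φ x * θ x ^ 2| ≤ θ x ^ 2 := fun x => by
      rw [abs_mul, abs_of_nonneg (sq_nonneg (θ x))]
      exact mul_le_of_le_one_left (sq_nonneg _) (S.abs_Φ_le_one x)
    refine norm_shiftedForm_le (g := fun y => S.Φ y * θ y ^ 2) hf₀ hφ1 hf hθ0'
      (S.contDiffOn_Φ.mul (hθ1.pow 2).contDiffOn) habs hCV0 hG0
      fun x hx => ⟨?_, ?_, fun h => ?_⟩
    · exact (habs x).trans ((hsqT x hx).trans hTG)
    · have hxΩ := hφ.2.2 hx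
      have hΦx : HasFDerivAt S.Φ (fderiv ℝ S.Φ x) x :=
        ((S.contDiffOn_Φ.contDiffAt (S.isOpen_Ω.mem_nhds hxΩ)).differentiableAt
          (by simp)).hasFDerivAt
      have hθx : HasFDerivAt (fun y => θ y ^ 2) (fderiv ℝ (fun y => θ y ^ 2) x) x :=
        ((hθ1.pow 2).differentiable (by simp) x).hasFDerivAt
      have h1 : HasFDerivAt (fun y => S.Φ y * θ y ^ 2) _ x := hΦx.mul hθx
      rw [h1.fderiv]
      refine (norm_add_le _ _).trans ?_
      rw [norm_smul, norm_smul, Real.norm_of_nonneg (sq_nonneg (θ x))]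
      have h2 : θ x ^ 2 * ‖fderiv ℝ S.Φ x‖ ≤ T ^ 2 * (1 + CΦ) := by
        by_cases hx0 : θ x = 0
        · rw [hx0, zero_pow two_ne_zero, zero_mul]; positivity
        · have h3 := hCΦ x hxΩ (hθR x hx0)
          exact mul_le_mul (hsqT x hx) (by linarith) (norm_nonneg _) (by positivity)
      have h3 : ‖S.Φ x‖ * ‖fderiv ℝ (fun y => θ y ^ 2) x‖ ≤ 2 * T * L :=
        (mul_le_of_le_one_left (norm_nonneg _) (S.abs_Φ_le_one x)).trans (hfd2 x hx)
      linarith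
    · exact hCV x (hφ.2.2 hx) (hθR x fun h0 => h (by simp [h0]))
  have hr1 := (Complex.re_le_norm _).trans hT1
  have hr2 := ((le_abs_self _).trans (Complex.abs_im_le_norm _)).trans hT2
  -- The linear term 2e₁MY takes δ/16 from the 3δ/16 on the left, leaving δ/8. The summand 2 in K₁
  -- collects the two approximation errors.
  have hYK : Y ≤ √K₁ := by
    refine Real.le_sqrt_of_sq_le ?_
    have h1 : C * ‖v‖ ^ 2 ≤ C * (P + 1) ^ 2 := by gcongr
    have h2 : 2 * (e₁ * (M * Y)) ≤ δ / 16 * Y ^ 2 + 16 * (e₁ * M) ^ 2 / δ := by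
      have h3 : δ / 16 * Y ^ 2 + 16 * (e₁ * M) ^ 2 / δ - 2 * (e₁ * (M * Y))
          = (δ * Y / 16 - e₁ * M) ^ 2 * (16 / δ) := by
        field_simp
        ring
      have h4 : 0 ≤ (δ * Y / 16 - e₁ * M) ^ 2 * (16 / δ) := by positivity
      linarith
    have h5 : δ / 8 * Y ^ 2 ≤ C * (P + 1) ^ 2 + 2 + 16 * (e₁ * M) ^ 2 / δ := by linarith
    calc Y ^ 2 = δ / 8 * Y ^ 2 * (8 / δ) := by field_simp
      _ ≤ _ := by rw [hK₁]; gcongr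
  -- ψ is split into ψ - φ, weighted by at most T, and φ, for which the truncated exponential is at
  -- most e₁θ since the cutoff equals 1 on the ball.
  have hmain := eLpNorm_le_of_norm_le_add (μ := (volume.restrict S.Ω).restrict (Metric.ball 0 N))
    (h := fun x => ((Real.exp (a * min (D x) N) : ℝ) : ℂ) * (ψ : LTwo S.Ω) x)
    Measure.restrict_le_self (Lp.memLp (v - (ψ : LTwo S.Ω))) hf.memLp hT0.le he₁0.le (by
      filter_upwards [ae_restrict_of_ae hvφ, ae_restrict_of_ae (Lp.coeFn_sub v (ψ : LTwo S.Ω)),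
        ae_restrict_mem Metric.isOpen_ball.measurableSet] with x h1 h2 h3
      rw [h2, Pi.sub_apply, h1, norm_mul, norm_mul, Complex.norm_real, Complex.norm_real,
        Real.norm_of_nonneg (Real.exp_pos _).le]
      have hET : Real.exp (a * min (D x) N) ≤ T := by
        refine Real.exp_le_exp.2 ?_
        have := mul_le_mul_of_nonneg_left (min_le_right (D x) (N : ℝ)) ha.le
        linarith
      have h4 : Real.exp (a * min (D x) N) * ‖φ x‖ ≤ e₁ * (‖θ x‖ * ‖φ x‖) := by
        by_cases hx : x ∈ tsupport φ
        · obtain ⟨-, h0, -, -, h5⟩ := hθK x hx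
          rw [hχb x h3, mul_one] at h5
          rw [Real.norm_of_nonneg h0, ← mul_assoc]
          exact mul_le_mul_of_nonneg_right h5 (norm_nonneg _)
        · simp [image_eq_zero_of_notMem_tsupport hx]
      have h5 : ‖(ψ : LTwo S.Ω) x‖ ≤ ‖φ x - (ψ : LTwo S.Ω) x‖ + ‖φ x‖ := by
        have := norm_sub_le (φ x) (φ x - (ψ : LTwo S.Ω) x)
        rw [sub_sub_cancel] at this
        linarith
      calc _ ≤ Real.exp (a * min (D x) N) * (‖φ x - (ψ : LTwo S.Ω) x‖ + ‖φ x‖) := by gcongr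
        _ = Real.exp (a * min (D x) N) * ‖φ x - (ψ : LTwo S.Ω) x‖
            + Real.exp (a * min (D x) N) * ‖φ x‖ := by ring
        _ ≤ _ := by gcongr)
  refine hmain.trans (ENNReal.ofReal_le_ofReal ?_)
  rw [Lp.toLp_coeFn]
  refine add_le_add (le_trans ?_ htT) (by gcongr)
  have := (norm_le_normH1A (v - (ψ : LTwo S.Ω))).trans hlt'.le
  gcongr

/-- If `(ℒ - lam) ψ` decays exponentially for the Agmon distance, then so does `ψ`. -/
theorem memLp_exp_agmonDist (hd : 1 ≤ d) (hγ₁ : 0 < γ₁) (hbound : S.PotentialBound γ₁ γ₂)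
    {δ : ℝ} (hδ : 0 < δ) {R : ℝ}
    (hκ : ∀ x ∈ S.Ω, R ≤ ‖x‖ → δ ≤ γ₁ * ‖S.V x‖ - lam.re - |lam.im| - γ₂)
    (hb : S.IsBasePoint b) {a : ℝ} (ha : 0 < a) (ha' : a ≤ 1 / 3) (ψ : S.op.domain)
    (hf₀ : MemLp (fun x => ((Real.exp (a * S.agmonDist γ₁ γ₂ lam b x) : ℝ) : ℂ)
      * (S.op ψ - lam • (ψ : LTwo S.Ω) : LTwo S.Ω) x) 2 (volume.restrict S.Ω)) :
    MemLp (fun x => ((Real.exp (a * S.agmonDist γ₁ γ₂ lam b x) : ℝ) : ℂ) * (ψ : LTwo S.Ω) x) 2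
      (volume.restrict S.Ω) := by
  obtain ⟨K, hK⟩ := exists_bound_truncated hd hγ₁ hbound hδ hκ hb ha ha' ψ hf₀
  set D := S.agmonDist γ₁ γ₂ lam b with hD
  have hDc : ContinuousOn D S.Ω := continuousOn_agmonDist hb
  have hm : ∀ {h : Eucl d → ℝ}, ContinuousOn h S.Ω → AEStronglyMeasurable
      (fun x => ((Real.exp (a * h x) : ℝ) : ℂ) * (ψ : LTwo S.Ω) x) (volume.restrict S.Ω) :=
    fun hh => ((Complex.continuous_ofReal.comp_continuousOn
      (Real.continuous_exp.comp_continuousOn (continuousOn_const.mul hh))).aestronglyMeasurable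
      S.isOpen_Ω.measurableSet).mul (Lp.memLp (ψ : LTwo S.Ω)).1
  refine ⟨hm hDc, ?_⟩
  set F : ℕ → Eucl d → ℂ := fun N => (Metric.ball (0 : Eucl d) N).indicator fun x =>
    ((Real.exp (a * min (D x) N) : ℝ) : ℂ) * (ψ : LTwo S.Ω) x with hF
  have hFm : ∀ N, AEStronglyMeasurable (F N) (volume.restrict S.Ω) := fun N =>
    (hm (hDc.inf continuousOn_const)).indicator Metric.isOpen_ball.measurableSet
  have hlim : ∀ x, Tendsto (fun N => F N x) atTop
      (𝓝 (((Real.exp (a * D x) : ℝ) : ℂ) * (ψ : LTwo S.Ω) x)) := by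
    intro x
    -- At a fixed point the truncations are eventually constant in N, so Fatou's lemma applies with
    -- the bound uniform in N.
    refine tendsto_const_nhds.congr' ?_
    obtain ⟨n, hn⟩ := exists_nat_gt (max ‖x‖ (D x))
    filter_upwards [eventually_ge_atTop n] with N hN
    have hN' : (n : ℝ) ≤ N := by exact_mod_cast hN
    have h1 : x ∈ Metric.ball (0 : Eucl d) N := by
      rw [mem_ball_zero_iff]
      exact ((le_max_left _ _).trans_lt hn).trans_le hN'
    have h2 : min (D x) (N : ℝ) = D x :=
      min_eq_left (((le_max_right _ _).trans hn.le).trans hN')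
    rw [hF]
    simp only [indicator_of_mem h1, h2]
  have hle := Lp.eLpNorm_lim_le_liminf_eLpNorm (p := 2) hFm _ (Eventually.of_forall hlim)
  refine hle.trans_lt (lt_of_le_of_lt ?_ (ENNReal.ofReal_lt_top (r := K)))
  refine (liminf_le_liminf (Eventually.of_forall fun N => ?_)).trans
    (liminf_const (ENNReal.ofReal K)).le
  rw [hF]
  simp only
  rw [eLpNorm_indicator_eq_eLpNorm_restrict Metric.isOpen_ball.measurableSet]
  exact hK N

/-- For bounded Ω the filter defining V_∞ is trivial, and any R beyond Ω works. -/
theorem exists_norm_le_of_lt_VInfty (S : EMSystem d) {c : ℝ} (hc : ENNReal.ofReal c < S.VInfty) :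
    ∃ R, ∀ x ∈ S.Ω, R ≤ ‖x‖ → c ≤ ‖S.V x‖ := by
  have h := eventually_lt_of_lt_liminf hc
  rw [eventually_inf_principal, ← comap_norm_atTop, eventually_comap] at h
  obtain ⟨R, hR⟩ := h.exists_forall_of_atTop
  refine ⟨R, fun x hx hxR => ?_⟩
  have := hR ‖x‖ hxR x rfl hx
  exact (ENNReal.ofReal_lt_ofReal_iff'.1 this).1.le

end EMSystem

end

/-- Agmon-type exponential decay of the eigenfunctions, and of all elements of the algebraic
eigenspace, of `ℒ` for a spectral point `lam` in the region `ρ_{γ₂ - γ₁ Vc}`, `0 < Vc < V_∞`. -/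
theorem mainTheorem1 {d : ℕ} (hd : 1 ≤ d) (S : EMSystem d)
    (γ₁ γ₂ : ℝ) (hγ₁ : 0 < γ₁) (hbound : S.PotentialBound γ₁ γ₂)
    (Vc : ℝ) (hVc_pos : 0 < Vc) (hVc_lt : ENNReal.ofReal Vc < S.VInfty)
    (lam : ℂ) (hlam : lam ∈ unboundedSpectrum S.op ∩ regionRho (γ₂ - γ₁ * Vc))
    (b : Eucl d → Eucl d) (hb : S.IsBasePoint b)
    (ε : ℝ) (hε : ε ∈ Set.Ioo (0 : ℝ) 1) :
    (∀ ψ : S.op.domain, ψ ≠ 0 → S.op ψ = lam • (ψ : LTwo S.Ω) →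
      MemLp (fun x => ((Real.exp ((1 - ε) / 3 * S.agmonDist γ₁ γ₂ lam b x) : ℝ) : ℂ)
        * (ψ : LTwo S.Ω) x) 2 (volume.restrict S.Ω)) ∧
    (∀ ψ ∈ algebraicEigenspace S.op lam,
      MemLp (fun x => ((Real.exp ((1 - ε) / 3 * S.agmonDist γ₁ γ₂ lam b x) : ℝ) : ℂ)
        * ψ x) 2 (volume.restrict S.Ω)) := by
  obtain ⟨hε0, hε1⟩ := hε
  have ha : 0 < (1 - ε) / 3 := by linarith
  have ha' : (1 - ε) / 3 ≤ 1 / 3 := by linarith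
  set a := (1 - ε) / 3
  obtain ⟨R, hR⟩ := EMSystem.exists_norm_le_of_lt_VInfty S hVc_lt
  -- Membership in ρ says that this number is positive; it is the lower bound δ for the Agmon weight
  -- far away, where |V| ≥ Vc.
  have hδ : 0 < -(γ₂ - γ₁ * Vc) - lam.re - |lam.im| := hlam.2
  have hκ : ∀ x ∈ S.Ω, R ≤ ‖x‖ → -(γ₂ - γ₁ * Vc) - lam.re - |lam.im|
      ≤ γ₁ * ‖S.V x‖ - lam.re - |lam.im| - γ₂ := fun x hx hxR => by
    have := mul_le_mul_of_nonneg_left (hR x hx hxR) hγ₁.le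
    linarith
  have step := fun ψ : S.op.domain =>
    EMSystem.memLp_exp_agmonDist hd hγ₁ hbound hδ hκ hb ha ha' ψ
  have zero : ∀ f : LTwo S.Ω, f = 0 →
      MemLp (fun x => ((Real.exp (a * S.agmonDist γ₁ γ₂ lam b x) : ℝ) : ℂ) * f x) 2
        (volume.restrict S.Ω) := by
    rintro f rfl
    refine (memLp_congr_ae ?_).2 (MemLp.zero (ε := ℂ))
    filter_upwards [Lp.coeFn_zero ℂ 2 (volume.restrict S.Ω)] with x hx
    rw [show ((0 : LTwo S.Ω) : Eucl d → ℂ) x = 0 from hx, mul_zero]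
    rfl
  refine ⟨fun ψ _ h => step ψ (zero _ (sub_eq_zero.2 h)), fun ψ hψ => ?_⟩
  obtain ⟨k, -, hk⟩ := mem_iUnion₂.1 hψ
  clear hψ
  -- (ℒ - λ)ψ lies in the previous kernel and decays by induction, so the resolvent form of the
  -- estimate passes the decay on to ψ at the same rate.
  induction k generalizing ψ with
  | zero => exact zero ψ hk
  | succ k ih =>
    obtain ⟨hu, h⟩ := hk
    exact step ⟨ψ, hu⟩ (ih _ h)
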